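/- Let $m,n\ge 1$, let $F\in C^\infty(\mathbb R^m)$ and $\vec f=(f_1,\dots,f_m)=\nabla F$, let $t_1\le T\le t_2$ be real numbers and let $x_0\in\mathbb R^n$. **Variational solutions.** Write $\partial_0=\partial_t$, let $\nabla=(\partial_1,\dots,\partial_n)$ be the gradient in $x$, and let products of vectors of $\mathbb R^m$ be summed over the components. For $a<b$, a function $\vec u$ is a variational solution of $\partial_t u_i-\Delta u_i=f_i(\vec u)$, $i=1,\dots,m$, in $(a,b)\times\mathbb R^n$ if * $\vec u\in H^1((a,b)\times B_R(0);\mathbb R^m)$ for every $R>0$; * $f_i(\vec u)\in L^1_{loc}((a,b)\times\mathbb R^n)$ and the system holds in $(a,b)\times\mathbb R^n$ in the sense of distributions; * $u_if_i(\vec u)$ $(i=1,\dots,m)$ and $F(\vec u)$ belong to $L^1((a,b)\times B_R(0))$ for every $R>0$; * there is $\delta_0>0$ such that for a.e. $\delta\in(0,\delta_0)$ with $a+\delta<b-\delta$, and for every $\psi=(\psi_0,\dots,\psi_n)\in C^1(\mathbb R^{n+1};\mathbb R^{n+1})$ for which there is a ball of $\mathbb R^n$ that contains the supports of all $\psi(t,\cdot)$,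 $t\in(a,b)$, $$\int_{a+\delta}^{b-\delta}\!\int_{\mathbb R^n}\Big[(|\nabla\vec u|^2-2F(\vec u))\sum_{k=0}^n\partial_k\psi_k-2\sum_{j=1}^n\sum_{k=0}^n\partial_j\vec u\,\partial_j\psi_k\,\partial_k\vec u-2\,\partial_t\vec u\sum_{k=0}^n\partial_k\vec u\,\psi_k\Big]dx\,dt-\Big[\int_{\mathbb R^n}(|\nabla\vec u|^2-2F(\vec u))\psi_0\,dx\Big]_{t=a+\delta}^{t=b-\delta}=0 .$$ A variational solution in $((t_1,T)\cup(T,t_2))\times\mathbb R^n$ is a function that is a variational solution in each of $(t_1,T)\times\mathbb R^n$ and $(T,t_2)\times\mathbb R^n$; nothing is required on an empty interval. **Notation.** Put $$G(t,x)=4\pi(T-t)\,|4\pi(T-t)|^{-\frac n2-1}\exp\Big(-\frac{|x-x_0|^2}{4(T-t)}\Big)\quad(t\ne T),$$ $T_r^-=(T-4r^2,T-r^2)\times\mathbb R^n$ and $T_r^+=(T+r^2,T+4r^2)\times\mathbb R^n$. Let $R^-=\frac12\sqrt{T-t_1}$ and $R^+=\frac12\sqrt{t_2-T}$. **Theorem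 3.1.** Let $\vec u$ be a variational solution of $\partial_tu_i-\Delta u_i=f_i(\vec u)$ in $((t_1,T)\cup(T,t_2))\times\mathbb R^n$. Assume that for every $\delta>0$, with $I_\delta=(t_1,T-\delta)\cup(T+\delta,t_2)$, the function $e^{-|x-x_0|^2/(4(T-t))}(|\nabla\vec u|^2-2F(\vec u))$ is integrable over $I_\delta\times\mathbb R^n$ and $$\operatorname*{ess\,sup}_{t\in I_\delta}\int_{\mathbb R^n}e^{-\frac{|x-x_0|^2}{4(T-t)}}\big(|\nabla\vec u|^2-2F(\vec u)\big)(t,x)\,dx+\int_{I_\delta}\int_{\mathbb R^n}e^{-\frac{|x-x_0|^2}{4(T-t)}}\big(|\partial_t\vec u|^2+|\vec u|^2\big)\,dx\,dt<\infty .$$ Let $\beta\in\mathbb R$ be such that, for every $r\in(0,R^-)$ and every $r\in(0,R^+)$ respectively, the integrals $$\int_{T_r^\mp}\big[2(\beta-1)F(\vec u)-\beta\,\vec u\cdot\vec f(\vec u)\big]G\qquad(T_r^-\text{ for }r<R^-,\ T_r^+\text{ for }r<R^+)$$ converge absolutely and are $\ge 0$. Then the functions $$\Psi^\pm(r)=r^{-2\beta}\int_{T_r^\pm}\big(|\nabla\vec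 u|^2-2F(\vec u)\big)G-\frac\beta2\,r^{-2\beta}\int_{T_r^\pm}\frac{|\vec u|^2}{T-t}\,G$$ are well defined on $(0,R^\pm)$, that is, their integrals converge absolutely, and for all $0<\rho<\sigma<R^\pm$ $$\Psi^\pm(\sigma)-\Psi^\pm(\rho)=\int_\rho^\sigma 2r^{-2\beta-1}\int_{T_r^\pm}\big[2(\beta-1)F(\vec u)-\beta\,\vec u\cdot\vec f(\vec u)\big]G\,dr+\int_\rho^\sigma r^{-2\beta-1}\int_{T_r^\pm}\frac1{T-t}\big(\nabla\vec u\cdot(x-x_0)-2(T-t)\partial_t\vec u-\beta\vec u\big)^2G\,dr\ \ge 0,$$ where $(\,\cdot\,)^2$ is summed over the components and all integrals on the right converge absolutely. In particular $\Psi^-$ and $\Psi^+$ are nondecreasing on $(0,R^-)$ and $(0,R^+)$. -/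

import Mathlib

open MeasureTheory Set
open scoped ContDiff

noncomputable section

namespace ParabolicMonotonicity

/-- Euclidean space `ℝⁿ`. -/
abbrev E (n : ℕ) : Type := EuclideanSpace ℝ (Fin n)

/-- Space-time `ℝ × ℝⁿ`; a point is `(t, x)`, and the measure is Lebesgue measure. -/
abbrev ST (n : ℕ) : Type := ℝ × E n

/-- The unit vector in the time direction. -/
def eT (n : ℕ) : ST n := (1, 0)

/-- The unit vector in the `j`-th space direction. -/
def eX {n : ℕ} (j : Fin n) : ST n := (0, EuclideanSpace.single j 1)

/-- The slab `(a, b) × ℝⁿ`. -/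
def slab (n : ℕ) (a b : ℝ) : Set (ST n) := Ioo a b ×ˢ univ

/-- `φ` is a smooth test function with compact support inside `Ω`. -/
def IsTestFunction {n : ℕ} (Ω : Set (ST n)) (φ : ST n → ℝ) : Prop :=
  ContDiff ℝ ∞ φ ∧ HasCompactSupport φ ∧ tsupport φ ⊆ Ω

/-- `ut` and `Du` are the weak time derivative and the weak space gradients of the components
of `u` in the open set `Ω`; `Du z i` is the gradient of the `i`-th component. -/
def IsWeakGradient {m n : ℕ} (Ω : Set (ST n)) (u ut : ST n → E m)
    (Du : ST n → Fin m → E n) : Prop :=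
  ∀ φ : ST n → ℝ, IsTestFunction Ω φ → ∀ i : Fin m,
    (∫ z in Ω, u z i * fderiv ℝ φ z (eT n)) = -∫ z in Ω, ut z i * φ z ∧
    ∀ j : Fin n, (∫ z in Ω, u z i * fderiv ℝ φ z (eX j)) = -∫ z in Ω, Du z i j * φ z

/-- `u` belongs to `H¹((a, b) × B_R(0))` for every `R > 0`, with weak derivatives `ut`, `Du`. -/
structure IsH1 {m n : ℕ} (a b : ℝ) (u ut : ST n → E m) (Du : ST n → Fin m → E n) : Prop where
  weak : IsWeakGradient (slab n a b) u ut Du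
  memLp : ∀ R > 0, MemLp u 2 (volume.restrict (Ioo a b ×ˢ Metric.ball (0 : E n) R))
  memLp_time : ∀ R > 0, MemLp ut 2 (volume.restrict (Ioo a b ×ˢ Metric.ball (0 : E n) R))
  memLp_space : ∀ R > 0, ∀ i : Fin m,
    MemLp (fun z => Du z i) 2 (volume.restrict (Ioo a b ×ˢ Metric.ball (0 : E n) R))

/-- `∂ₜ u - Δ u = ∇F(u)` holds in `(a, b) × ℝⁿ` in the sense of distributions. -/
def IsDistributionalSolution {m n : ℕ} (F : E m → ℝ) (a b : ℝ) (u : ST n → E m) : Prop :=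
  ∀ i : Fin m,
    LocallyIntegrableOn (fun z => gradient F (u z) i) (slab n a b) ∧
    ∀ φ : ST n → ℝ, IsTestFunction (slab n a b) φ →
      (∫ z in slab n a b,
        u z i * (-fderiv ℝ φ z (eT n) - Laplacian.laplacian (fun x : E n => φ (z.1, x)) z.2)) =
      ∫ z in slab n a b, gradient F (u z) i * φ z

/-- The energy density `|∇u|² - 2 F(u)`. -/
def energy {m n : ℕ} (F : E m → ℝ) (u : ST n → E m) (Du : ST n → Fin m → E n)
    (z : ST n) : ℝ :=
  (∑ i, ‖Du z i‖ ^ 2) - 2 * F (u z)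

/-- The derivative at `z` of the `i`-th component of `u` in the space-time direction `v`,
that is `∂ₜ uᵢ v₀ + ∑ₖ ∂ₖ uᵢ vₖ`. -/
def dirDeriv {m n : ℕ} (ut : ST n → E m) (Du : ST n → Fin m → E n) (z v : ST n) (i : Fin m) : ℝ :=
  ut z i * v.1 + inner ℝ (Du z i) v.2

/-- The space-time divergence `∂ₜ ψ₀ + ∑ⱼ ∂ⱼ ψⱼ`. -/
def divST {n : ℕ} (ψ : ST n → ST n) (z : ST n) : ℝ :=
  (fderiv ℝ ψ z (eT n)).1 + ∑ j, (fderiv ℝ ψ z (eX j)).2 j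

/-- Admissible domain variations over the time interval `(a, b)`: `C¹` vector fields on `ℝⁿ⁺¹`
whose time slices have supports in a common ball of `ℝⁿ`. -/
def IsVariation {n : ℕ} (a b : ℝ) (ψ : ST n → ST n) : Prop :=
  ContDiff ℝ 1 ψ ∧ ∃ R : ℝ, ∀ t ∈ Ioo a b, ∀ x : E n, R < ‖x‖ → ψ (t, x) = 0

/-- The first variation of the functional over `(s₁, s₂) × ℝⁿ` in the direction `ψ`:
`∫∫ [(|∇u|² - 2F(u)) div ψ - 2 ∑_{j ≥ 1} ∑_{k ≥ 0} ∂ⱼu · ∂ⱼψₖ ∂ₖu - 2 ∂ₜu · ∑_{k ≥ 0} ∂ₖu ψₖ]`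
minus the difference of `∫ (|∇u|² - 2F(u)) ψ₀` at the times `s₂` and `s₁`. -/
def firstVariation {m n : ℕ} (F : E m → ℝ) (u ut : ST n → E m) (Du : ST n → Fin m → E n)
    (s₁ s₂ : ℝ) (ψ : ST n → ST n) : ℝ :=
  (∫ z in slab n s₁ s₂,
    (energy F u Du z * divST ψ z
      - 2 * ∑ i, ∑ j, Du z i j * dirDeriv ut Du z (fderiv ℝ ψ z (eX j)) i
      - 2 * ∑ i, ut z i * dirDeriv ut Du z (ψ z) i))
  - (∫ x : E n, energy F u Du (s₂, x) * (ψ (s₂, x)).1)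
  + (∫ x : E n, energy F u Du (s₁, x) * (ψ (s₁, x)).1)

/-- `u`, with weak derivatives `ut` and `Du`, is a variational solution of
`∂ₜ u - Δ u = ∇F(u)` in `(a, b) × ℝⁿ`. Nothing is required if the interval is empty. -/
structure IsVariationalSolution {m n : ℕ} (F : E m → ℝ) (a b : ℝ) (u ut : ST n → E m)
    (Du : ST n → Fin m → E n) : Prop where
  h1 : IsH1 a b u ut Du
  distributional : IsDistributionalSolution F a b u
  integrable_uf : ∀ R > 0, ∀ i : Fin m,
    IntegrableOn (fun z => u z i * gradient F (u z) i) (Ioo a b ×ˢ Metric.ball (0 : E n) R)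
  integrable_F : ∀ R > 0,
    IntegrableOn (fun z => F (u z)) (Ioo a b ×ˢ Metric.ball (0 : E n) R)
  variation : ∃ δ₀ > 0, ∀ᵐ δ : ℝ, 0 < δ → δ < δ₀ → a + δ < b - δ →
    ∀ ψ : ST n → ST n, IsVariation a b ψ → firstVariation F u ut Du (a + δ) (b - δ) ψ = 0

/-- The Gaussian weight `exp(-|x - x₀|² / (4 (T - t)))`. -/
def gaussWeight {n : ℕ} (T : ℝ) (x₀ : E n) (z : ST n) : ℝ :=
  Real.exp (-(‖z.2 - x₀‖ ^ 2 / (4 * (T - z.1))))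

/-- The backward heat kernel
`4π(T - t) |4π(T - t)|^(-n/2 - 1) exp(-|x - x₀|² / (4 (T - t)))`. It is negative for `t > T`. -/
def heatKernel {n : ℕ} (T : ℝ) (x₀ : E n) (z : ST n) : ℝ :=
  4 * Real.pi * (T - z.1) * |4 * Real.pi * (T - z.1)| ^ (-(n : ℝ) / 2 - 1)
    * Real.exp (-(‖z.2 - x₀‖ ^ 2 / (4 * (T - z.1))))

/-- The layer `(T - 4r², T - r²) × ℝⁿ`. -/
def layerMinus (n : ℕ) (T r : ℝ) : Set (ST n) := slab n (T - 4 * r ^ 2) (T - r ^ 2)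

/-- The layer `(T + r², T + 4r²) × ℝⁿ`. -/
def layerPlus (n : ℕ) (T r : ℝ) : Set (ST n) := slab n (T + r ^ 2) (T + 4 * r ^ 2)

/-- The Gaussian-weighted energy bounds away from the time `T`. The energy density may change
sign; its weighted integrals are required to converge absolutely, and the supremum over times is
an essential one because `u` and its derivatives are given up to null sets. -/
def EnergyBounds {m n : ℕ} (F : E m → ℝ) (t₁ t₂ T : ℝ) (x₀ : E n) (u ut : ST n → E m)
    (Du : ST n → Fin m → E n) : Prop :=
  ∀ δ > 0,
    IntegrableOn (fun z => gaussWeight T x₀ z * energy F u Du z)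
      ((Ioo t₁ (T - δ) ∪ Ioo (T + δ) t₂) ×ˢ univ) ∧
    (∃ C : ℝ, ∀ᵐ t : ℝ, t ∈ Ioo t₁ (T - δ) ∪ Ioo (T + δ) t₂ →
      ∫ x : E n, gaussWeight T x₀ (t, x) * energy F u Du (t, x) ≤ C) ∧
    IntegrableOn (fun z => gaussWeight T x₀ z * (‖ut z‖ ^ 2 + ‖u z‖ ^ 2))
      ((Ioo t₁ (T - δ) ∪ Ioo (T + δ) t₂) ×ˢ univ)

/-- The bulk density `2(β - 1) F(u) - β u · f(u)`, where `f = ∇F`. -/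
def bulk {m n : ℕ} (F : E m → ℝ) (β : ℝ) (u : ST n → E m) (z : ST n) : ℝ :=
  2 * (β - 1) * F (u z) - β * inner ℝ (u z) (gradient F (u z))

/-- The square `(∇u · (x - x₀) - 2 (T - t) ∂ₜu - β u)²`, summed over the components. -/
def defect {m n : ℕ} (β T : ℝ) (x₀ : E n) (u ut : ST n → E m) (Du : ST n → Fin m → E n)
    (z : ST n) : ℝ :=
  ∑ i, (inner ℝ (Du z i) (z.2 - x₀) - 2 * (T - z.1) * ut z i - β * u z i) ^ 2

/-- The function `Ψ` for the family of layers `L`. -/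
def Psi {m n : ℕ} (F : E m → ℝ) (β T : ℝ) (x₀ : E n) (u : ST n → E m)
    (Du : ST n → Fin m → E n) (L : ℝ → Set (ST n)) (r : ℝ) : ℝ :=
  r ^ (-2 * β) * (∫ z in L r, energy F u Du z * heatKernel T x₀ z)
    - β / 2 * r ^ (-2 * β) * ∫ z in L r, 1 / (T - z.1) * ‖u z‖ ^ 2 * heatKernel T x₀ z

end ParabolicMonotonicity

end

open ParabolicMonotonicity

open ParabolicMonotonicity

namespace ParabolicMonotonicity

open Filter Topology ContinuousLinearMap
open scoped Convolution ENNReal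

/-! ### Mollification in `L²` -/

section Mollification

variable {G E' : Type*} [NormedAddCommGroup G] [NormedSpace ℝ G] [FiniteDimensional ℝ G]
  [MeasurableSpace G] [BorelSpace G] [NormedAddCommGroup E'] [NormedSpace ℝ E']
  {μ : Measure G} [μ.IsAddHaarMeasure]

/-! Let `X = 2(t - T)∂ₜ + (x - x₀)·∇` be the generator of the parabolic scaling about `(T, x₀)`
(`scalingField`). Then `Xu = ∇u·(x - x₀) - 2(T - t)∂ₜu`, so `defect` is `|Xu - βu|²`. The kernel `G`
is homogeneous of degree `-n`, that is `XG = -nG`, while `div X = n + 2`. Three identities are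
localized by a test function `q`: the domain variation along `G q X`
(`IsVariationalSolution.hasZeroIntegral_scaling`), the equation tested with `G q u`
(`IsVariationalSolution.hasZeroIntegral_energy`), and the divergence theorem for `|u|² G q / (T -
t)` along `X` (`IsH1.hasZeroIntegral_weighted_sq`). Because `∇G = -(x - x₀) G / (2(T - t))`, the
spatial derivatives of `G` recombine with `∂ₜu` into multiples of `Xu / (T - t)`, and one linear
combination completes the square. The result is
`IsVariationalSolution.hasZeroIntegral_monotonicity`.

Testing with `u` itself needs care, since `u` is only `H¹` and only `uᵢfᵢ(u)` is known to be
integrable. The equation is first tested with `b(u) p` for bounded smooth `b`, by mollifying `u`;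
then `b` tends to the identity (`integral_self_testing`).

Next `q = ζ(t) η_N(x)²` with `η_N → 1`. The energy density may change sign, so integrability of
`|∇u|² G` is not given. It follows from Fatou's lemma in a combination of the second and third
identities in which `|∇u|²` has coefficient one for every `β`
(`IsVariationalSolution.timeLocInt_gradient`). This controls the terms with `∇η_N`; a second use of
Fatou gives integrability of the square term, and dominated convergence gives an identity containing
only `ζ` (`IsVariationalSolution.hasZeroIntegral_time`).

After integration in `x` it says that `(2(t - T)h)' = 2βh + k` weakly, where `h(t)` is the slice
integral of the density in `Ψ` and `k(t)` that of twice the bulk term plus the square term. By du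
Bois-Reymond `h` has a continuous representative, and differentiating `r^(-2β) ∫ h` over `(T + p r²,
T + q r²)` gives exactly `r^(-2β-1) ∫ k` (`hasDerivAt_rpow_mul_integral_layer`). The formula is the
fundamental theorem of calculus with `(p, q) = (-4, -1)` before `T` and `(1, 4)` after `T`. Its
right side is nonnegative: the bulk part by assumption, the square part because `G` has the sign of
`T - t` on both sides of `T`. -/

theorem enorm_normed_convolution_sq_le (φ : ContDiffBump (0 : G)) {g : G → E'}
    (hg : AEStronglyMeasurable g μ) (x : G) :
    ‖(φ.normed μ ⋆[lsmul ℝ ℝ, μ] g) x‖ₑ ^ (2 : ℝ) ≤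
      ∫⁻ t, ENNReal.ofReal (φ.normed μ t) * ‖g (x - t)‖ₑ ^ (2 : ℝ) ∂μ := by
  have hρ : Measurable (fun t => ENNReal.ofReal (φ.normed μ t)) :=
    (φ.continuous_normed.measurable).ennreal_ofReal
  have hg' : AEStronglyMeasurable (fun t => g (x - t)) μ :=
    hg.comp_measurePreserving (Measure.measurePreserving_sub_left μ x)
  -- The mollifier times `μ` is a probability measure, so Jensen's inequality for the square is the
  -- inclusion of `L²(ν)` in `L¹(ν)` with constant one.
  set ν := μ.withDensity (fun t => ENNReal.ofReal (φ.normed μ t)) with hν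
  have hνp : IsProbabilityMeasure ν := by
    constructor
    rw [hν, withDensity_apply _ MeasurableSet.univ, Measure.restrict_univ,
      ← ofReal_integral_eq_lintegral_ofReal φ.integrable_normed
        (Eventually.of_forall φ.nonneg_normed), φ.integral_normed, ENNReal.ofReal_one]
  have hgν : AEStronglyMeasurable (fun t => g (x - t)) ν :=
    hg'.mono_ac (withDensity_absolutelyContinuous _ _)
  have h1 : ‖(φ.normed μ ⋆[lsmul ℝ ℝ, μ] g) x‖ₑ ≤ ∫⁻ t, ‖g (x - t)‖ₑ ∂ν := by
    rw [convolution_def, hν, lintegral_withDensity_eq_lintegral_mul₀ hρ.aemeasurable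
      hg'.enorm]
    refine (enorm_integral_le_lintegral_enorm _).trans (lintegral_mono fun t => ?_)
    simp only [lsmul_apply, Pi.mul_apply, enorm_smul]
    rw [Real.enorm_eq_ofReal (φ.nonneg_normed t)]
  have h2 : ∫⁻ t, ‖g (x - t)‖ₑ ∂ν ≤ (∫⁻ t, ‖g (x - t)‖ₑ ^ (2 : ℝ) ∂ν) ^ (1 / (2 : ℝ)) := by
    have := eLpNorm_le_eLpNorm_of_exponent_le (μ := ν) (p := 1) (q := 2)
      (by norm_num) hgν
    rwa [eLpNorm_one_eq_lintegral_enorm, eLpNorm_eq_lintegral_rpow_enorm_toReal (by norm_num)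
      (by norm_num), ENNReal.toReal_ofNat] at this
  calc _ ≤ ((∫⁻ t, ‖g (x - t)‖ₑ ^ (2 : ℝ) ∂ν) ^ (1 / (2 : ℝ))) ^ (2 : ℝ) :=
        ENNReal.rpow_le_rpow (h1.trans h2) (by norm_num)
    _ = ∫⁻ t, ‖g (x - t)‖ₑ ^ (2 : ℝ) ∂ν := by
        rw [← ENNReal.rpow_mul]; norm_num
    _ = _ := by
        rw [hν, lintegral_withDensity_eq_lintegral_mul₀ hρ.aemeasurable (hg'.enorm.pow_const _)]
        rfl

/-- Young's inequality: integrate the pointwise Jensen bound, exchange the integrals and use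
translation invariance and total mass one. -/
theorem eLpNorm_normed_convolution_le (φ : ContDiffBump (0 : G)) {g : G → E'}
    (hg : AEStronglyMeasurable g μ) :
    eLpNorm (φ.normed μ ⋆[lsmul ℝ ℝ, μ] g) 2 μ ≤ eLpNorm g 2 μ := by
  rw [eLpNorm_eq_lintegral_rpow_enorm_toReal (by norm_num) (by norm_num),
    eLpNorm_eq_lintegral_rpow_enorm_toReal (by norm_num) (by norm_num), ENNReal.toReal_ofNat]
  refine ENNReal.rpow_le_rpow ?_ (by norm_num)
  have hρ : Measurable (fun t => ENNReal.ofReal (φ.normed μ t)) :=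
    (φ.continuous_normed.measurable).ennreal_ofReal
  calc _ ≤ ∫⁻ x, ∫⁻ t, ENNReal.ofReal (φ.normed μ t) * ‖g (x - t)‖ₑ ^ (2 : ℝ) ∂μ ∂μ :=
        lintegral_mono fun x => enorm_normed_convolution_sq_le φ hg x
    _ = ∫⁻ t, ∫⁻ x, ENNReal.ofReal (φ.normed μ t) * ‖g (x - t)‖ₑ ^ (2 : ℝ) ∂μ ∂μ := by
        rw [lintegral_lintegral_swap]
        refine AEMeasurable.mul (hρ.comp measurable_snd).aemeasurable ?_
        refine AEMeasurable.pow_const (AEStronglyMeasurable.enorm ?_) _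
        exact hg.comp_quasiMeasurePreserving (quasiMeasurePreserving_sub μ μ)
    _ = ∫⁻ t, ENNReal.ofReal (φ.normed μ t) * ∫⁻ x, ‖g x‖ₑ ^ (2 : ℝ) ∂μ ∂μ := by
        refine lintegral_congr fun t => ?_
        rw [lintegral_const_mul' _ _ ENNReal.ofReal_ne_top,
          lintegral_sub_right_eq_self (fun x => ‖g x‖ₑ ^ (2 : ℝ)) t]
    _ = _ := by
        rw [lintegral_mul_const _ hρ, ← ofReal_integral_eq_lintegral_ofReal φ.integrable_normed
        (Eventually.of_forall φ.nonneg_normed), φ.integral_normed, ENNReal.ofReal_one, one_mul]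

/-- By uniform continuity the difference is eventually at most `δ`, and once the radius is below one
it vanishes off the compact 1-thickening of the support. Its `L²` norm is therefore at most `δ`
times a fixed constant. -/
theorem tendsto_eLpNorm_normed_convolution_sub_of_hasCompactSupport
    [CompleteSpace E'] {φ : ℕ → ContDiffBump (0 : G)} (hφ : Tendsto (fun i => (φ i).rOut) atTop (𝓝 0)) {h : G → E'}
    (hc : Continuous h) (hs : HasCompactSupport h) :
    Tendsto (fun i => eLpNorm ((φ i).normed μ ⋆[lsmul ℝ ℝ, μ] h - h) 2 μ) atTop (𝓝 0) := by
  set K := Metric.cthickening 1 (tsupport h)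
  have hK : IsCompact K := IsCompact.cthickening hs
  have hKμ : μ K ≠ (⊤ : ℝ≥0∞) := hK.measure_lt_top.ne
  have hu := hs.uniformContinuous_of_continuous hc
  have key : ∀ δ > 0, ∀ᶠ i in atTop, eLpNorm ((φ i).normed μ ⋆[lsmul ℝ ℝ, μ] h - h) 2 μ ≤
      ENNReal.ofReal δ * μ K ^ (1 / (2 : ℝ)) := by
    intro δ hδ
    obtain ⟨η, hη, H⟩ := Metric.uniformContinuous_iff.1 hu δ hδ
    filter_upwards [hφ.eventually (gt_mem_nhds hη), hφ.eventually (gt_mem_nhds one_pos)]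
      with i hi hi1
    have hb : ∀ x, ‖((φ i).normed μ ⋆[lsmul ℝ ℝ, μ] h - h) x‖ ≤
        ‖K.indicator (fun _ => δ) x‖ := by
      intro x
      rw [Pi.sub_apply, ← dist_eq_norm]
      by_cases hx : x ∈ K
      · rw [indicator_of_mem hx, Real.norm_of_nonneg hδ.le]
        refine ContDiffBump.dist_normed_convolution_le hc.aestronglyMeasurable fun y hy => ?_
        exact (H (lt_trans hy hi)).le
      · have h0 : ∀ y ∈ Metric.ball x (φ i).rOut, h y = 0 := by
          intro y hy
          by_contra hne
          apply hx
          refine Metric.mem_cthickening_of_dist_le x y 1 _ (subset_tsupport _ hne) ?_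
          rw [dist_comm]; exact (lt_trans hy hi1).le
        rw [ContDiffBump.normed_convolution_eq_right, dist_self]
        · positivity
        · intro y hy
          rw [h0 y hy, h0 x (Metric.mem_ball_self (φ i).rOut_pos)]
    refine (eLpNorm_mono hb).trans ?_
    rw [eLpNorm_indicator_const hK.measurableSet (by norm_num) (by norm_num),
      Real.enorm_eq_ofReal hδ.le, ENNReal.toReal_ofNat]
  rw [ENNReal.tendsto_nhds_zero]
  intro ε hε
  have hlim : Tendsto (fun δ : ℝ => ENNReal.ofReal δ * μ K ^ (1 / (2 : ℝ))) (𝓝[>] 0) (𝓝 0) := by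
    have : Tendsto (fun δ : ℝ => ENNReal.ofReal δ * μ K ^ (1 / (2 : ℝ))) (𝓝[>] 0)
        (𝓝 (ENNReal.ofReal 0 * μ K ^ (1 / (2 : ℝ)))) := by
      refine ENNReal.Tendsto.mul_const ?_ (Or.inr (ENNReal.rpow_ne_top_of_nonneg (by norm_num) hKμ))
      exact (ENNReal.continuous_ofReal.tendsto 0).mono_left nhdsWithin_le_nhds
    simpa using this
  obtain ⟨δ, hδ, hδ0⟩ := ((ENNReal.tendsto_nhds_zero.1 hlim ε hε).and self_mem_nhdsWithin).exists
  filter_upwards [key δ hδ0] with i hi using hi.trans hδ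

/-- Density of continuous compactly supported functions in `L²`; the contraction bound for
convolution makes the approximation error uniform along the sequence. -/
theorem tendsto_eLpNorm_normed_convolution_sub
    [CompleteSpace E'] {φ : ℕ → ContDiffBump (0 : G)} (hφ : Tendsto (fun i => (φ i).rOut) atTop (𝓝 0)) {g : G → E'}
    (hg : MemLp g 2 μ) :
    Tendsto (fun i => eLpNorm ((φ i).normed μ ⋆[lsmul ℝ ℝ, μ] g - g) 2 μ) atTop (𝓝 0) := by
  rw [ENNReal.tendsto_nhds_zero]
  intro ε hε
  have hε3 : ε / 3 ≠ 0 := by simpa using hε.ne'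
  obtain ⟨h, hs, hgh, hc, hm⟩ := hg.exists_hasCompactSupport_eLpNorm_sub_le (by norm_num) hε3
  have h1 := ENNReal.tendsto_nhds_zero.1
    (tendsto_eLpNorm_normed_convolution_sub_of_hasCompactSupport (μ := μ) hφ hc hs) (ε / 3)
    (pos_iff_ne_zero.2 hε3)
  filter_upwards [h1] with i hi
  set ρ := (φ i).normed μ
  have hρc : Continuous ρ := (φ i).continuous_normed
  have hρs : HasCompactSupport ρ := (φ i).hasCompactSupport_normed
  have hmg : AEStronglyMeasurable (ρ ⋆[lsmul ℝ ℝ, μ] g) μ :=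
    (hρs.continuous_convolution_left _ hρc (hg.locallyIntegrable (by norm_num))).aestronglyMeasurable
  have hmh : AEStronglyMeasurable (ρ ⋆[lsmul ℝ ℝ, μ] h) μ :=
    (hρs.continuous_convolution_left _ hρc (hm.locallyIntegrable (by norm_num))).aestronglyMeasurable
  have heq : ρ ⋆[lsmul ℝ ℝ, μ] g - ρ ⋆[lsmul ℝ ℝ, μ] h = ρ ⋆[lsmul ℝ ℝ, μ] (g - h) := by
    ext x
    have e1 := hρs.convolutionExists_left (lsmul ℝ ℝ) hρc (hg.locallyIntegrable (by norm_num)) x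
    have e2 := hρs.convolutionExists_left (lsmul ℝ ℝ) hρc (hm.locallyIntegrable (by norm_num)) x
    rw [Pi.sub_apply, convolution_def, convolution_def, convolution_def,
      ← integral_sub e1.integrable e2.integrable]
    simp [smul_sub]
  have hsplit : ρ ⋆[lsmul ℝ ℝ, μ] g - g =
      (ρ ⋆[lsmul ℝ ℝ, μ] (g - h) + (ρ ⋆[lsmul ℝ ℝ, μ] h - h)) - (g - h) := by
    rw [← heq]; abel
  rw [hsplit]
  calc _ ≤ eLpNorm (ρ ⋆[lsmul ℝ ℝ, μ] (g - h)) 2 μ + eLpNorm (ρ ⋆[lsmul ℝ ℝ, μ] h - h) 2 μ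
        + eLpNorm (g - h) 2 μ := by
        refine (eLpNorm_sub_le ?_ (hg.1.sub hm.1) (by norm_num)).trans ?_
        · exact (heq ▸ hmg.sub hmh).add (hmh.sub hm.1)
        · gcongr
          exact eLpNorm_add_le (heq ▸ hmg.sub hmh) (hmh.sub hm.1) (by norm_num)
    _ ≤ ε / 3 + ε / 3 + ε / 3 := by
        gcongr
        exact (eLpNorm_normed_convolution_le _ (hg.1.sub hm.1)).trans hgh
    _ = ε := ENNReal.add_thirds ε

end Mollification

set_option linter.unusedSectionVars false

/-! ### Testing a weak equation with functions of the solution -/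

section Testing

variable {G : Type*} [NormedAddCommGroup G] [NormedSpace ℝ G] [FiniteDimensional ℝ G]
  [MeasurableSpace G] [BorelSpace G] {μ : Measure G} [μ.IsAddHaarMeasure]

/-- `φ` is a smooth test function with compact support inside the set `Ω` of a normed space. -/
def IsBump (Ω : Set G) (φ : G → ℝ) : Prop :=
  ContDiff ℝ ∞ φ ∧ HasCompactSupport φ ∧ tsupport φ ⊆ Ω

theorem exists_memLp_extension {X W : Type*} [MeasurableSpace X] {ν : Measure X}
    [NormedAddCommGroup W] {U : Set X} (hU : MeasurableSet U) {g : X → W}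
    (hg : MemLp g 2 (ν.restrict U)) :
    ∃ g' : X → W, MemLp g' 2 ν ∧ EqOn g' g U ∧ ∀ z ∉ U, g' z = 0 :=
  ⟨U.indicator g, (memLp_indicator_iff_restrict hU).2 hg, fun _ hz => indicator_of_mem hz g,
    fun _ hz => indicator_of_notMem hz g⟩

/-- Mollification commutes with weak differentiation as long as the ball of the mollifier stays in
`U`, for then `t ↦ ρ(z - t)` is an admissible test function. Extension by zero outside `U` lets the
convolutions run over the whole space. -/
theorem hasFDerivAt_normed_convolution {U : Set G}
    {v : G → ℝ} {g : G → G →L[ℝ] ℝ}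
    (hv : LocallyIntegrable v μ) (hg : LocallyIntegrable g μ)
    (hv0 : ∀ z ∉ U, v z = 0) (hg0 : ∀ z ∉ U, g z = 0)
    (hw : ∀ φ : G → ℝ, IsBump U φ → ∀ w,
      ∫ z in U, v z * fderiv ℝ φ z w ∂μ = -∫ z in U, g z w * φ z ∂μ)
    (φ : ContDiffBump (0 : G)) {z : G} (hz : Metric.closedBall z φ.rOut ⊆ U) :
    HasFDerivAt (φ.normed μ ⋆[lsmul ℝ ℝ, μ] v) ((φ.normed μ ⋆[lsmul ℝ ℝ, μ] g) z) z := by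
  set ρ := φ.normed μ with hρ
  have hρd : ContDiff ℝ ∞ ρ := φ.contDiff_normed
  have hρs : HasCompactSupport ρ := φ.hasCompactSupport_normed
  have hder := hρs.hasFDerivAt_convolution_left (lsmul ℝ ℝ) (hρd.of_le (by norm_num)) hv z
  suffices h : (ρ ⋆[lsmul ℝ ℝ, μ] g) z =
      (fderiv ℝ ρ ⋆[(lsmul ℝ ℝ).precompL G, μ] v) z by rw [h]; exact hder
  ext w
  have hex1 : ConvolutionExists (fderiv ℝ ρ) v ((lsmul ℝ ℝ).precompL G) μ :=
    (hρs.fderiv ℝ).convolutionExists_left _ (hρd.continuous_fderiv (by norm_num)) hv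
  have hex2 : ConvolutionExists ρ g (lsmul ℝ ℝ) μ :=
    hρs.convolutionExists_left _ hρd.continuous hg
  rw [convolution_eq_swap, convolution_eq_swap,
    ContinuousLinearMap.integral_apply (hex2 z).integrable_swap,
    ContinuousLinearMap.integral_apply (hex1 z).integrable_swap]
  have htest : IsBump U (fun t => ρ (z - t)) := by
    refine ⟨hρd.comp (contDiff_const.sub contDiff_id), ?_, ?_⟩
    · exact hρs.comp_homeomorph (Homeomorph.subLeft z)
    · have : tsupport (fun t => ρ (z - t)) ⊆ Metric.closedBall z φ.rOut := by
        refine closure_minimal ?_ Metric.isClosed_closedBall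
        intro t ht
        have : z - t ∈ Function.support ρ := ht
        rw [hρ, φ.support_normed_eq, Metric.mem_ball, dist_zero_right] at this
        rw [Metric.mem_closedBall, dist_comm, dist_eq_norm]
        exact this.le
      exact this.trans hz
  have hfd : ∀ t, fderiv ℝ (fun t => ρ (z - t)) t w = -fderiv ℝ ρ (z - t) w := by
    intro t
    have h1 : HasFDerivAt ρ (fderiv ℝ ρ (z - t)) (z - t) :=
      (hρd.differentiable (by norm_num) _).hasFDerivAt
    have h2 : HasFDerivAt (fun t : G => z - t) (-ContinuousLinearMap.id ℝ G) t :=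
      (hasFDerivAt_id t).const_sub z
    rw [show (fun t => ρ (z - t)) = ρ ∘ (fun t => z - t) from rfl, (h1.comp t h2).fderiv]
    simp
  have key := hw _ htest w
  simp only [hfd, mul_neg, integral_neg, neg_inj] at key
  rw [setIntegral_eq_integral_of_forall_compl_eq_zero (fun t ht => by simp [hv0 t ht]),
    setIntegral_eq_integral_of_forall_compl_eq_zero (fun t ht => by simp [hg0 t ht])] at key
  calc ∫ t, ((lsmul ℝ ℝ) (ρ (z - t)) (g t)) w ∂μ = ∫ t, g t w * ρ (z - t) ∂μ :=
        integral_congr_ae (Eventually.of_forall fun t => by simp [mul_comm])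
    _ = ∫ t, v t * fderiv ℝ ρ (z - t) w ∂μ := key.symm
    _ = _ := integral_congr_ae (Eventually.of_forall fun t => by simp [mul_comm, precompL_apply])

theorem exists_smooth_approx {U : Set G} (hU : IsOpen U)
    {v : G → ℝ} {g : G → G →L[ℝ] ℝ}
    (hv : MemLp v 2 (μ.restrict U)) (hg : MemLp g 2 (μ.restrict U))
    (hw : ∀ φ : G → ℝ, IsBump U φ → ∀ w,
      ∫ z in U, v z * fderiv ℝ φ z w ∂μ = -∫ z in U, g z w * φ z ∂μ)
    {K : Set G} (hK : IsCompact K) (hKU : K ⊆ U) :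
    ∃ V : ℕ → G → ℝ, (∀ i, ContDiff ℝ ∞ (V i)) ∧
      (∀ᵐ z ∂μ.restrict U, Tendsto (fun i => V i z) atTop (𝓝 (v z))) ∧
      Tendsto (fun i => eLpNorm (fun z => fderiv ℝ (V i) z - g z) 2 (μ.restrict K))
        atTop (𝓝 0) := by
  obtain ⟨v', hv', hvU, hv0⟩ := exists_memLp_extension hU.measurableSet hv
  obtain ⟨g', hg', hgU, hg0⟩ := exists_memLp_extension hU.measurableSet hg
  have hvi : LocallyIntegrable v' μ := hv'.locallyIntegrable (by norm_num)
  have hgi : LocallyIntegrable g' μ := hg'.locallyIntegrable (by norm_num)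
  have hw' : ∀ φ : G → ℝ, IsBump U φ → ∀ w,
      ∫ z in U, v' z * fderiv ℝ φ z w ∂μ = -∫ z in U, g' z w * φ z ∂μ := by
    intro φ hφ w
    rw [setIntegral_congr_fun hU.measurableSet (fun z hz => by rw [hvU hz]), hw φ hφ w]
    congr 1
    exact setIntegral_congr_fun hU.measurableSet (fun z hz => by simp only [hgU hz])
  -- Keeping the two radii comparable is what the Lebesgue differentiation theorem needs for almost
  -- everywhere convergence.
  let φ : ℕ → ContDiffBump (0 : G) := fun i =>
    ⟨1 / (i + 1 : ℝ) / 2, 1 / (i + 1 : ℝ), by positivity, half_lt_self (by positivity)⟩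
  have hφ : Tendsto (fun i => (φ i).rOut) atTop (𝓝 0) := tendsto_one_div_add_atTop_nhds_zero_nat
  have hφ2 : ∀ i, (φ i).rOut ≤ 2 * (φ i).rIn := fun i => by
    change 1 / (i + 1 : ℝ) ≤ 2 * (1 / (i + 1 : ℝ) / 2)
    linarith
  clear_value φ
  obtain ⟨δ, hδ, hδU⟩ := hK.exists_cthickening_subset_open hU hKU
  refine ⟨fun i => (φ i).normed μ ⋆[lsmul ℝ ℝ, μ] v', fun i => ?_, ?_, ?_⟩
  · exact (φ i).hasCompactSupport_normed.contDiff_convolution_left _ (φ i).contDiff_normed hvi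
  · have := ContDiffBump.ae_convolution_tendsto_right_of_locallyIntegrable (K := 2) hφ
      (Eventually.of_forall hφ2) hvi
    filter_upwards [ae_restrict_of_ae this, ae_restrict_mem hU.measurableSet] with z hz hzU
    rwa [hvU hzU] at hz
  · refine tendsto_of_tendsto_of_tendsto_of_le_of_le' tendsto_const_nhds
      (tendsto_eLpNorm_normed_convolution_sub hφ hg') (Eventually.of_forall fun _ => zero_le) ?_
    filter_upwards [hφ.eventually (gt_mem_nhds hδ)] with i hi
    refine le_trans (le_of_eq ?_) (eLpNorm_mono_measure _ (Measure.restrict_le_self (s := K)))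
    refine eLpNorm_congr_ae ?_
    filter_upwards [ae_restrict_mem hK.measurableSet] with z hz
    have hball : Metric.closedBall z (φ i).rOut ⊆ U := fun t ht =>
      hδU (Metric.mem_cthickening_of_dist_le t z δ _ hz (le_trans ht hi.le))
    rw [(hasFDerivAt_normed_convolution hvi hgi hv0 hg0 hw' (φ i) hball).fderiv,
      Pi.sub_apply, hgU (hKU hz)]

theorem IsBump.exists_bound {Ω : Set G} {p : G → ℝ} (hp : IsBump Ω p) :
    ∃ C, 0 ≤ C ∧ (∀ z, ‖p z‖ ≤ C) ∧ ∀ z, ‖fderiv ℝ p z‖ ≤ C := by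
  obtain ⟨C₁, h1⟩ := hp.1.continuous.bounded_above_of_compact_support hp.2.1
  obtain ⟨C₂, h2⟩ := (hp.1.continuous_fderiv (by norm_num)).bounded_above_of_compact_support
    (hp.2.1.fderiv ℝ)
  exact ⟨max C₁ C₂, ((norm_nonneg _).trans (h1 0)).trans (le_max_left _ _),
    fun z => (h1 z).trans (le_max_left _ _), fun z => (h2 z).trans (le_max_right _ _)⟩

theorem integrable_norm_mul_norm {X A B : Type*} [MeasurableSpace X] {μ : Measure X}
    [NormedAddCommGroup A] [NormedAddCommGroup B] {f : X → A} {g : X → B}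
    (hf : MemLp f 2 μ) (hg : MemLp g 2 μ) : Integrable (fun x => ‖f x‖ * ‖g x‖) μ :=
  hf.norm.integrable_mul hg.norm

theorem lintegral_enorm_mul_enorm_le {X A B : Type*} [MeasurableSpace X] {μ : Measure X}
    [NormedAddCommGroup A] [NormedAddCommGroup B] {f : X → A} {g : X → B}
    (hf : AEStronglyMeasurable f μ) (hg : AEStronglyMeasurable g μ) :
    ∫⁻ x, ‖f x‖ₑ * ‖g x‖ₑ ∂μ ≤ eLpNorm f 2 μ * eLpNorm g 2 μ := by
  have := ENNReal.lintegral_mul_le_Lp_mul_Lq μ Real.HolderConjugate.two_two hf.enorm hg.enorm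
  rw [eLpNorm_eq_lintegral_rpow_enorm_toReal (by norm_num) (by norm_num),
    eLpNorm_eq_lintegral_rpow_enorm_toReal (by norm_num) (by norm_num), ENNReal.toReal_ofNat]
  exact this

-- A chain rule for weak equations. With smooth `V i → v` the function `b(V i) p` is a legitimate
-- test function. In the resulting identity `∇V i` is replaced by the weak differential `g`: the
-- main part `Φ` is then dominated independently of `i`, and the error `Θ` tends to zero by
-- Cauchy-Schwarz, since `∇V i → g` in `L²` on the support of `p`.
set_option maxHeartbeats 800000 in
theorem integral_comp_testing {U : Set G} (hU : IsOpen U)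
    (hUfin : μ U ≠ ⊤) {v : G → ℝ} {g : G → G →L[ℝ] ℝ}
    (hv : MemLp v 2 (μ.restrict U)) (hg : MemLp g 2 (μ.restrict U))
    (hw : ∀ φ : G → ℝ, IsBump U φ → ∀ w,
      ∫ z in U, v z * fderiv ℝ φ z w ∂μ = -∫ z in U, g z w * φ z ∂μ)
    {α : G → ℝ} {γ : G → G} (hα : IntegrableOn α U μ) (hγ : MemLp γ 2 (μ.restrict U))
    (heq : ∀ φ : G → ℝ, IsBump U φ →
      ∫ z in U, (α z * φ z + fderiv ℝ φ z (γ z)) ∂μ = 0)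
    {b : ℝ → ℝ} (hb : ContDiff ℝ ∞ b) {M : ℝ} (hbM : ∀ s, ‖b s‖ ≤ M)
    (hb'M : ∀ s, ‖deriv b s‖ ≤ M) {p : G → ℝ} (hp : IsBump U p) :
    ∫ z in U, (α z * b (v z) * p z + deriv b (v z) * p z * g z (γ z)
      + b (v z) * fderiv ℝ p z (γ z)) ∂μ = 0 := by
  have : IsFiniteMeasure (μ.restrict U) := ⟨by simpa using hUfin.lt_top⟩
  obtain ⟨V, hVs, hVae, hVd⟩ := exists_smooth_approx hU hv hg hw hp.2.1 hp.2.2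
  obtain ⟨C, hC0, hpC, hpC'⟩ := hp.exists_bound
  have hM0 : 0 ≤ M := (norm_nonneg _).trans (hbM 0)
  have hb1 : Continuous (deriv b) := hb.continuous_deriv (by norm_num)
  have hpc := hp.1.continuous
  have hpc' := hp.1.continuous_fderiv (by norm_num)
  have hgγ := integrable_norm_mul_norm hg hγ
  have hγ1 : Integrable (fun z => ‖γ z‖) (μ.restrict U) := (hγ.integrable (by norm_num)).norm
  have hmgγ : AEStronglyMeasurable (fun z => g z (γ z)) (μ.restrict U) :=
    (ContinuousLinearMap.apply ℝ ℝ).aestronglyMeasurable_comp₂ hγ.1 hg.1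
  have hmpγ : AEStronglyMeasurable (fun z => fderiv ℝ p z (γ z)) (μ.restrict U) :=
    (ContinuousLinearMap.apply ℝ ℝ).aestronglyMeasurable_comp₂ hγ.1 hpc'.aestronglyMeasurable
  let Φ : ℕ → G → ℝ := fun i z => α z * b (V i z) * p z + deriv b (V i z) * p z * g z (γ z)
      + b (V i z) * fderiv ℝ p z (γ z)
  let D : G → ℝ := fun z => ‖α z‖ * M * C + M * C * (‖g z‖ * ‖γ z‖) + M * (C * ‖γ z‖)
  have hD : Integrable D (μ.restrict U) :=
    (((hα.norm.mul_const _).mul_const _).add (hgγ.const_mul _)).add ((hγ1.const_mul _).const_mul _)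
  have hΦm : ∀ i, AEStronglyMeasurable (Φ i) (μ.restrict U) := by
    intro i
    have hVc := (hVs i).continuous
    refine ((((hα.aestronglyMeasurable.mul (hb.continuous.comp hVc).aestronglyMeasurable).mul
      hpc.aestronglyMeasurable)).add (AEStronglyMeasurable.mul ?_ hmgγ)).add
      ((hb.continuous.comp hVc).aestronglyMeasurable.mul hmpγ)
    exact ((hb1.comp hVc).mul hpc).aestronglyMeasurable
  have hΦD : ∀ i z, ‖Φ i z‖ ≤ D z := by
    intro i z
    refine (norm_add₃_le).trans ?_
    simp only [norm_mul]
    dsimp only [D]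
    gcongr
    · exact hbM _
    · exact hpC z
    · exact hb'M _
    · exact hpC z
    · exact (g z).le_opNorm _
    · exact hbM _
    · exact ((fderiv ℝ p z).le_opNorm _).trans (by gcongr; exact hpC' z)
  have hlim : Tendsto (fun i => ∫ z in U, Φ i z ∂μ) atTop
      (𝓝 (∫ z in U, (α z * b (v z) * p z + deriv b (v z) * p z * g z (γ z)
      + b (v z) * fderiv ℝ p z (γ z)) ∂μ)) := by
    refine tendsto_integral_of_dominated_convergence D hΦm hD
      (fun i => Eventually.of_forall (hΦD i)) ?_
    filter_upwards [hVae] with z hz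
    have t1 := (hb.continuous.tendsto (v z)).comp hz
    have t2 := (hb1.tendsto (v z)).comp hz
    exact (((t1.const_mul _).mul_const _).add ((t2.mul_const _).mul_const _)).add (t1.mul_const _)
  -- The price of having `g` in place of `∇V i` in `Φ`.
  let Θ : ℕ → G → ℝ := fun i z => deriv b (V i z) * p z * (fderiv ℝ (V i) z - g z) (γ z)
  have hUK : ∀ f : G → ℝ, (∀ z ∉ tsupport p, f z = 0) →
      ∫ z in U, f z ∂μ = ∫ z in tsupport p, f z ∂μ := by
    intro f hf
    exact setIntegral_eq_of_subset_of_forall_sdiff_eq_zero hU.measurableSet hp.2.2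
      (fun z hz => hf z hz.2)
  have hsum : ∀ i, ∫ z in U, Φ i z ∂μ = -∫ z in tsupport p, Θ i z ∂μ := by
    intro i
    have htest : IsBump U (fun z => b (V i z) * p z) :=
      ⟨(hb.comp (hVs i)).mul hp.1, hp.2.1.mul_left, (tsupport_mul_subset_right).trans hp.2.2⟩
    have h0 := heq _ htest
    have hfd : ∀ z, α z * (b (V i z) * p z) + fderiv ℝ (fun z => b (V i z) * p z) z (γ z) =
        Φ i z + Θ i z := by
      intro z
      have d1 : HasFDerivAt (V i) (fderiv ℝ (V i) z) z :=
        ((hVs i).differentiable (by norm_num) z).hasFDerivAt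
      have d2 : HasDerivAt b (deriv b (V i z)) (V i z) :=
        (hb.differentiable (by norm_num) _).hasDerivAt
      have d3 : HasFDerivAt p (fderiv ℝ p z) z := (hp.1.differentiable (by norm_num) z).hasFDerivAt
      have d4 := (d2.comp_hasFDerivAt z d1).mul d3
      have d5 : fderiv ℝ (fun z => b (V i z) * p z) z = _ := d4.fderiv
      rw [d5]
      simp [Φ, Θ]
      ring
    simp only [hfd] at h0
    have hΘi : Integrable (Θ i) (μ.restrict U) := by
      have hs : HasCompactSupport (fun z => deriv b (V i z) * p z) := hp.2.1.mul_left
      have hΦi : Integrable (Φ i) (μ.restrict U) :=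
        hD.mono' (hΦm i) (Eventually.of_forall (hΦD i))
      have hVc := (hVs i).continuous
      have hcd := (hVs i).continuous_fderiv (by norm_num)
      obtain ⟨C', hC'⟩ := (((hb1.comp hVc).mul hpc).smul hcd).bounded_above_of_compact_support
        hs.smul_right
      have h1 : Integrable (fun z => ((deriv b (V i z) * p z) • fderiv ℝ (V i) z) (γ z))
          (μ.restrict U) := by
        refine (hγ1.const_mul C').mono' ?_ (Eventually.of_forall fun z => ?_)
        · exact (ContinuousLinearMap.apply ℝ ℝ).aestronglyMeasurable_comp₂ hγ.1
            (((hb1.comp hVc).mul hpc).smul hcd).aestronglyMeasurable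
        · exact (ContinuousLinearMap.le_opNorm _ _).trans
            (mul_le_mul_of_nonneg_right (hC' z) (norm_nonneg _))
      have h2 : Integrable (fun z => deriv b (V i z) * p z * g z (γ z)) (μ.restrict U) := by
        refine (hgγ.const_mul (M * C)).mono'
          (((hb1.comp hVc).mul hpc).aestronglyMeasurable.mul hmgγ) (Eventually.of_forall fun z => ?_)
        rw [norm_mul, norm_mul]
        gcongr
        · exact hb'M _
        · exact hpC z
        · exact (g z).le_opNorm _
      refine (h1.sub h2).congr (Eventually.of_forall fun z => ?_)
      simp [Θ]; ring
    rw [integral_add (hD.mono' (hΦm i) (Eventually.of_forall (hΦD i))) hΘi] at h0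
    rw [← hUK (Θ i) (fun z hz => by simp [Θ, image_eq_zero_of_notMem_tsupport hz])]
    linarith
  have hγK : MemLp γ 2 (μ.restrict (tsupport p)) := hγ.mono_measure
    (Measure.restrict_mono hp.2.2 le_rfl)
  have hgK : MemLp g 2 (μ.restrict (tsupport p)) := hg.mono_measure
    (Measure.restrict_mono hp.2.2 le_rfl)
  have hlim2 : Tendsto (fun i => ∫ z in tsupport p, Θ i z ∂μ) atTop (𝓝 0) := by
    have hb0 : ∀ i, ‖∫ z in tsupport p, Θ i z ∂μ‖ₑ ≤ ENNReal.ofReal (M * C) *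
        (eLpNorm (fun z => fderiv ℝ (V i) z - g z) 2 (μ.restrict (tsupport p))
          * eLpNorm γ 2 (μ.restrict (tsupport p))) := by
      intro i
      have hm : AEStronglyMeasurable (fun z => fderiv ℝ (V i) z - g z)
          (μ.restrict (tsupport p)) :=
        ((hVs i).continuous_fderiv (by norm_num)).aestronglyMeasurable.sub hgK.1
      refine (enorm_integral_le_lintegral_enorm _).trans ?_
      have hpt : ∀ z, ‖Θ i z‖ₑ ≤ ENNReal.ofReal (M * C) *
          (‖fderiv ℝ (V i) z - g z‖ₑ * ‖γ z‖ₑ) := by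
        intro z
        have : ‖Θ i z‖ ≤ (M * C) * (‖fderiv ℝ (V i) z - g z‖ * ‖γ z‖) := by
          rw [norm_mul, norm_mul]
          gcongr
          · exact hb'M _
          · exact hpC z
          · exact ContinuousLinearMap.le_opNorm _ _
        rw [← ofReal_norm, ← ofReal_norm, ← ofReal_norm, ← ENNReal.ofReal_mul (norm_nonneg _),
          ← ENNReal.ofReal_mul (by positivity)]
        exact ENNReal.ofReal_le_ofReal this
      refine (lintegral_mono hpt).trans ?_
      rw [lintegral_const_mul' _ _ ENNReal.ofReal_ne_top]
      gcongr
      exact lintegral_enorm_mul_enorm_le hm hγK.1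
    rw [tendsto_zero_iff_enorm_tendsto_zero]
    refine tendsto_of_tendsto_of_tendsto_of_le_of_le tendsto_const_nhds ?_
      (fun _ => zero_le) hb0
    have h1 := ENNReal.Tendsto.mul_const (b := eLpNorm γ 2 (μ.restrict (tsupport p))) hVd
      (Or.inr hγK.2.ne)
    have h2 := ENNReal.Tendsto.const_mul (a := ENNReal.ofReal (M * C)) h1
      (Or.inr ENNReal.ofReal_ne_top)
    simpa using h2
  have h3 : Tendsto (fun i => ∫ z in U, Φ i z ∂μ) atTop (𝓝 0) := by
    simp only [hsum]
    simpa using hlim2.neg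
  exact tendsto_nhds_unique hlim h3

/-- A bounded smooth approximation of the identity with derivative bounded by `1`. -/
noncomputable def softTrunc (c s : ℝ) : ℝ := s / (1 + c * s ^ 2)

theorem hasDerivAt_softTrunc {c : ℝ} (hc : 0 ≤ c) (s : ℝ) :
    HasDerivAt (softTrunc c) ((1 - c * s ^ 2) / (1 + c * s ^ 2) ^ 2) s := by
  have h0 : 1 + c * s ^ 2 ≠ 0 := by positivity
  have h1 : HasDerivAt (fun s : ℝ => 1 + c * s ^ 2) (c * (2 * s)) s := by
    simpa using ((hasDerivAt_pow 2 s).const_mul c).const_add 1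
  exact ((hasDerivAt_id s).div h1 h0).congr_deriv (by simp only [id]; ring)

theorem contDiff_softTrunc {c : ℝ} (hc : 0 ≤ c) : ContDiff ℝ ∞ (softTrunc c) :=
  contDiff_id.div (contDiff_const.add (contDiff_const.mul (contDiff_id.pow 2)))
    fun s => by have : 0 < 1 + c * s ^ 2 := by positivity
                exact this.ne'

theorem abs_softTrunc_le_abs {c : ℝ} (hc : 0 ≤ c) (s : ℝ) : |softTrunc c s| ≤ |s| := by
  have h0 : 1 ≤ 1 + c * s ^ 2 := by have : 0 ≤ c * s ^ 2 := by positivity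
                                    linarith
  rw [softTrunc, abs_div, abs_of_pos (by linarith : (0:ℝ) < 1 + c * s ^ 2)]
  exact div_le_self (abs_nonneg _) h0

/-- This follows from `|s| ≤ 1 + s²`. The bound degenerates as `c → 0` and only makes `softTrunc c`
admissible in `integral_comp_testing`; passing to the limit rests on the bounds `|s|` and `1`, which
do not depend on `c`. -/
theorem abs_softTrunc_le {c : ℝ} (hc : 0 < c) (s : ℝ) : |softTrunc c s| ≤ 1 + 1 / c := by
  have h0 : 0 < 1 + c * s ^ 2 := by positivity
  rw [softTrunc, abs_div, abs_of_pos h0, div_le_iff₀ h0]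
  have h1 : (1 + 1 / c) * (1 + c * s ^ 2) = 1 + 1 / c + c * s ^ 2 + s ^ 2 := by
    field_simp
    ring
  rw [h1]
  have h2 : 0 ≤ c * s ^ 2 := by positivity
  have h3 : 0 ≤ 1 / c := by positivity
  nlinarith [sq_nonneg (|s| - 1), sq_abs s]

theorem abs_deriv_softTrunc_le {c : ℝ} (hc : 0 ≤ c) (s : ℝ) : |deriv (softTrunc c) s| ≤ 1 := by
  have h0 : 0 ≤ c * s ^ 2 := by positivity
  rw [(hasDerivAt_softTrunc hc s).deriv, abs_div, abs_of_pos (by positivity : 0 < (1 + c * s ^ 2) ^ 2),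
    div_le_one (by positivity), abs_le]
  constructor <;> nlinarith

/-- Testing a distributional equation with the solution itself times a test function. -/
theorem integral_self_testing {U : Set G} (hU : IsOpen U)
    (hUfin : μ U ≠ ⊤) {v : G → ℝ} {g : G → G →L[ℝ] ℝ}
    (hv : MemLp v 2 (μ.restrict U)) (hg : MemLp g 2 (μ.restrict U))
    (hw : ∀ φ : G → ℝ, IsBump U φ → ∀ w,
      ∫ z in U, v z * fderiv ℝ φ z w ∂μ = -∫ z in U, g z w * φ z ∂μ)
    {α : G → ℝ} {γ : G → G} (hα : IntegrableOn α U μ)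
    (hαv : IntegrableOn (fun z => α z * v z) U μ) (hγ : MemLp γ 2 (μ.restrict U))
    (heq : ∀ φ : G → ℝ, IsBump U φ →
      ∫ z in U, (α z * φ z + fderiv ℝ φ z (γ z)) ∂μ = 0)
    {p : G → ℝ} (hp : IsBump U p) :
    ∫ z in U, (α z * v z * p z + p z * g z (γ z) + v z * fderiv ℝ p z (γ z)) ∂μ = 0 := by
  obtain ⟨C, hC0, hpC, hpC'⟩ := hp.exists_bound
  have hpc := hp.1.continuous
  have hpc' := hp.1.continuous_fderiv (by norm_num)
  have hmgγ : AEStronglyMeasurable (fun z => g z (γ z)) (μ.restrict U) :=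
    (ContinuousLinearMap.apply ℝ ℝ).aestronglyMeasurable_comp₂ hγ.1 hg.1
  have hmpγ : AEStronglyMeasurable (fun z => fderiv ℝ p z (γ z)) (μ.restrict U) :=
    (ContinuousLinearMap.apply ℝ ℝ).aestronglyMeasurable_comp₂ hγ.1 hpc'.aestronglyMeasurable
  let c : ℕ → ℝ := fun k => 1 / (k + 1 : ℝ)
  have hc0 : ∀ k, 0 < c k := fun k => by positivity
  have hc : Tendsto c atTop (𝓝 0) := tendsto_one_div_add_atTop_nhds_zero_nat
  let Φ : ℕ → G → ℝ := fun k z => α z * softTrunc (c k) (v z) * p z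
    + deriv (softTrunc (c k)) (v z) * p z * g z (γ z) + softTrunc (c k) (v z) * fderiv ℝ p z (γ z)
  have hΦ0 : ∀ k, ∫ z in U, Φ k z ∂μ = 0 := fun k =>
    integral_comp_testing hU hUfin hv hg hw hα hγ heq (contDiff_softTrunc (hc0 k).le)
      (M := 1 + 1 / c k) (fun s => abs_softTrunc_le (hc0 k) s)
      (fun s => (abs_deriv_softTrunc_le (hc0 k).le s).trans
        (by have := hc0 k; have : 0 ≤ 1 / c k := by positivity
            linarith)) hp
  -- Since `|b(s)| ≤ |s|` and `|b'| ≤ 1`, only the integrability of `α v` enters for the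
  -- zeroth-order term, not any bound on `v`.
  let D : G → ℝ := fun z => ‖α z * v z‖ * C + C * (‖g z‖ * ‖γ z‖) + C * (‖v z‖ * ‖γ z‖)
  have hD : Integrable D (μ.restrict U) :=
    ((hαv.norm.mul_const _).add ((integrable_norm_mul_norm hg hγ).const_mul _)).add
      ((integrable_norm_mul_norm hv hγ).const_mul _)
  have hlim : Tendsto (fun k => ∫ z in U, Φ k z ∂μ) atTop (𝓝 (∫ z in U,
      (α z * v z * p z + 1 * p z * g z (γ z) + v z * fderiv ℝ p z (γ z)) ∂μ)) := by
    refine tendsto_integral_of_dominated_convergence D (fun k => ?_) hD (fun k => ?_) ?_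
    · have h1 : AEStronglyMeasurable (fun z => softTrunc (c k) (v z)) (μ.restrict U) :=
        (contDiff_softTrunc (hc0 k).le).continuous.comp_aestronglyMeasurable hv.1
      have h2 : AEStronglyMeasurable (fun z => deriv (softTrunc (c k)) (v z)) (μ.restrict U) :=
        ((contDiff_softTrunc (hc0 k).le).continuous_deriv
          (by norm_num)).comp_aestronglyMeasurable hv.1
      exact (((hα.aestronglyMeasurable.mul h1).mul hpc.aestronglyMeasurable).add
        ((h2.mul hpc.aestronglyMeasurable).mul hmgγ)).add (h1.mul hmpγ)
    · refine Eventually.of_forall fun z => (norm_add₃_le).trans ?_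
      have b1 := abs_softTrunc_le_abs (hc0 k).le (v z)
      have b2 := abs_deriv_softTrunc_le (hc0 k).le (v z)
      have b3 : ‖fderiv ℝ p z (γ z)‖ ≤ C * ‖γ z‖ :=
        ((fderiv ℝ p z).le_opNorm _).trans (by gcongr; exact hpC' z)
      simp only [norm_mul]
      dsimp only [D]
      rw [norm_mul]
      gcongr ?_ + ?_ + ?_
      · gcongr
        · exact b1
        · exact hpC z
      · calc _ ≤ 1 * C * (‖g z‖ * ‖γ z‖) := by
              gcongr
              · exact b2
              · exact hpC z
              · exact (g z).le_opNorm _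
          _ = _ := by ring
      · calc _ ≤ ‖v z‖ * (C * ‖γ z‖) := by
              gcongr
              exact b1
          _ = _ := by ring
    · refine Eventually.of_forall fun z => ?_
      have t0 : Tendsto (fun k => 1 + c k * v z ^ 2) atTop (𝓝 1) := by
        simpa using (hc.mul_const (v z ^ 2)).const_add 1
      have t1 : Tendsto (fun k => softTrunc (c k) (v z)) atTop (𝓝 (v z)) := by
        have := (tendsto_const_nhds (x := v z)).div t0 one_ne_zero
        rwa [div_one] at this
      have t2 : Tendsto (fun k => deriv (softTrunc (c k)) (v z)) atTop (𝓝 1) := by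
        have e : ∀ k, deriv (softTrunc (c k)) (v z) =
            (1 - c k * v z ^ 2) / (1 + c k * v z ^ 2) ^ 2 :=
          fun k => (hasDerivAt_softTrunc (hc0 k).le _).deriv
        simp only [e]
        have t3 : Tendsto (fun k => 1 - c k * v z ^ 2) atTop (𝓝 1) := by
          simpa using (hc.mul_const (v z ^ 2)).const_sub 1
        have := t3.div (t0.pow 2) (by norm_num)
        rw [one_pow, div_one] at this
        exact this
      exact (((t1.const_mul _).mul_const _).add ((t2.mul_const _).mul_const _)).add
        (t1.mul_const _)
  simp only [hΦ0, one_mul] at hlim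
  exact (tendsto_nhds_unique hlim tendsto_const_nhds)

end Testing

/-! ### Vanishing integrals and the weak differential of the solution -/

section Identities

variable {m n : ℕ}

/-- `f` is integrable and its integral vanishes. -/
def HasZeroIntegral {X : Type*} [MeasurableSpace X] (μ : Measure X) (f : X → ℝ) : Prop :=
  Integrable f μ ∧ ∫ x, f x ∂μ = 0

namespace HasZeroIntegral

variable {X : Type*} [MeasurableSpace X] {μ : Measure X} {f g : X → ℝ}

theorem add (hf : HasZeroIntegral μ f) (hg : HasZeroIntegral μ g) :
    HasZeroIntegral μ (fun x => f x + g x) :=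
  ⟨hf.1.add hg.1, by rw [integral_add hf.1 hg.1, hf.2, hg.2, add_zero]⟩

theorem const_mul (hf : HasZeroIntegral μ f) (c : ℝ) : HasZeroIntegral μ (fun x => c * f x) :=
  ⟨hf.1.const_mul c, by rw [integral_const_mul, hf.2, mul_zero]⟩

theorem sum {ι : Type*} {s : Finset ι} {f : ι → X → ℝ} (hf : ∀ i ∈ s, HasZeroIntegral μ (f i)) :
    HasZeroIntegral μ (fun x => ∑ i ∈ s, f i x) :=
  ⟨integrable_finsetSum s fun i hi => (hf i hi).1, by
    rw [integral_finsetSum s fun i hi => (hf i hi).1]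
    exact Finset.sum_eq_zero fun i hi => (hf i hi).2⟩

theorem congr_on {s : Set X} (hs : MeasurableSet s) (hf : HasZeroIntegral (μ.restrict s) f)
    (h : ∀ x ∈ s, f x = g x) : HasZeroIntegral (μ.restrict s) g :=
  ⟨hf.1.congr ((ae_restrict_mem hs).mono h), by
    rw [← hf.2]; exact (setIntegral_congr_fun hs h).symm⟩

theorem of_subset {s t : Set X} (ht : MeasurableSet t) (hst : s ⊆ t)
    (hf : HasZeroIntegral (μ.restrict s) f) (h0 : ∀ x ∈ t, x ∉ s → f x = 0) :
    HasZeroIntegral (μ.restrict t) f :=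
  ⟨IntegrableOn.of_forall_sdiff_eq_zero hf.1 ht fun x hx => h0 x hx.1 hx.2, by
    rw [setIntegral_eq_of_subset_of_forall_sdiff_eq_zero ht hst fun x hx => h0 x hx.1 hx.2]
    exact hf.2⟩

end HasZeroIntegral

theorem isOpen_slab (a b : ℝ) : IsOpen (slab n a b) := isOpen_Ioo.prod isOpen_univ

theorem measurableSet_slab (a b : ℝ) : MeasurableSet (slab n a b) := (isOpen_slab a b).measurableSet

theorem eq_sum_basis (w : ST n) : w = w.1 • eT n + ∑ j, w.2 j • eX j := by
  refine Prod.ext ?_ ?_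
  · simp [eT, eX, Prod.fst_sum]
  · simp only [eT, eX, Prod.snd_add, Prod.smul_snd, smul_zero, zero_add, Prod.snd_sum]
    ext k
    simp [Pi.single_apply]

/-- The differential of the `i`-th component of `u`, assembled from its weak derivatives. -/
noncomputable def weakDifferential (ut : ST n → E m) (Du : ST n → Fin m → E n) (i : Fin m)
    (z : ST n) : ST n →L[ℝ] ℝ :=
  ut z i • ContinuousLinearMap.fst ℝ ℝ (E n) +
    (innerSL ℝ (Du z i)).comp (ContinuousLinearMap.snd ℝ ℝ (E n))

theorem weakDifferential_apply (ut : ST n → E m) (Du : ST n → Fin m → E n) (i : Fin m)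
    (z w : ST n) : weakDifferential ut Du i z w = dirDeriv ut Du z w i := by
  simp [weakDifferential, dirDeriv]

/-- A relatively compact open neighbourhood of the support of a test function. -/
theorem exists_nhd_of_isCompact {a b : ℝ} {K : Set (ST n)} (hK : IsCompact K)
    (hKs : K ⊆ slab n a b) : ∃ U : Set (ST n), IsOpen U ∧ K ⊆ U ∧ IsCompact (closure U) ∧
      closure U ⊆ slab n a b ∧ ∃ R > 0, U ⊆ Ioo a b ×ˢ Metric.ball (0 : E n) R := by
  obtain ⟨U, hUo, hKU, hUs, hUc⟩ :=
    exists_open_between_and_isCompact_closure hK (isOpen_slab a b) hKs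
  refine ⟨U, hUo, hKU, hUc, hUs, ?_⟩
  obtain ⟨R, hR, hUR⟩ := hUc.isBounded.subset_ball_lt 0 (0 : ST n)
  refine ⟨R, hR, fun z hz => ⟨(hUs (subset_closure hz)).1, ?_⟩⟩
  have := hUR (subset_closure hz)
  rw [Metric.mem_ball, Prod.dist_eq, max_lt_iff] at this
  exact this.2

variable {a b : ℝ} {u ut : ST n → E m} {Du : ST n → Fin m → E n}

theorem memLp_apply {μ : Measure (ST n)} {v : ST n → E m} (hv : MemLp v 2 μ) (i : Fin m) :
    MemLp (fun z => v z i) 2 μ :=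
  (EuclideanSpace.proj (𝕜 := ℝ) i).comp_memLp' hv

theorem IsH1.memLp_weakDifferential (h : IsH1 a b u ut Du) {U : Set (ST n)} {R : ℝ} (hR : 0 < R)
    (hU : U ⊆ Ioo a b ×ˢ Metric.ball (0 : E n) R) (i : Fin m) :
    MemLp (weakDifferential ut Du i) 2 (volume.restrict U) := by
  have hm := Measure.restrict_mono (μ := volume) hU le_rfl
  have h1 : MemLp (fun z => ut z i) 2 (volume.restrict U) :=
    (memLp_apply (h.memLp_time R hR) i).mono_measure hm
  have h2 : MemLp (fun z => Du z i) 2 (volume.restrict U) := (h.memLp_space R hR i).mono_measure hm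
  let L1 : ℝ →L[ℝ] (ST n →L[ℝ] ℝ) :=
    (ContinuousLinearMap.id ℝ ℝ).smulRight (ContinuousLinearMap.fst ℝ ℝ (E n))
  let L2 : E n →L[ℝ] (ST n →L[ℝ] ℝ) :=
    ((compL ℝ (ST n) (E n) ℝ).flip (ContinuousLinearMap.snd ℝ ℝ (E n))).comp (innerSL ℝ)
  refine ((L1.comp_memLp' h1).add (L2.comp_memLp' h2)).ae_eq (Eventually.of_forall fun z => ?_)
  ext w <;> simp [L1, L2, weakDifferential]

theorem setIntegral_slab_eq {U : Set (ST n)} (hU : U ⊆ slab n a b) {f : ST n → ℝ}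
    (hf : ∀ z ∉ U, f z = 0) : ∫ z in slab n a b, f z = ∫ z in U, f z :=
  setIntegral_eq_of_subset_of_forall_sdiff_eq_zero (measurableSet_slab a b) hU
    fun z hz => hf z hz.2

theorem fderiv_eq_zero_of_notMem {W : Type*} [NormedAddCommGroup W] [NormedSpace ℝ W]
    {φ : ST n → W} {U : Set (ST n)} (hφ : tsupport φ ⊆ U) {z : ST n} (hz : z ∉ U) :
    fderiv ℝ φ z = 0 :=
  image_eq_zero_of_notMem_tsupport fun h => hz (hφ (tsupport_fderiv_subset ℝ h))

/-- The definition of weak derivatives covers the coordinate directions; both sides are linear in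
the direction `w`. The passage from the slab to a bounded `U` puts everything in `L²` on a set of
finite measure. -/
theorem IsH1.integral_mul_fderiv (h : IsH1 a b u ut Du) {U : Set (ST n)} {R : ℝ} (hR : 0 < R)
    (hUR : U ⊆ Ioo a b ×ˢ Metric.ball (0 : E n) R) (i : Fin m)
    {φ : ST n → ℝ} (hφ : IsBump U φ) (w : ST n) :
    ∫ z in U, u z i * fderiv ℝ φ z w = -∫ z in U, weakDifferential ut Du i z w * φ z := by
  have hUs : U ⊆ slab n a b := hUR.trans (prod_mono le_rfl (subset_univ _))
  have hfin : volume U ≠ ⊤ := by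
    refine ((measure_mono hUR).trans_lt ?_).ne
    rw [Measure.volume_eq_prod, Measure.prod_prod]
    exact ENNReal.mul_lt_top measure_Ioo_lt_top measure_ball_lt_top
  have : IsFiniteMeasure (volume.restrict U) := ⟨by simpa using hfin.lt_top⟩
  have hm := Measure.restrict_mono (μ := volume) hUR le_rfl
  have hu1 : Integrable (fun z => u z i) (volume.restrict U) :=
    ((memLp_apply (h.memLp R hR) i).mono_measure hm).integrable (by norm_num)
  have hg1 : Integrable (weakDifferential ut Du i) (volume.restrict U) :=
    (h.memLp_weakDifferential hR hUR i).integrable (by norm_num)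
  have htest : IsTestFunction (slab n a b) φ := ⟨hφ.1, hφ.2.1, hφ.2.2.trans hUs⟩
  obtain ⟨C, hC0, hC, hC'⟩ := hφ.exists_bound
  have i1 : ∀ e : ST n, Integrable (fun z => u z i * fderiv ℝ φ z e) (volume.restrict U) := by
    intro e
    refine hu1.mul_bdd (c := C * ‖e‖) ?_ (Eventually.of_forall fun z => ?_)
    · exact ((hφ.1.continuous_fderiv (by norm_num)).clm_apply continuous_const).aestronglyMeasurable
    · exact ((fderiv ℝ φ z).le_opNorm e).trans (by gcongr; exact hC' z)
  have i2 : ∀ e : ST n, Integrable (fun z => weakDifferential ut Du i z e * φ z)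
      (volume.restrict U) := by
    intro e
    exact (hg1.apply_continuousLinearMap e).mul_bdd (c := C) hφ.1.continuous.aestronglyMeasurable
      (Eventually.of_forall hC)
  have key : ∀ e : ST n, (e = eT n ∨ ∃ j, e = eX j) →
      HasZeroIntegral (volume.restrict U)
        (fun z => u z i * fderiv ℝ φ z e + weakDifferential ut Du i z e * φ z) := by
    intro e he
    refine ⟨(i1 e).add (i2 e), ?_⟩
    have hz1 : ∀ z ∉ U, u z i * fderiv ℝ φ z e = 0 := fun z hz => by
      simp [fderiv_eq_zero_of_notMem hφ.2.2 hz]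
    have hz2 : ∀ (f : ST n → ℝ), ∀ z ∉ U, f z * φ z = 0 := fun f z hz => by
      simp [image_eq_zero_of_notMem_tsupport (fun h => hz (hφ.2.2 h))]
    rw [integral_add (i1 e) (i2 e)]
    rcases he with rfl | ⟨j, rfl⟩
    · have := (h.weak φ htest i).1
      rw [setIntegral_slab_eq hUs hz1, setIntegral_slab_eq hUs (hz2 fun z => ut z i)] at this
      simp only [weakDifferential_apply, dirDeriv, eT, inner_zero_right, mul_one, add_zero] at this ⊢
      linarith
    · have := (h.weak φ htest i).2 j
      rw [setIntegral_slab_eq hUs hz1, setIntegral_slab_eq hUs (hz2 fun z => Du z i j)] at this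
      simp only [weakDifferential_apply, dirDeriv, eX, mul_zero, zero_add,
        EuclideanSpace.inner_single_right, one_mul, conj_trivial] at this ⊢
      linarith
  have hw : ∫ z in U, (u z i * fderiv ℝ φ z w + weakDifferential ut Du i z w * φ z) = 0 := by
    have e1 : ∀ z, u z i * fderiv ℝ φ z w + weakDifferential ut Du i z w * φ z =
        w.1 * (u z i * fderiv ℝ φ z (eT n) + weakDifferential ut Du i z (eT n) * φ z) +
        ∑ j, w.2 j * (u z i * fderiv ℝ φ z (eX j) + weakDifferential ut Du i z (eX j) * φ z) := by
      intro z
      conv_lhs => rw [eq_sum_basis w]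
      simp only [map_add, map_smul, map_sum, smul_eq_mul, mul_add, Finset.mul_sum, Finset.sum_mul,
        Finset.sum_add_distrib, add_mul]
      have c1 : ∀ j, u z i * (w.2 j * fderiv ℝ φ z (eX j)) =
        w.2 j * (u z i * fderiv ℝ φ z (eX j)) := fun j => by ring
      have c2 : ∀ j, w.2 j * weakDifferential ut Du i z (eX j) * φ z =
        w.2 j * (weakDifferential ut Du i z (eX j) * φ z) := fun j => by ring
      simp only [c1, c2]
      ring
    simp only [e1]
    exact (((key _ (Or.inl rfl)).const_mul _).add
      (HasZeroIntegral.sum fun j _ => (key (eX j) (Or.inr ⟨j, rfl⟩)).const_mul _)).2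
  rw [integral_add (i1 w) (i2 w)] at hw
  linarith

end Identities

/-! ### Self-testing with integrability -/

section SelfTesting

variable {G : Type*} [NormedAddCommGroup G] [NormedSpace ℝ G] [FiniteDimensional ℝ G]
  [MeasurableSpace G] [BorelSpace G] {μ : Measure G} [μ.IsAddHaarMeasure]

/-- The integral of a non-integrable function is zero by convention, so integrability is recorded
along with the vanishing; otherwise the identities could not be added. -/
theorem hasZeroIntegral_self_testing {U : Set G} (hU : IsOpen U)
    (hUfin : μ U ≠ ⊤) {v : G → ℝ} {g : G → G →L[ℝ] ℝ}
    (hv : MemLp v 2 (μ.restrict U)) (hg : MemLp g 2 (μ.restrict U))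
    (hw : ∀ φ : G → ℝ, IsBump U φ → ∀ w,
      ∫ z in U, v z * fderiv ℝ φ z w ∂μ = -∫ z in U, g z w * φ z ∂μ)
    {α : G → ℝ} {γ : G → G} (hα : IntegrableOn α U μ)
    (hαv : IntegrableOn (fun z => α z * v z) U μ) (hγ : MemLp γ 2 (μ.restrict U))
    (heq : ∀ φ : G → ℝ, IsBump U φ →
      ∫ z in U, (α z * φ z + fderiv ℝ φ z (γ z)) ∂μ = 0)
    {p : G → ℝ} (hp : IsBump U p) :
    HasZeroIntegral (μ.restrict U)
      (fun z => α z * v z * p z + p z * g z (γ z) + v z * fderiv ℝ p z (γ z)) := by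
  refine ⟨?_, integral_self_testing hU hUfin hv hg hw hα hαv hγ heq hp⟩
  obtain ⟨C, hC0, hpC, hpC'⟩ := hp.exists_bound
  have hpc := hp.1.continuous.aestronglyMeasurable (μ := μ.restrict U)
  have hpc' := hp.1.continuous_fderiv (by norm_num)
  have hmgγ : AEStronglyMeasurable (fun z => g z (γ z)) (μ.restrict U) :=
    (ContinuousLinearMap.apply ℝ ℝ).aestronglyMeasurable_comp₂ hγ.1 hg.1
  have hmpγ : AEStronglyMeasurable (fun z => fderiv ℝ p z (γ z)) (μ.restrict U) :=
    (ContinuousLinearMap.apply ℝ ℝ).aestronglyMeasurable_comp₂ hγ.1 hpc'.aestronglyMeasurable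
  refine ((hαv.mul_bdd (c := C) hpc (Eventually.of_forall hpC)).add ?_).add ?_
  · refine ((integrable_norm_mul_norm hg hγ).const_mul C).mono' (hpc.mul hmgγ)
      (Eventually.of_forall fun z => ?_)
    rw [norm_mul]
    gcongr
    · exact hpC z
    · exact (g z).le_opNorm _
  · refine ((integrable_norm_mul_norm hv hγ).const_mul C).mono' (hv.1.mul hmpγ)
      (Eventually.of_forall fun z => ?_)
    have b3 : ‖fderiv ℝ p z (γ z)‖ ≤ C * ‖γ z‖ :=
      ((fderiv ℝ p z).le_opNorm _).trans (by gcongr; exact hpC' z)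
    rw [norm_mul]
    calc _ ≤ ‖v z‖ * (C * ‖γ z‖) := by gcongr
      _ = _ := by ring

end SelfTesting

/-! ### The equation tested with the solution -/

section SolutionIdentities

variable {m n : ℕ} {a b : ℝ} {u ut : ST n → E m} {Du : ST n → Fin m → E n} {F : E m → ℝ}

instance : (volume : Measure (ST n)).IsAddHaarMeasure := by
  rw [Measure.volume_eq_prod]; infer_instance

theorem volume_ne_top_of_subset {U : Set (ST n)} {R : ℝ}
    (hUR : U ⊆ Ioo a b ×ˢ Metric.ball (0 : E n) R) : volume U ≠ ⊤ := by
  refine ((measure_mono hUR).trans_lt ?_).ne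
  rw [Measure.volume_eq_prod, Measure.prod_prod]
  exact ENNReal.mul_lt_top measure_Ioo_lt_top measure_ball_lt_top

/-- The product rule for `u²`, obtained by self-testing: the definition of the weak derivative is
itself a weak equation, with `α = ∂ₑuᵢ` and `γ = uᵢ e`. -/
theorem IsH1.hasZeroIntegral_sq_fderiv (h : IsH1 a b u ut Du) {p : ST n → ℝ}
    (hp : IsTestFunction (slab n a b) p) (i : Fin m) (e : ST n) :
    HasZeroIntegral (volume.restrict (slab n a b))
      (fun z => p z * (2 * u z i * dirDeriv ut Du z e i) + u z i ^ 2 * fderiv ℝ p z e) := by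
  obtain ⟨U, hUo, hKU, -, hUs, R, hR, hUR⟩ := exists_nhd_of_isCompact hp.2.1 hp.2.2
  have hUs' : U ⊆ slab n a b := subset_closure.trans hUs
  have hUfin := volume_ne_top_of_subset hUR
  have : IsFiniteMeasure (volume.restrict U) := ⟨by simpa using hUfin.lt_top⟩
  have hpU : IsBump U p := ⟨hp.1, hp.2.1, hKU⟩
  have hv : MemLp (fun z => u z i) 2 (volume.restrict U) :=
    (memLp_apply (h.memLp R hR) i).mono_measure (Measure.restrict_mono hUR le_rfl)
  have hg := h.memLp_weakDifferential hR hUR i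
  have hge : MemLp (fun z => weakDifferential ut Du i z e) 2 (volume.restrict U) :=
    (ContinuousLinearMap.apply ℝ ℝ e).comp_memLp' hg
  have hγ : MemLp (fun z => u z i • e) 2 (volume.restrict U) :=
    ((ContinuousLinearMap.id ℝ ℝ).smulRight e).comp_memLp' hv
  have hw := fun φ (hφ : IsBump U φ) w => h.integral_mul_fderiv hR hUR i hφ w
  have := hasZeroIntegral_self_testing hUo hUfin hv hg hw (hge.integrable (by norm_num))
    (hge.integrable_mul hv) hγ ?_ hpU
  · refine HasZeroIntegral.of_subset (measurableSet_slab a b) hUs'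
      (this.congr_on hUo.measurableSet fun z _ => ?_) fun z _ hz => ?_
    · rw [map_smul, map_smul, smul_eq_mul, smul_eq_mul, weakDifferential_apply]
      ring
    · simp [image_eq_zero_of_notMem_tsupport fun h' => hz (hKU h'),
        fderiv_eq_zero_of_notMem hKU hz]
  · intro φ hφ
    obtain ⟨C, hC0, hC, hC'⟩ := hφ.exists_bound
    have i1 : Integrable (fun z => u z i * fderiv ℝ φ z e) (volume.restrict U) := by
      refine (hv.integrable (by norm_num)).mul_bdd (c := C * ‖e‖) ?_
        (Eventually.of_forall fun z => ?_)
      · exact ((hφ.1.continuous_fderiv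
          (by norm_num)).clm_apply continuous_const).aestronglyMeasurable
      · exact ((fderiv ℝ φ z).le_opNorm e).trans (by gcongr; exact hC' z)
    have i2 : Integrable (fun z => weakDifferential ut Du i z e * φ z) (volume.restrict U) :=
      (hge.integrable (by norm_num)).mul_bdd (c := C) hφ.1.continuous.aestronglyMeasurable
        (Eventually.of_forall hC)
    simp only [map_smul, smul_eq_mul]
    rw [integral_add i2 i1, hw φ hφ e]
    ring

theorem laplacian_slice {φ : ST n → ℝ} (hφ : ContDiff ℝ ∞ φ) (z : ST n) :
    Laplacian.laplacian (fun x : E n => φ (z.1, x)) z.2 =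
      ∑ j, fderiv ℝ (fun y => fderiv ℝ φ y (eX j)) z (eX j) := by
  rw [InnerProductSpace.laplacian_eq_iteratedFDeriv_orthonormalBasis _
    (EuclideanSpace.basisFun (Fin n) ℝ)]
  refine Finset.sum_congr rfl fun j _ => ?_
  have hsl : ∀ (W : Type) [NormedAddCommGroup W] [NormedSpace ℝ W] (f : ST n → W)
      (_ : Differentiable ℝ f) (x : E n),
      HasFDerivAt (fun x : E n => f (z.1, x))
        ((fderiv ℝ f (z.1, x)).comp (ContinuousLinearMap.inr ℝ ℝ (E n))) x := by
    intro W _ _ f hf x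
    exact (hf (z.1, x)).hasFDerivAt.comp x (hasFDerivAt_prodMk_right z.1 x)
  have h1 : fderiv ℝ (fun x : E n => φ (z.1, x)) = fun x =>
      (fderiv ℝ φ (z.1, x)).comp (ContinuousLinearMap.inr ℝ ℝ (E n)) :=
    funext fun x => (hsl ℝ φ (hφ.differentiable (by norm_num)) x).fderiv
  have hd2 : Differentiable ℝ (fderiv ℝ φ) :=
    (hφ.fderiv_right (m := 1) (by norm_cast)).differentiable (by norm_num)
  have hd : Differentiable ℝ (fun y => fderiv ℝ φ y (eX j)) := fun y =>
    (hd2 y).clm_apply (differentiableAt_const _)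
  rw [iteratedFDeriv_two_apply, h1]
  simp only [Matrix.cons_val_zero, Matrix.cons_val_one, EuclideanSpace.basisFun_apply]
  have h2 : DifferentiableAt ℝ (fun x : E n =>
      (fderiv ℝ φ (z.1, x)).comp (ContinuousLinearMap.inr ℝ ℝ (E n))) z.2 :=
    ((hsl _ _ hd2 z.2).differentiableAt).clm_comp (differentiableAt_const _)
  have h3 : fderiv ℝ (fun x : E n =>
      ((fderiv ℝ φ (z.1, x)).comp (ContinuousLinearMap.inr ℝ ℝ (E n)))
        (EuclideanSpace.single j 1)) z.2 (EuclideanSpace.single j 1) =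
      fderiv ℝ (fun x : E n =>
      ((fderiv ℝ φ (z.1, x)).comp (ContinuousLinearMap.inr ℝ ℝ (E n)))) z.2
        (EuclideanSpace.single j 1) (EuclideanSpace.single j 1) := by
    rw [fderiv_clm_apply h2 (differentiableAt_const _)]
    simp
  rw [← h3]
  have h4 := (hsl ℝ _ hd z.2).fderiv
  have h5 : (fun x : E n => ((fderiv ℝ φ (z.1, x)).comp (ContinuousLinearMap.inr ℝ ℝ (E n)))
        (EuclideanSpace.single j 1)) = fun x : E n => fderiv ℝ φ (z.1, x) (eX j) := by
    ext x
    simp [eX]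
  rw [h5, h4]
  simp [eX]

theorem IsTestFunction.fderiv_apply {Ω : Set (ST n)} {φ : ST n → ℝ} (hφ : IsTestFunction Ω φ)
    (e : ST n) : IsTestFunction Ω (fun z => fderiv ℝ φ z e) := by
  refine ⟨(hφ.1.fderiv_right (m := ∞) (by norm_num)).clm_apply contDiff_const, ?_, ?_⟩
  · exact (hφ.2.1.fderiv ℝ).comp_left (g := fun L : ST n →L[ℝ] ℝ => L e) rfl
  · refine (closure_mono ?_).trans ((tsupport_fderiv_subset ℝ).trans hφ.2.2)
    intro z hz
    contrapose! hz
    simp only [Function.mem_support, not_not] at hz ⊢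
    rw [hz]; rfl

/-- The equation `∂ₜ uᵢ - Δ uᵢ = fᵢ(u)` in weak form. -/
theorem IsVariationalSolution.integral_weak_form (h : IsVariationalSolution F a b u ut Du)
    {φ : ST n → ℝ} (hφ : IsTestFunction (slab n a b) φ) (i : Fin m) :
    ∫ z in slab n a b, ((ut z i - gradient F (u z) i) * φ z + fderiv ℝ φ z (0, Du z i)) = 0 := by
  obtain ⟨U, hUo, hKU, hUc, hUs, R, hR, hUR⟩ := exists_nhd_of_isCompact hφ.2.1 hφ.2.2
  have hUs' : U ⊆ slab n a b := subset_closure.trans hUs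
  have hUfin := volume_ne_top_of_subset hUR
  have : IsFiniteMeasure (volume.restrict U) := ⟨by simpa using hUfin.lt_top⟩
  have hm := Measure.restrict_mono (μ := volume) hUR le_rfl
  have hu : Integrable (fun z => u z i) (volume.restrict U) :=
    ((memLp_apply (h.h1.memLp R hR) i).mono_measure hm).integrable (by norm_num)
  have hut : Integrable (fun z => ut z i) (volume.restrict U) :=
    ((memLp_apply (h.h1.memLp_time R hR) i).mono_measure hm).integrable (by norm_num)
  have hDu : ∀ j, Integrable (fun z => Du z i j) (volume.restrict U) := fun j =>
    (((EuclideanSpace.proj (𝕜 := ℝ) j).comp_memLp' (h.h1.memLp_space R hR i)).mono_measure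
      hm).integrable (by norm_num)
  obtain ⟨hloc, heq⟩ := h.distributional i
  have hf : IntegrableOn (fun z => gradient F (u z) i) U :=
    (hloc.integrableOn_compact_subset hUs hUc).mono_set subset_closure
  have bdd : ∀ {f ψ : ST n → ℝ}, IntegrableOn f U → IsTestFunction (slab n a b) ψ →
      IntegrableOn (fun z => f z * ψ z) U := by
    intro f ψ hf hψ
    obtain ⟨C, hC⟩ := hψ.1.continuous.bounded_above_of_compact_support hψ.2.1
    exact hf.mul_bdd (c := C) hψ.1.continuous.aestronglyMeasurable (Eventually.of_forall hC)
  have hz : ∀ {ψ : ST n → ℝ}, tsupport ψ ⊆ U → ∀ (f : ST n → ℝ), ∀ z ∉ U, f z * ψ z = 0 :=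
    fun hψ f z hz => by simp [image_eq_zero_of_notMem_tsupport fun h => hz (hψ h)]
  have hts : ∀ e, tsupport (fun z => fderiv ℝ φ z e) ⊆ U := fun e => by
    refine (closure_mono ?_).trans ((tsupport_fderiv_subset ℝ).trans hKU)
    intro z hz
    contrapose! hz
    simp only [Function.mem_support, not_not] at hz ⊢
    rw [hz]; rfl
  have hts2 : ∀ e, tsupport (fun z => fderiv ℝ (fun y => fderiv ℝ φ y e) z e) ⊆ U := fun e => by
    refine (closure_mono ?_).trans ((tsupport_fderiv_subset ℝ).trans (hts e))
    intro z hz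
    contrapose! hz
    simp only [Function.mem_support, not_not] at hz ⊢
    rw [hz]; rfl
  have wt := (h.h1.weak φ hφ i).1
  -- Each second derivative is removed by using the weak gradient with `∂ⱼφ` as the test function.
  have wx := fun j => (h.h1.weak _ (hφ.fderiv_apply (eX j)) i).2 j
  have hfd := heq φ hφ
  simp only [laplacian_slice hφ.1] at hfd
  rw [setIntegral_slab_eq hUs' (hz (hts _) _), setIntegral_slab_eq hUs' (hz hKU _)] at wt
  have wx' : ∀ j, ∫ z in U, u z i * fderiv ℝ (fun y => fderiv ℝ φ y (eX j)) z (eX j) =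
      -∫ z in U, Du z i j * fderiv ℝ φ z (eX j) := fun j => by
    rw [← setIntegral_slab_eq hUs' (hz (hts2 _) _), ← setIntegral_slab_eq hUs' (hz (hts _) _)]
    exact wx j
  have hL : ∫ z in slab n a b, u z i * (-fderiv ℝ φ z (eT n) -
      ∑ j, fderiv ℝ (fun y => fderiv ℝ φ y (eX j)) z (eX j)) =
      (∫ z in U, ut z i * φ z) + ∑ j, ∫ z in U, Du z i j * fderiv ℝ φ z (eX j) := by
    rw [setIntegral_slab_eq hUs' (U := U)]
    · have e1 : ∀ z, u z i * (-fderiv ℝ φ z (eT n) -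
          ∑ j, fderiv ℝ (fun y => fderiv ℝ φ y (eX j)) z (eX j)) =
          -(u z i * fderiv ℝ φ z (eT n)) -
          ∑ j, u z i * fderiv ℝ (fun y => fderiv ℝ φ y (eX j)) z (eX j) := fun z => by
        rw [mul_sub, Finset.mul_sum]; ring
      simp only [e1]
      have i2 := fun j => bdd hu ((hφ.fderiv_apply (eX j)).fderiv_apply (eX j))
      have i1 : Integrable (fun z => -(u z i * fderiv ℝ φ z (eT n))) (volume.restrict U) :=
        (bdd hu (hφ.fderiv_apply _)).neg
      rw [integral_sub i1 (integrable_finsetSum _ fun j _ => i2 j),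
        integral_neg, wt, integral_finsetSum _ fun j _ => i2 j]
      simp only [wx', Finset.sum_neg_distrib]
      ring
    · intro z hzU
      have e1 : fderiv ℝ φ z (eT n) = 0 :=
        image_eq_zero_of_notMem_tsupport (f := fun z => fderiv ℝ φ z (eT n))
          fun h => hzU (hts _ h)
      have e2 : ∀ j, fderiv ℝ (fun y => fderiv ℝ φ y (eX j)) z (eX j) = 0 := fun j =>
        image_eq_zero_of_notMem_tsupport
          (f := fun z => fderiv ℝ (fun y => fderiv ℝ φ y (eX j)) z (eX j)) fun h => hzU (hts2 _ h)
      simp [e1, e2]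
  rw [hL, setIntegral_slab_eq hUs' (hz hKU _)] at hfd
  have e3 : ∀ z, fderiv ℝ φ z (0, Du z i) = ∑ j, Du z i j * fderiv ℝ φ z (eX j) := fun z => by
    conv_lhs => rw [eq_sum_basis ((0, Du z i) : ST n)]
    simp
  rw [setIntegral_slab_eq hUs' (U := U)]
  · simp only [e3, sub_mul]
    have j1 := fun j => bdd (hDu j) (hφ.fderiv_apply (eX j))
    have j2 : Integrable (fun z => ut z i * φ z - gradient F (u z) i * φ z)
        (volume.restrict U) := (bdd hut hφ).sub (bdd hf hφ)
    rw [integral_add j2 (integrable_finsetSum _ fun j _ => j1 j),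
      integral_sub (bdd hut hφ) (bdd hf hφ), integral_finsetSum _ fun j _ => j1 j]
    linarith
  · intro z hzU
    simp [fderiv_eq_zero_of_notMem hKU hzU,
      image_eq_zero_of_notMem_tsupport fun h => hzU (hKU h)]

/-- Self-testing with `α = ∂ₜuᵢ - fᵢ(u)` and `γ = (0, ∇uᵢ)`. The separate integrability of `uᵢ
fᵢ(u)` for each component is what makes it applicable. -/
theorem IsVariationalSolution.hasZeroIntegral_energy (h : IsVariationalSolution F a b u ut Du)
    {p : ST n → ℝ} (hp : IsTestFunction (slab n a b) p) (i : Fin m) :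
    HasZeroIntegral (volume.restrict (slab n a b))
      (fun z => ‖Du z i‖ ^ 2 * p z + u z i * fderiv ℝ p z (0, Du z i)
        + (u z i * ut z i - u z i * gradient F (u z) i) * p z) := by
  obtain ⟨U, hUo, hKU, hUc, hUs, R, hR, hUR⟩ := exists_nhd_of_isCompact hp.2.1 hp.2.2
  have hUs' : U ⊆ slab n a b := subset_closure.trans hUs
  have hUfin := volume_ne_top_of_subset hUR
  have : IsFiniteMeasure (volume.restrict U) := ⟨by simpa using hUfin.lt_top⟩
  have hm := Measure.restrict_mono (μ := volume) hUR le_rfl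
  have hpU : IsBump U p := ⟨hp.1, hp.2.1, hKU⟩
  have hv : MemLp (fun z => u z i) 2 (volume.restrict U) :=
    (memLp_apply (h.h1.memLp R hR) i).mono_measure hm
  have hut : MemLp (fun z => ut z i) 2 (volume.restrict U) :=
    (memLp_apply (h.h1.memLp_time R hR) i).mono_measure hm
  have hγ : MemLp (fun z => ((0, Du z i) : ST n)) 2 (volume.restrict U) :=
    (ContinuousLinearMap.inr ℝ ℝ (E n)).comp_memLp' ((h.h1.memLp_space R hR i).mono_measure hm)
  have hg := h.h1.memLp_weakDifferential hR hUR i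
  have hw := fun φ (hφ : IsBump U φ) w => h.h1.integral_mul_fderiv hR hUR i hφ w
  have hf : IntegrableOn (fun z => gradient F (u z) i) U :=
    ((h.distributional i).1.integrableOn_compact_subset hUs hUc).mono_set subset_closure
  have huf : IntegrableOn (fun z => u z i * gradient F (u z) i) U :=
    (h.integrable_uf R hR i).mono_set hUR
  have hαv : IntegrableOn (fun z => (ut z i - gradient F (u z) i) * u z i) U := by
    refine ((hut.integrable_mul hv).sub huf).congr (Eventually.of_forall fun z => ?_)
    simp only [Pi.sub_apply, Pi.mul_apply]; ring
  have := hasZeroIntegral_self_testing hUo hUfin hv hg hw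
    ((hut.integrable (by norm_num)).sub hf) hαv hγ (fun φ hφ => ?_) hpU
  · refine HasZeroIntegral.of_subset (measurableSet_slab a b) hUs'
      (this.congr_on hUo.measurableSet fun z _ => ?_) fun z _ hz => ?_
    · simp only [weakDifferential_apply, dirDeriv, Pi.sub_apply, mul_zero, zero_add,
        real_inner_self_eq_norm_sq]
      ring
    · simp [image_eq_zero_of_notMem_tsupport fun h' => hz (hKU h'),
        fderiv_eq_zero_of_notMem hKU hz]
  · have e := h.integral_weak_form ⟨hφ.1, hφ.2.1, hφ.2.2.trans hUs'⟩ i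
    rwa [setIntegral_slab_eq hUs'] at e
    intro z hz
    simp [image_eq_zero_of_notMem_tsupport fun h' => hz (hφ.2.2 h'),
      fderiv_eq_zero_of_notMem hφ.2.2 hz]

end SolutionIdentities

theorem integrable_mul_clm_apply {X W : Type*} [MeasurableSpace X] {μ : Measure X}
    [NormedAddCommGroup W] [NormedSpace ℝ W] {f : X → ℝ} {g : X → W →L[ℝ] ℝ} {Y : X → W}
    (hf : MemLp f 2 μ) (hg : MemLp g 2 μ) (hY : AEStronglyMeasurable Y μ) {C : ℝ}
    (hC : ∀ x, ‖Y x‖ ≤ C) : Integrable (fun x => f x * g x (Y x)) μ := by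
  have hm : AEStronglyMeasurable (fun z => g z (Y z)) μ :=
    (ContinuousLinearMap.apply ℝ ℝ).aestronglyMeasurable_comp₂ hY hg.1
  refine ((integrable_norm_mul_norm hf hg).const_mul C).mono' (hf.1.mul hm)
    (Eventually.of_forall fun z => ?_)
  rw [norm_mul]
  calc _ ≤ ‖f z‖ * (‖g z‖ * C) := by
        gcongr
        exact ((g z).le_opNorm _).trans (by gcongr; exact hC z)
    _ = _ := by ring

/-! ### Domain variations along the scaling field -/

section Variation

variable {m n : ℕ} {a b : ℝ} {u ut : ST n → E m} {Du : ST n → Fin m → E n} {F : E m → ℝ}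

theorem IsVariationalSolution.integrableOn_energy (h : IsVariationalSolution F a b u ut Du)
    {R : ℝ} (hR : 0 < R) :
    IntegrableOn (energy F u Du) (Ioo a b ×ˢ Metric.ball (0 : E n) R) := by
  refine Integrable.sub (integrable_finsetSum _ fun i _ => ?_) ((h.integrable_F R hR).const_mul 2)
  exact (h.h1.memLp_space R hR i).integrable_norm_pow (by norm_num)

/-- For a field supported compactly in the open slab, the interval `(a + δ, b - δ)` contains all
times of the support once `δ` is small. The boundary integrals then vanish and the identity extends
to the whole slab. -/
theorem IsVariationalSolution.hasZeroIntegral_variation (h : IsVariationalSolution F a b u ut Du)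
    {ψ : ST n → ST n} (hψ : ContDiff ℝ ∞ ψ) (hs : HasCompactSupport ψ)
    (hsub : tsupport ψ ⊆ slab n a b) :
    HasZeroIntegral (volume.restrict (slab n a b)) (fun z => energy F u Du z * divST ψ z
      - 2 * ∑ i, ∑ j, Du z i j * dirDeriv ut Du z (fderiv ℝ ψ z (eX j)) i
      - 2 * ∑ i, ut z i * dirDeriv ut Du z (ψ z) i) := by
  obtain ⟨U, hUo, hKU, hUc, hUs, R, hR, hUR⟩ := exists_nhd_of_isCompact hs hsub
  have hUs' : U ⊆ slab n a b := subset_closure.trans hUs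
  have hm := Measure.restrict_mono (μ := volume) hUR le_rfl
  have hψ' : Continuous (fderiv ℝ ψ) := hψ.continuous_fderiv (by norm_num)
  set I : ST n → ℝ := fun z => energy F u Du z * divST ψ z
      - 2 * ∑ i, ∑ j, Du z i j * dirDeriv ut Du z (fderiv ℝ ψ z (eX j)) i
      - 2 * ∑ i, ut z i * dirDeriv ut Du z (ψ z) i with hI
  have hI0 : ∀ z ∉ tsupport ψ, I z = 0 := by
    intro z hz
    have e1 : ψ z = 0 := image_eq_zero_of_notMem_tsupport hz
    have e2 : fderiv ℝ ψ z = 0 := fderiv_eq_zero_of_notMem le_rfl hz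
    simp [hI, divST, e1, e2, dirDeriv]
  refine ⟨?_, ?_⟩
  · have hint : IntegrableOn I U := by
      have hg := fun i => h.h1.memLp_weakDifferential hR hUR i
      have prod : ∀ (i : Fin m) (f : ST n → ℝ) (Y : ST n → ST n),
          MemLp f 2 (volume.restrict U) → Continuous Y → HasCompactSupport Y →
          IntegrableOn (fun z => f z * dirDeriv ut Du z (Y z) i) U := by
        intro i f Y hf hY hYs
        obtain ⟨C, hC⟩ := hY.bounded_above_of_compact_support hYs
        simp only [← weakDifferential_apply]
        exact integrable_mul_clm_apply hf (hg i) hY.aestronglyMeasurable hC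
      refine (Integrable.sub ?_ ((integrable_finsetSum _ fun i _ =>
        integrable_finsetSum _ fun j _ => ?_).const_mul 2)).sub
        ((integrable_finsetSum _ fun i _ => ?_).const_mul 2)
      · have hdc : Continuous (divST ψ) := by
          unfold divST
          refine ((hψ'.clm_apply continuous_const).fst).add (continuous_finsetSum _ fun j _ => ?_)
          exact (EuclideanSpace.proj (𝕜 := ℝ) j).continuous.comp
            (hψ'.clm_apply continuous_const).snd
        have hds : HasCompactSupport (divST ψ) := by
          refine (hs.fderiv ℝ).mono fun z hz => ?_
          contrapose! hz
          simp only [Function.mem_support, not_not] at hz ⊢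
          simp [divST, hz]
        obtain ⟨C, hC⟩ := hdc.bounded_above_of_compact_support hds
        exact ((h.integrableOn_energy hR).mono_set hUR).mul_bdd (c := C)
          hdc.aestronglyMeasurable (Eventually.of_forall hC)
      · refine prod i (fun z => Du z i j) (fun z => fderiv ℝ ψ z (eX j)) ?_
          (hψ'.clm_apply continuous_const) ?_
        · exact ((EuclideanSpace.proj (𝕜 := ℝ) j).comp_memLp'
            (h.h1.memLp_space R hR i)).mono_measure hm
        · exact (hs.fderiv ℝ).comp_left (g := fun L : ST n →L[ℝ] ST n => L (eX j)) rfl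
      · exact prod i (fun z => ut z i) ψ ((memLp_apply (h.h1.memLp_time R hR) i).mono_measure hm)
          hψ.continuous hs
    exact IntegrableOn.of_forall_sdiff_eq_zero hint (measurableSet_slab a b)
      fun z hz => hI0 z fun h' => hz.2 (hKU h')
  -- A point of the support is needed below to see that `a + δ < b - δ`.
  · rcases (tsupport ψ).eq_empty_or_nonempty with hemp | ⟨z₀, hz₀⟩
    · have : ∀ z, I z = 0 := fun z => hI0 z (by simp [hemp])
      simp [this]
    obtain ⟨ε, hε, hεs⟩ := hs.exists_cthickening_subset_open (isOpen_slab a b) hsub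
    have hloc : ∀ z ∈ tsupport ψ, a + ε < z.1 ∧ z.1 < b - ε := by
      intro z hz
      have h1 : ((z.1 - ε, z.2) : ST n) ∈ slab n a b := hεs
        (Metric.mem_cthickening_of_dist_le _ z ε _ hz (by
          rw [Prod.dist_eq]; simp [abs_of_pos hε, hε.le]))
      have h2 : ((z.1 + ε, z.2) : ST n) ∈ slab n a b := hεs
        (Metric.mem_cthickening_of_dist_le _ z ε _ hz (by
          rw [Prod.dist_eq]; simp [abs_of_pos hε, hε.le]))
      have h3 := h1.1.1
      have h4 := h2.1.2
      simp only at h3 h4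
      constructor <;> linarith
    obtain ⟨δ₀, hδ₀, hae⟩ := h.variation
    have hc : 0 < min δ₀ ε := lt_min hδ₀ hε
    -- An admissible `δ` exists since the variation identity holds for almost every `δ` in an
    -- interval of positive length.
    have hne : (ae (volume.restrict (Ioo 0 (min δ₀ ε)))).NeBot := by
      rw [ae_neBot, Ne, Measure.restrict_eq_zero, Real.volume_Ioo]
      simpa using hc
    obtain ⟨δ, hδ, hδm⟩ := ((ae_restrict_of_ae hae).and (ae_restrict_mem measurableSet_Ioo)).exists
      (f := ae (volume.restrict (Ioo 0 (min δ₀ ε))))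
    have hδε : δ < ε := hδm.2.trans_le (min_le_right _ _)
    have hvar : IsVariation a b ψ := by
      refine ⟨hψ.of_le (by norm_num), ?_⟩
      obtain ⟨R', hR'⟩ := hs.isBounded.subset_closedBall (0 : ST n)
      refine ⟨R', fun t _ x hx => ?_⟩
      by_contra hne'
      have := hR' (subset_tsupport _ hne')
      rw [Metric.mem_closedBall, Prod.dist_eq, max_le_iff] at this
      exact absurd ((dist_zero_right x).symm.trans_le this.2) (not_le.2 hx)
    have hz := hloc z₀ hz₀
    have key := hδ hδm.1 (hδm.2.trans_le (min_le_left _ _)) (by linarith) ψ hvar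
    have hb0 : ∀ x, ψ (b - δ, x) = 0 := fun x => image_eq_zero_of_notMem_tsupport fun h' => by
      have := (hloc _ h').2
      simp only at this
      linarith
    have ha0 : ∀ x, ψ (a + δ, x) = 0 := fun x => image_eq_zero_of_notMem_tsupport fun h' => by
      have := (hloc _ h').1
      simp only at this
      linarith
    rw [firstVariation] at key
    simp only [hb0, ha0, Prod.fst_zero, mul_zero, integral_zero, sub_zero, add_zero] at key
    rw [setIntegral_eq_integral_of_forall_compl_eq_zero fun z hz => hI0 z fun h' => hz (hsub h')]
    rw [setIntegral_eq_integral_of_forall_compl_eq_zero fun z hz => hI0 z fun h' => hz ?_] at key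
    · exact key
    · have := hloc z h'
      exact ⟨⟨by linarith, by linarith⟩, mem_univ _⟩

/-- The generator `2 (t - T) ∂ₜ + (x - x₀) · ∇` of the parabolic scaling about `(T, x₀)`. -/
def scalingField (T : ℝ) (x₀ : E n) (z : ST n) : ST n := (2 * (z.1 - T), z.2 - x₀)

variable {T : ℝ} {x₀ : E n}

theorem contDiff_scalingField : ContDiff ℝ ∞ (scalingField T x₀) :=
  (contDiff_const.mul (contDiff_fst.sub contDiff_const)).prodMk (contDiff_snd.sub contDiff_const)

theorem hasFDerivAt_scalingField (z : ST n) : HasFDerivAt (scalingField T x₀)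
    (((2 : ℝ) • ContinuousLinearMap.fst ℝ ℝ (E n)).prod (ContinuousLinearMap.snd ℝ ℝ (E n))) z :=
  ((hasFDerivAt_fst.sub_const T).const_mul 2).prodMk (hasFDerivAt_snd.sub_const x₀)

theorem fderiv_smul_scalingField {p : ST n → ℝ} {z : ST n} (hp : DifferentiableAt ℝ p z)
    (w : ST n) : fderiv ℝ (fun z => p z • scalingField T x₀ z) z w =
      p z • ((2 * w.1, w.2) : ST n) + fderiv ℝ p z w • scalingField T x₀ z := by
  have h1 : fderiv ℝ (fun z => p z • scalingField T x₀ z) z = _ :=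
    (hp.hasFDerivAt.smul (hasFDerivAt_scalingField z)).fderiv
  rw [h1]
  rfl

theorem fderiv_apply_eq_sum {p : ST n → ℝ} (z w : ST n) :
    fderiv ℝ p z w = w.1 * fderiv ℝ p z (eT n) + ∑ j, w.2 j * fderiv ℝ p z (eX j) := by
  conv_lhs => rw [eq_sum_basis w]
  simp

theorem divST_smul_scalingField {p : ST n → ℝ} {z : ST n} (hp : DifferentiableAt ℝ p z) :
    divST (fun z => p z • scalingField T x₀ z) z =
      (n + 2) * p z + fderiv ℝ p z (scalingField T x₀ z) := by
  rw [divST, fderiv_apply_eq_sum z (scalingField T x₀ z)]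
  simp only [fderiv_smul_scalingField hp]
  simp [eT, eX, Finset.sum_add_distrib, scalingField, mul_comm]
  ring

theorem dirDeriv_add (z v w : ST n) (i : Fin m) :
    dirDeriv ut Du z (v + w) i = dirDeriv ut Du z v i + dirDeriv ut Du z w i := by
  simp only [← weakDifferential_apply, map_add]

theorem dirDeriv_smul (c : ℝ) (z v : ST n) (i : Fin m) :
    dirDeriv ut Du z (c • v) i = c * dirDeriv ut Du z v i := by
  simp only [← weakDifferential_apply, map_smul, smul_eq_mul]

theorem dirDeriv_eX (z : ST n) (j : Fin n) (i : Fin m) : dirDeriv ut Du z (eX j) i = Du z i j := by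
  simp [dirDeriv, eX, EuclideanSpace.inner_single_right]

theorem dirDeriv_eq_sum (z w : ST n) (i : Fin m) : dirDeriv ut Du z w i =
    w.1 * dirDeriv ut Du z (eT n) i + ∑ j, w.2 j * dirDeriv ut Du z (eX j) i := by
  simp only [← weakDifferential_apply]
  conv_lhs => rw [eq_sum_basis w]
  simp

theorem tsupport_mul_subset_of_isTestFunction {Ω : Set (ST n)} {p f : ST n → ℝ}
    (hp : IsTestFunction Ω p) (hf : ContDiff ℝ ∞ f) : IsTestFunction Ω (fun z => p z * f z) :=
  ⟨hp.1.mul hf, hp.2.1.mul_right, tsupport_mul_subset_left.trans hp.2.2⟩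

/-- The domain variation identity along the scaling field. -/
theorem IsVariationalSolution.hasZeroIntegral_scaling (h : IsVariationalSolution F a b u ut Du)
    (T : ℝ) (x₀ : E n) {p : ST n → ℝ} (hp : IsTestFunction (slab n a b) p) :
    HasZeroIntegral (volume.restrict (slab n a b)) (fun z =>
      energy F u Du z * ((n + 2) * p z + fderiv ℝ p z (scalingField T x₀ z))
      - 2 * ∑ i, (p z * ‖Du z i‖ ^ 2 + fderiv ℝ p z (0, Du z i) *
          dirDeriv ut Du z (scalingField T x₀ z) i)
      - 2 * ∑ i, p z * (ut z i * dirDeriv ut Du z (scalingField T x₀ z) i)) := by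
  have hs : tsupport (fun z => p z • scalingField T x₀ z) ⊆ tsupport p :=
    tsupport_smul_subset_left p _
  refine (h.hasZeroIntegral_variation (ψ := fun z => p z • scalingField T x₀ z)
    (hp.1.smul contDiff_scalingField) hp.2.1.smul_right (hs.trans hp.2.2)).congr_on
    (measurableSet_slab a b) fun z _ => ?_
  have hd : DifferentiableAt ℝ p z := hp.1.differentiable (by norm_num) z
  rw [divST_smul_scalingField hd]
  congr 2
  · congr 1
    refine Finset.sum_congr rfl fun i _ => ?_
    have e1 : ((0, Du z i) : ST n).1 = 0 := rfl
    have e2 : ((0, Du z i) : ST n).2 = Du z i := rfl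
    have e3 : ∀ j : Fin n, ((2 * (eX j : ST n).1, (eX j : ST n).2) : ST n) = eX j := fun j => by
      simp [eX]
    rw [fderiv_apply_eq_sum z (0, Du z i), e1, e2, zero_mul, zero_add, EuclideanSpace.real_norm_sq_eq,
      Finset.mul_sum, Finset.sum_mul, ← Finset.sum_add_distrib]
    refine Finset.sum_congr rfl fun j _ => ?_
    rw [fderiv_smul_scalingField hd, e3, dirDeriv_add, dirDeriv_smul, dirDeriv_smul, dirDeriv_eX]
    ring
  · refine Finset.sum_congr rfl fun i _ => ?_
    rw [dirDeriv_smul]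
    ring

/-- The divergence theorem for `|uᵢ|²` along the scaling field. -/
theorem IsH1.hasZeroIntegral_sq_scaling (h : IsH1 a b u ut Du) (T : ℝ) (x₀ : E n) {p : ST n → ℝ}
    (hp : IsTestFunction (slab n a b) p) (i : Fin m) :
    HasZeroIntegral (volume.restrict (slab n a b)) (fun z =>
      2 * p z * (u z i * dirDeriv ut Du z (scalingField T x₀ z) i)
      + u z i ^ 2 * ((n + 2) * p z + fderiv ℝ p z (scalingField T x₀ z))) := by
  have c0 : ContDiff ℝ ∞ fun z : ST n => (scalingField T x₀ z).1 := contDiff_scalingField.fst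
  have cj : ∀ j, ContDiff ℝ ∞ fun z : ST n => (scalingField T x₀ z).2 j := fun j =>
    (EuclideanSpace.proj (𝕜 := ℝ) j).contDiff.comp (contDiff_scalingField (T := T) (x₀ := x₀)).snd
  refine ((h.hasZeroIntegral_sq_fderiv (tsupport_mul_subset_of_isTestFunction hp c0) i (eT n)).add
    (HasZeroIntegral.sum (s := Finset.univ) fun j _ => h.hasZeroIntegral_sq_fderiv
      (tsupport_mul_subset_of_isTestFunction hp (cj j)) i (eX j))).congr_on
    (measurableSet_slab a b) fun z _ => ?_
  have hd : HasFDerivAt p (fderiv ℝ p z) z := (hp.1.differentiable (by norm_num) z).hasFDerivAt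
  have d0 : fderiv ℝ (fun z => p z * (scalingField T x₀ z).1) z (eT n) =
      p z * 2 + (scalingField T x₀ z).1 * fderiv ℝ p z (eT n) := by
    have h1 : fderiv ℝ (fun z => p z * (scalingField T x₀ z).1) z = _ :=
      (hd.mul (hasFDerivAt_scalingField z).fst).fderiv
    rw [h1]
    simp [eT]
  have dj : ∀ j, fderiv ℝ (fun z => p z * (scalingField T x₀ z).2 j) z (eX j) =
      p z + (scalingField T x₀ z).2 j * fderiv ℝ p z (eX j) := fun j => by
    have h1 : fderiv ℝ (fun z => p z * (scalingField T x₀ z).2 j) z = _ :=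
      (hd.mul ((EuclideanSpace.proj (𝕜 := ℝ) j).hasFDerivAt.comp z
        (hasFDerivAt_scalingField (T := T) (x₀ := x₀) z).snd)).fderiv
    rw [h1]
    simp [eX]
  simp only [d0, dj]
  rw [fderiv_apply_eq_sum z (scalingField T x₀ z), dirDeriv_eq_sum z (scalingField T x₀ z)]
  simp only [Finset.sum_add_distrib, mul_add, Finset.mul_sum, Finset.sum_const, Finset.card_univ,
    Fintype.card_fin, nsmul_eq_mul]
  have e1 : ∀ j, p z * (scalingField T x₀ z).2 j * (2 * u z i * dirDeriv ut Du z (eX j) i) =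
    2 * p z * (u z i * ((scalingField T x₀ z).2 j * dirDeriv ut Du z (eX j) i)) := fun j => by ring
  simp only [e1]
  ring

end Variation

/-! ### Homogeneity of the heat kernel -/

section HeatKernel

variable {n : ℕ} {T : ℝ} {x₀ : E n}

/-- The same formula holds for both signs of `y`, so the times before and after `T` need no separate
computation. -/
theorem hasDerivAt_mul_abs_rpow {y r : ℝ} (hy : y ≠ 0) :
    HasDerivAt (fun y : ℝ => y * |y| ^ r) ((1 + r) * |y| ^ r) y := by
  have h1 : HasDerivAt (fun y : ℝ => Real.exp (Real.log y * r)) (Real.exp (Real.log y * r) * (y⁻¹ * r)) y :=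
    ((Real.hasDerivAt_log hy).mul_const r).exp
  have h2 : ∀ y : ℝ, y ≠ 0 → |y| ^ r = Real.exp (Real.log y * r) := fun y hy => by
    rw [Real.rpow_def_of_pos (abs_pos.2 hy), Real.log_abs]
  have h3 : HasDerivAt (fun y : ℝ => |y| ^ r) (|y| ^ r * (y⁻¹ * r)) y := by
    rw [h2 y hy]
    refine h1.congr_of_eventuallyEq ?_
    filter_upwards [isOpen_ne.mem_nhds hy] with y' hy' using h2 y' hy'
  refine ((hasDerivAt_id y).mul h3).congr_deriv ?_
  simp only [id]
  field_simp

theorem hasFDerivAt_heatKernel {z : ST n} (hz : z.1 ≠ T) :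
    HasFDerivAt (heatKernel T x₀) (heatKernel T x₀ z •
      ((n / (2 * (T - z.1)) - ‖z.2 - x₀‖ ^ 2 / (4 * (T - z.1) ^ 2)) •
          ContinuousLinearMap.fst ℝ ℝ (E n)
        - (1 / (2 * (T - z.1))) • (innerSL ℝ (z.2 - x₀)).comp
          (ContinuousLinearMap.snd ℝ ℝ (E n)))) z := by
  have hτ : T - z.1 ≠ 0 := sub_ne_zero.2 hz.symm
  have hy : 4 * Real.pi * (T - z.1) ≠ 0 := by positivity
  have ht : HasFDerivAt (fun z : ST n => T - z.1) (-ContinuousLinearMap.fst ℝ ℝ (E n)) z :=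
    hasFDerivAt_fst.const_sub T
  have h1 := (hasDerivAt_mul_abs_rpow (r := -(n : ℝ) / 2 - 1) hy).comp_hasFDerivAt z
    (ht.const_mul (4 * Real.pi))
  have h2 : HasFDerivAt (fun z : ST n => ‖z.2 - x₀‖ ^ 2)
      (2 • (innerSL ℝ (z.2 - x₀)).comp (ContinuousLinearMap.snd ℝ ℝ (E n))) z :=
    (hasFDerivAt_snd.sub_const x₀).norm_sq
  have h3 := (hasDerivAt_inv (mul_ne_zero four_ne_zero hτ)).comp_hasFDerivAt z (ht.const_mul 4)
  have h4 := ((h2.mul h3).neg).exp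
  refine (HasFDerivAt.congr_fderiv (h1.mul h4) ?_).congr_of_eventuallyEq (Eventually.of_forall fun z => ?_)
  · ext w
    · simp [heatKernel, div_eq_mul_inv]
      field_simp
      ring
    · simp [heatKernel, div_eq_mul_inv]
      field_simp
      ring
  · simp [heatKernel, div_eq_mul_inv]

theorem contDiffAt_heatKernel {z : ST n} (hz : z.1 ≠ T) : ContDiffAt ℝ ∞ (heatKernel T x₀) z := by
  have hτ : T - z.1 ≠ 0 := sub_ne_zero.2 hz.symm
  have hy : 4 * Real.pi * (T - z.1) ≠ 0 := by positivity
  have ht : ContDiffAt ℝ ∞ (fun z : ST n => T - z.1) z := contDiffAt_const.sub contDiffAt_fst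
  have hc : ContDiffAt ℝ ∞ (fun z : ST n => 4 * Real.pi * (T - z.1)) z := contDiffAt_const.mul ht
  refine (hc.mul (ContDiffAt.rpow_const_of_ne ?_ (abs_ne_zero.2 hy))).mul (ContDiffAt.exp ?_)
  · exact (contDiffAt_abs hy).comp z hc
  · exact (((contDiffAt_snd.sub contDiffAt_const).norm_sq ℝ).div (contDiffAt_const.mul ht)
      (mul_ne_zero four_ne_zero hτ)).neg

/-- Euler's relation: the exponential is invariant under the parabolic scaling and the prefactor has
degree `-n`. Together with `div X = n + 2` this leaves `div(G q X) = G (2q + Xq)`. -/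
theorem fderiv_heatKernel_scalingField {z : ST n} (hz : z.1 ≠ T) :
    fderiv ℝ (heatKernel T x₀) z (scalingField T x₀ z) = -n * heatKernel T x₀ z := by
  have hτ : T - z.1 ≠ 0 := sub_ne_zero.2 hz.symm
  rw [(hasFDerivAt_heatKernel hz).fderiv]
  simp only [scalingField, smul_apply, sub_apply, comp_apply, ContinuousLinearMap.coe_fst',
    ContinuousLinearMap.coe_snd', innerSL_apply_apply, smul_eq_mul, real_inner_self_eq_norm_sq]
  field_simp
  ring

theorem fderiv_heatKernel_space {z : ST n} (hz : z.1 ≠ T) (w : E n) :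
    fderiv ℝ (heatKernel T x₀) z (0, w) =
      -(inner ℝ w (z.2 - x₀) / (2 * (T - z.1))) * heatKernel T x₀ z := by
  rw [(hasFDerivAt_heatKernel hz).fderiv]
  simp only [smul_apply, sub_apply, comp_apply, ContinuousLinearMap.coe_fst',
    ContinuousLinearMap.coe_snd', innerSL_apply_apply, smul_eq_mul, mul_zero, zero_sub,
    real_inner_comm w]
  ring

variable {a b : ℝ}

theorem IsTestFunction.smooth_mul {Ω : Set (ST n)} {q g : ST n → ℝ} (hq : IsTestFunction Ω q)
    (hg : ∀ z ∈ Ω, ContDiffAt ℝ ∞ g z) : IsTestFunction Ω (fun z => g z * q z) := by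
  have hs : tsupport (fun z => g z * q z) ⊆ tsupport q := tsupport_mul_subset_right
  refine ⟨contDiff_iff_contDiffAt.2 fun z => ?_, hq.2.1.mul_left, hs.trans hq.2.2⟩
  by_cases hz : z ∈ tsupport (fun z => g z * q z)
  · exact (hg z (hq.2.2 (hs hz))).mul hq.1.contDiffAt
  · exact contDiffAt_const.congr_of_eventuallyEq (notMem_tsupport_iff_eventuallyEq.1 hz)

theorem contDiffAt_heatKernel_div {z : ST n} (hz : z.1 ≠ T) :
    ContDiffAt ℝ ∞ (fun z => heatKernel T x₀ z / (T - z.1)) z :=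
  (contDiffAt_heatKernel hz).div (contDiffAt_const.sub contDiffAt_fst) (sub_ne_zero.2 hz.symm)

theorem fderiv_heatKernel_mul {q : ST n → ℝ} {z : ST n} (hq : DifferentiableAt ℝ q z)
    (hz : z.1 ≠ T) (w : ST n) : fderiv ℝ (fun z => heatKernel T x₀ z * q z) z w =
      heatKernel T x₀ z * fderiv ℝ q z w + q z * fderiv ℝ (heatKernel T x₀) z w := by
  have h : fderiv ℝ (fun z => heatKernel T x₀ z * q z) z = _ :=
    ((hasFDerivAt_heatKernel hz).differentiableAt.hasFDerivAt.mul hq.hasFDerivAt).fderiv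
  rw [h]
  simp

/-- The function `G / (T - t)` has degree `-(n + 2)`, which exactly balances `div X`, so the field
`G X / (T - t)` is divergence free. -/
theorem fderiv_heatKernel_div_mul {q : ST n → ℝ} {z : ST n} (hq : DifferentiableAt ℝ q z)
    (hz : z.1 ≠ T) : fderiv ℝ (fun z => heatKernel T x₀ z / (T - z.1) * q z) z
      (scalingField T x₀ z) = heatKernel T x₀ z / (T - z.1) *
        (fderiv ℝ q z (scalingField T x₀ z) - (n + 2) * q z) := by
  have hτ : T - z.1 ≠ 0 := sub_ne_zero.2 hz.symm
  have ht : HasFDerivAt (fun z : ST n => T - z.1) (-ContinuousLinearMap.fst ℝ ℝ (E n)) z :=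
    hasFDerivAt_fst.const_sub T
  have h : fderiv ℝ (fun z => heatKernel T x₀ z * (T - z.1)⁻¹ * q z) z = _ :=
    (((hasFDerivAt_heatKernel hz).differentiableAt.hasFDerivAt.mul
      ((hasDerivAt_inv hτ).comp_hasFDerivAt z ht)).mul hq.hasFDerivAt).fderiv
  simp only [div_eq_mul_inv]
  rw [h]
  have e := fderiv_heatKernel_scalingField (x₀ := x₀) hz
  simp only [add_apply, smul_apply, Pi.mul_apply, Function.comp_apply, smul_eq_mul, e, neg_apply,
    ContinuousLinearMap.coe_fst']
  simp only [scalingField]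
  field_simp
  ring

end HeatKernel

/-! ### The localized monotonicity identity -/

section WeightedIdentities

variable {m n : ℕ} {a b T : ℝ} {x₀ : E n} {u ut : ST n → E m} {Du : ST n → Fin m → E n}
  {F : E m → ℝ}

theorem dirDeriv_scalingField (z : ST n) (i : Fin m) :
    dirDeriv ut Du z (scalingField T x₀ z) i =
      inner ℝ (Du z i) (z.2 - x₀) - 2 * (T - z.1) * ut z i := by
  simp only [dirDeriv, scalingField]; ring

/-- Since `G X / (T - t)` is divergence free, only the derivative of `q` survives besides `u·Xu`. -/
theorem IsH1.hasZeroIntegral_weighted_sq (h : IsH1 a b u ut Du) (hT : T ∉ Ioo a b)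
    {q : ST n → ℝ} (hq : IsTestFunction (slab n a b) q) :
    HasZeroIntegral (volume.restrict (slab n a b)) (fun z => heatKernel T x₀ z / (T - z.1) *
      (2 * q z * (∑ i, u z i * dirDeriv ut Du z (scalingField T x₀ z) i)
        + ‖u z‖ ^ 2 * fderiv ℝ q z (scalingField T x₀ z))) := by
  have hne : ∀ z ∈ slab n a b, z.1 ≠ T := fun z hz he => hT (he ▸ hz.1)
  refine (HasZeroIntegral.sum (s := Finset.univ) fun i _ => h.hasZeroIntegral_sq_scaling T x₀
    (hq.smooth_mul fun z hz => contDiffAt_heatKernel_div (x₀ := x₀) (hne z hz)) i).congr_on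
    (measurableSet_slab a b) fun z hz => ?_
  simp only [fderiv_heatKernel_div_mul (hq.1.differentiable (by norm_num) z) (hne z hz)]
  rw [EuclideanSpace.real_norm_sq_eq]
  simp only [Finset.mul_sum, Finset.sum_mul, ← Finset.sum_add_distrib]
  refine Finset.sum_congr rfl fun i _ => ?_
  ring

/-- Testing with `G q u` produces `-u·Xu G q / (2(T - t))`; the factor `β / 4` on the weighted
identity is chosen to cancel `β` times this term. Rewriting `β|∇u|² - β u·f` as `|∇u|² + bulk + (β -
1) energy` gives `|∇u|²` the coefficient one for all `β`, including zero and negative ones. -/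
theorem IsVariationalSolution.hasZeroIntegral_gradient (h : IsVariationalSolution F a b u ut Du)
    (hT : T ∉ Ioo a b) (β : ℝ) {q : ST n → ℝ} (hq : IsTestFunction (slab n a b) q) :
    HasZeroIntegral (volume.restrict (slab n a b)) (fun z => heatKernel T x₀ z *
      ((∑ i, ‖Du z i‖ ^ 2) * q z + β * (∑ i, u z i * fderiv ℝ q z (0, Du z i))
        + bulk F β u z * q z + (β - 1) * energy F u Du z * q z
        + β / 4 * (1 / (T - z.1) * ‖u z‖ ^ 2) * fderiv ℝ q z (scalingField T x₀ z))) := by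
  have hne : ∀ z ∈ slab n a b, z.1 ≠ T := fun z hz he => hT (he ▸ hz.1)
  refine (((HasZeroIntegral.sum (s := Finset.univ) fun i _ => h.hasZeroIntegral_energy
    (hq.smooth_mul fun z hz => contDiffAt_heatKernel (x₀ := x₀) (hne z hz)) i).const_mul β).add
    ((h.h1.hasZeroIntegral_weighted_sq (x₀ := x₀) hT hq).const_mul (β / 4))).congr_on
    (measurableSet_slab a b) fun z hz => ?_
  have hτ : T - z.1 ≠ 0 := sub_ne_zero.2 (hne z hz).symm
  have e1 : ∑ i, (‖Du z i‖ ^ 2 * (heatKernel T x₀ z * q z) + u z i *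
      fderiv ℝ (fun z => heatKernel T x₀ z * q z) z (0, Du z i)
        + (u z i * ut z i - u z i * gradient F (u z) i) * (heatKernel T x₀ z * q z)) =
      heatKernel T x₀ z * ((∑ i, ‖Du z i‖ ^ 2) * q z + ∑ i, u z i * fderiv ℝ q z (0, Du z i)
      - q z / (2 * (T - z.1)) * (∑ i, u z i * dirDeriv ut Du z (scalingField T x₀ z) i)
      - (∑ i, u z i * gradient F (u z) i) * q z) := by
    simp only [fderiv_heatKernel_mul (hq.1.differentiable (by norm_num) z) (hne z hz),
      fderiv_heatKernel_space (hne z hz), dirDeriv_scalingField, Finset.mul_sum, Finset.sum_mul,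
      ← Finset.sum_add_distrib, ← Finset.sum_sub_distrib]
    refine Finset.sum_congr rfl fun i _ => ?_
    field_simp
    ring
  have e2 : inner ℝ (u z) (gradient F (u z)) = ∑ i, u z i * gradient F (u z) i := by
    rw [PiLp.inner_apply]
    exact Finset.sum_congr rfl fun i _ => by simp [mul_comm]
  rw [e1, bulk, energy, e2]
  field_simp
  ring

/-- The variation along `G q X` yields `|Xu|² / (T - t)` and `-2|∇u|²`. Twice the gradient identity
removes the latter, and `-β` times the weighted identity supplies the cross term `-2β u·Xu / (T -
t)`. Completing the square costs `-β²|u|² / (T - t)`, which is the part of the `|u|²` term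
multiplied by `2βq`. -/
theorem IsVariationalSolution.hasZeroIntegral_monotonicity
    (h : IsVariationalSolution F a b u ut Du)
    (hT : T ∉ Ioo a b) (β : ℝ) {q : ST n → ℝ} (hq : IsTestFunction (slab n a b) q) :
    HasZeroIntegral (volume.restrict (slab n a b)) (fun z => heatKernel T x₀ z *
      ((energy F u Du z - β / 2 * (1 / (T - z.1) * ‖u z‖ ^ 2)) *
          (2 * β * q z + fderiv ℝ q z (scalingField T x₀ z))
        + (2 * bulk F β u z + 1 / (T - z.1) * defect β T x₀ u ut Du z) * q z
        + 2 * ∑ i, fderiv ℝ q z (0, Du z i) *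
          (β * u z i - dirDeriv ut Du z (scalingField T x₀ z) i))) := by
  have hne : ∀ z ∈ slab n a b, z.1 ≠ T := fun z hz he => hT (he ▸ hz.1)
  refine (((h.hasZeroIntegral_scaling T x₀
    (hq.smooth_mul fun z hz => contDiffAt_heatKernel (x₀ := x₀) (hne z hz))).add
    ((h.hasZeroIntegral_gradient (x₀ := x₀) hT β hq).const_mul 2)).add
    ((h.h1.hasZeroIntegral_weighted_sq (x₀ := x₀) hT hq).const_mul (-β))).congr_on
    (measurableSet_slab a b) fun z hz => ?_
  have hτ : T - z.1 ≠ 0 := sub_ne_zero.2 (hne z hz).symm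
  have hd : DifferentiableAt ℝ q z := hq.1.differentiable (by norm_num) z
  have hu2 : ‖u z‖ ^ 2 = ∑ i, u z i ^ 2 := EuclideanSpace.real_norm_sq_eq _
  have e1 : ∑ i, (heatKernel T x₀ z * q z * ‖Du z i‖ ^ 2 +
      fderiv ℝ (fun z => heatKernel T x₀ z * q z) z (0, Du z i) *
        dirDeriv ut Du z (scalingField T x₀ z) i) +
      ∑ i, heatKernel T x₀ z * q z * (ut z i * dirDeriv ut Du z (scalingField T x₀ z) i) =
      heatKernel T x₀ z * (q z * ∑ i, ‖Du z i‖ ^ 2 +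
        ∑ i, fderiv ℝ q z (0, Du z i) * dirDeriv ut Du z (scalingField T x₀ z) i -
        q z / (2 * (T - z.1)) * ∑ i, dirDeriv ut Du z (scalingField T x₀ z) i ^ 2) := by
    simp only [fderiv_heatKernel_mul hd (hne z hz),
      fderiv_heatKernel_space (hne z hz), dirDeriv_scalingField, Finset.mul_sum,
      ← Finset.sum_add_distrib, ← Finset.sum_sub_distrib]
    refine Finset.sum_congr rfl fun i _ => ?_
    field_simp
    ring
  have e2 : defect β T x₀ u ut Du z = ∑ i, dirDeriv ut Du z (scalingField T x₀ z) i ^ 2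
      - 2 * β * (∑ i, u z i * dirDeriv ut Du z (scalingField T x₀ z) i)
      + β ^ 2 * ‖u z‖ ^ 2 := by
    rw [hu2]
    simp only [defect, ← dirDeriv_scalingField, Finset.mul_sum, ← Finset.sum_add_distrib,
      ← Finset.sum_sub_distrib]
    exact Finset.sum_congr rfl fun i _ => by ring
  have e3 : ∑ i, fderiv ℝ q z (0, Du z i) *
      (β * u z i - dirDeriv ut Du z (scalingField T x₀ z) i) =
      β * (∑ i, u z i * fderiv ℝ q z (0, Du z i)) -
      ∑ i, fderiv ℝ q z (0, Du z i) * dirDeriv ut Du z (scalingField T x₀ z) i := by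
    simp only [Finset.mul_sum, ← Finset.sum_sub_distrib]
    exact Finset.sum_congr rfl fun i _ => by ring
  rw [fderiv_heatKernel_mul hd (hne z hz), fderiv_heatKernel_scalingField (hne z hz)]
  rw [sub_sub, ← mul_add, e1, e2, e3]
  have e4 : ∑ i, ‖Du z i‖ ^ 2 = energy F u Du z + 2 * F (u z) := by rw [energy]; ring
  rw [e4]
  field_simp
  ring

end WeightedIdentities

/-! ### Cutoff functions in space and time -/

section Cutoff

variable {n : ℕ}

/-- Rescaled bumps `χ((x - x₀) / (N + 1))`. The bound on `|∇η_N| |x - x₀|` is scale invariant and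
absorbs the linear growth of the scaling field; it is `2M` because `χ` lives in the ball of radius
two. -/
theorem exists_spatial_cutoff (x₀ : E n) : ∃ (η : ℕ → E n → ℝ) (C : ℝ), 0 ≤ C ∧
    (∀ N, ContDiff ℝ ∞ (η N)) ∧ (∀ N, HasCompactSupport (η N)) ∧ (∀ N x, 0 ≤ η N x) ∧
    (∀ N x, η N x ≤ 1) ∧ (∀ N x, ‖fderiv ℝ (η N) x‖ ≤ C) ∧
    (∀ N x, ‖fderiv ℝ (η N) x‖ * ‖x - x₀‖ ≤ C) ∧
    ∀ x, ∀ᶠ N in atTop, η N x = 1 ∧ fderiv ℝ (η N) x = 0 := by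
  let χ : ContDiffBump (0 : E n) := ⟨1, 2, one_pos, one_lt_two⟩
  obtain ⟨M, hM⟩ := (χ.contDiff.continuous_fderiv (n := 1) (by norm_num)).bounded_above_of_compact_support
    (χ.hasCompactSupport.fderiv ℝ)
  have hM0 : 0 ≤ M := (norm_nonneg _).trans (hM 0)
  let s : ℕ → ℝ := fun N => ((N : ℝ) + 1)⁻¹
  have hs0 : ∀ N, 0 < s N := fun N => by positivity
  have hs1 : ∀ N, s N ≤ 1 := fun N => inv_le_one_of_one_le₀ (by
    have : (0 : ℝ) ≤ N := N.cast_nonneg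
    linarith)
  have hd : ∀ N x, HasFDerivAt (fun x => χ (s N • (x - x₀)))
      ((fderiv ℝ χ (s N • (x - x₀))).comp (s N • ContinuousLinearMap.id ℝ (E n))) x := by
    intro N x
    have h1 : HasFDerivAt χ (fderiv ℝ χ (s N • (x - x₀))) (s N • (x - x₀)) :=
      (χ.contDiff.differentiable (n := 1) (by norm_num) _).hasFDerivAt
    have h2 : HasFDerivAt (fun x : E n => s N • (x - x₀))
        (s N • ContinuousLinearMap.id ℝ (E n)) x :=
      ((hasFDerivAt_id x).sub_const x₀).const_smul (s N)
    exact HasFDerivAt.comp (g := χ) x h1 h2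
  have hn : ∀ N x, ‖fderiv ℝ (fun x => χ (s N • (x - x₀))) x‖ ≤
      s N * ‖fderiv ℝ χ (s N • (x - x₀))‖ := by
    intro N x
    rw [(hd N x).fderiv, comp_smul, comp_id, norm_smul, Real.norm_of_nonneg (hs0 N).le]
  refine ⟨fun N x => χ (s N • (x - x₀)), 2 * M, by positivity, fun N => ?_, fun N => ?_,
    fun N x => χ.nonneg, fun N x => χ.le_one, fun N x => ?_, fun N x => ?_, fun x => ?_⟩
  · have h2 : ContDiff ℝ ∞ (fun x : E n => s N • (x - x₀)) :=
      (contDiff_id.sub contDiff_const).const_smul (s N)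
    exact χ.contDiff.comp h2
  · exact χ.hasCompactSupport.comp_homeomorph
      ((Homeomorph.subRight x₀).trans (Homeomorph.smulOfNeZero (s N) (hs0 N).ne'))
  · refine (hn N x).trans ?_
    calc _ ≤ 1 * M := by
          gcongr
          · exact hs1 N
          · exact hM _
      _ ≤ _ := by linarith
  · refine (mul_le_mul_of_nonneg_right (hn N x) (norm_nonneg _)).trans ?_
    have e : s N * ‖fderiv ℝ χ (s N • (x - x₀))‖ * ‖x - x₀‖ =
        ‖fderiv ℝ χ (s N • (x - x₀))‖ * ‖s N • (x - x₀)‖ := by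
      rw [norm_smul, Real.norm_of_nonneg (hs0 N).le]; ring
    rw [e]
    by_cases hx : ‖s N • (x - x₀)‖ ≤ 2
    · calc _ ≤ M * 2 := by
            gcongr
            exact hM _
        _ = _ := by ring
    · have : fderiv ℝ χ (s N • (x - x₀)) = 0 := by
        refine image_eq_zero_of_notMem_tsupport fun h => hx ?_
        have := tsupport_fderiv_subset ℝ h
        rw [χ.tsupport_eq, mem_closedBall_zero_iff] at this
        exact this
      rw [this, norm_zero, zero_mul]
      positivity
  · have hlim : Tendsto (fun N => s N * ‖x - x₀‖) atTop (𝓝 0) := by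
      have : Tendsto s atTop (𝓝 0) := by
        simpa [s, one_div] using tendsto_one_div_add_atTop_nhds_zero_nat (𝕜 := ℝ)
      simpa using this.mul_const ‖x - x₀‖
    filter_upwards [hlim.eventually (gt_mem_nhds one_pos)] with N hN
    have hmem : s N • (x - x₀) ∈ Metric.ball (0 : E n) 1 := by
      rw [mem_ball_zero_iff, norm_smul, Real.norm_of_nonneg (hs0 N).le]
      exact hN
    refine ⟨χ.one_of_mem_closedBall (Metric.ball_subset_closedBall hmem), ?_⟩
    have h1 : fderiv ℝ χ (s N • (x - x₀)) = 0 := by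
      have : (χ : E n → ℝ) =ᶠ[𝓝 (s N • (x - x₀))] fun _ => 1 := by
        filter_upwards [Metric.isOpen_ball.mem_nhds hmem] with y hy
        exact χ.one_of_mem_closedBall (Metric.ball_subset_closedBall hy)
      rw [this.fderiv_eq]
      simp
    rw [(hd N x).fderiv, h1, zero_comp]

/-- The product of a cutoff in time and the square of a cutoff in space. -/
def productCutoff (ζ : ℝ → ℝ) (η : E n → ℝ) (z : ST n) : ℝ := ζ z.1 * η z.2 ^ 2

variable {ζ : ℝ → ℝ} {η : E n → ℝ}

theorem isTestFunction_productCutoff {a b : ℝ} (hζ : ContDiff ℝ ∞ ζ) (hζc : HasCompactSupport ζ)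
    (hζs : tsupport ζ ⊆ Ioo a b) (hη : ContDiff ℝ ∞ η) (hηc : HasCompactSupport η) :
    IsTestFunction (slab n a b) (productCutoff ζ η) := by
  have hsub : Function.support (productCutoff ζ η) ⊆ tsupport ζ ×ˢ tsupport η := by
    intro z hz
    have h1 : ζ z.1 * η z.2 ^ 2 ≠ 0 := hz
    refine ⟨subset_tsupport _ (left_ne_zero_of_mul h1), subset_tsupport _ ?_⟩
    exact fun h => right_ne_zero_of_mul h1 (by rw [h]; simp)
  have hcl : IsClosed (tsupport ζ ×ˢ tsupport η) :=
    (isClosed_tsupport ζ).prod (isClosed_tsupport η)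
  refine ⟨(hζ.comp contDiff_fst).mul ((hη.comp contDiff_snd).pow 2), ?_, ?_⟩
  · exact HasCompactSupport.of_support_subset_isCompact (hζc.isCompact.prod hηc.isCompact) hsub
  · exact (closure_minimal hsub hcl).trans (prod_mono hζs (subset_univ _))

theorem fderiv_productCutoff (hζ : ContDiff ℝ ∞ ζ) (hη : ContDiff ℝ ∞ η) (z w : ST n) :
    fderiv ℝ (productCutoff ζ η) z w = deriv ζ z.1 * w.1 * η z.2 ^ 2 +
      ζ z.1 * (2 * η z.2 * fderiv ℝ η z.2 w.2) := by
  have h1 := (hζ.differentiable (by norm_num) z.1).hasDerivAt.comp_hasFDerivAt z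
    (hasFDerivAt_fst (𝕜 := ℝ) (E := ℝ) (F := E n) (p := z))
  have h2 : HasFDerivAt (fun z : ST n => η z.2) _ z :=
    (hη.differentiable (by norm_num) z.2).hasFDerivAt.comp z hasFDerivAt_snd
  have h3 : fderiv ℝ (productCutoff ζ η) z = _ := (h1.mul (h2.pow 2)).fderiv
  rw [h3]
  simp
  ring

end Cutoff

/-! ### Integrability locally in time -/

section TimeLocInt

variable {n : ℕ} {a b : ℝ} {f g : ST n → ℝ}

/-- `f` is integrable over all slabs `(A, B) × ℝⁿ` with `a < A` and `B < b`. -/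
def TimeLocInt (a b : ℝ) (f : ST n → ℝ) : Prop :=
  ∀ A B, a < A → B < b → IntegrableOn f (slab n A B)

namespace TimeLocInt

theorem add (hf : TimeLocInt a b f) (hg : TimeLocInt a b g) :
    TimeLocInt a b (fun z => f z + g z) := fun A B hA hB => (hf A B hA hB).add (hg A B hA hB)

theorem const_mul (hf : TimeLocInt a b f) (c : ℝ) : TimeLocInt a b (fun z => c * f z) :=
  fun A B hA hB => (hf A B hA hB).const_mul c

theorem abs (hf : TimeLocInt a b f) : TimeLocInt a b (fun z => |f z|) :=
  fun A B hA hB => (hf A B hA hB).norm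

theorem congr (hf : TimeLocInt a b f) (h : ∀ z ∈ slab n a b, f z = g z) : TimeLocInt a b g :=
  fun A B hA hB => (hf A B hA hB).congr_fun
    (fun z hz => h z ⟨⟨hA.trans hz.1.1, hz.1.2.trans hB⟩, hz.2⟩) (measurableSet_slab A B)

theorem mul_continuousOn (hf : TimeLocInt a b f) {κ : ℝ → ℝ} (hκ : ContinuousOn κ (Ioo a b)) :
    TimeLocInt a b (fun z => κ z.1 * f z) := by
  intro A B hA hB
  have hsub : Icc A B ⊆ Ioo a b := fun t ht => ⟨hA.trans_le ht.1, ht.2.trans_lt hB⟩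
  obtain ⟨C, hC⟩ := isCompact_Icc.exists_bound_of_continuousOn (hκ.mono hsub)
  refine (hf A B hA hB).bdd_mul (c := C) ?_ ?_
  · have : ContinuousOn (fun z : ST n => κ z.1) (slab n A B) :=
      hκ.comp continuousOn_fst fun z hz => hsub ⟨hz.1.1.le, hz.1.2.le⟩
    exact this.aestronglyMeasurable (measurableSet_slab A B)
  · filter_upwards [ae_restrict_mem (measurableSet_slab A B)] with z hz
    exact hC _ ⟨hz.1.1.le, hz.1.2.le⟩

theorem integrable_mul (hf : TimeLocInt a b f) {κ : ℝ → ℝ} (hκ : Continuous κ)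
    (hκc : HasCompactSupport κ) (hκs : tsupport κ ⊆ Ioo a b) :
    Integrable (fun z => κ z.1 * f z) (volume.restrict (slab n a b)) := by
  rcases (tsupport κ).eq_empty_or_nonempty with hemp | hne
  · have : ∀ t, κ t = 0 := fun t => image_eq_zero_of_notMem_tsupport (by simp [hemp])
    simp [this]
  obtain ⟨A₀, hA₀, hA₀'⟩ := hκc.isCompact.exists_isLeast hne
  obtain ⟨B₀, hB₀, hB₀'⟩ := hκc.isCompact.exists_isGreatest hne
  obtain ⟨A, hA, hAA⟩ := exists_between (hκs hA₀).1
  obtain ⟨B, hBB, hB⟩ := exists_between (hκs hB₀).2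
  refine IntegrableOn.of_forall_sdiff_eq_zero
    (hf.mul_continuousOn hκ.continuousOn A B hA hB) (measurableSet_slab a b) fun z hz => ?_
  have : κ z.1 = 0 := by
    refine image_eq_zero_of_notMem_tsupport fun h => hz.2 ⟨⟨?_, ?_⟩, mem_univ _⟩
    · exact hAA.trans_le (hA₀' h)
    · exact (hB₀' h).trans_lt hBB
  rw [this, zero_mul]

end TimeLocInt

theorem exists_time_cutoff {A B : ℝ} (hA : a < A) (hB : B < b) : ∃ ζ : ℝ → ℝ, ContDiff ℝ ∞ ζ ∧
    HasCompactSupport ζ ∧ tsupport ζ ⊆ Ioo a b ∧ (∀ t, 0 ≤ ζ t) ∧ ∀ t ∈ Ioo A B, ζ t = 1 := by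
  rcases lt_or_ge A B with hAB | hAB
  · set ε := min (A - a) (b - B) / 2 with hε
    have hε0 : 0 < ε := by
      have := lt_min (sub_pos.2 hA) (sub_pos.2 hB)
      positivity
    have h1 : ε < A - a := by
      have := min_le_left (A - a) (b - B)
      linarith
    have h2 : ε < b - B := by
      have := min_le_right (A - a) (b - B)
      linarith
    let χ : ContDiffBump ((A + B) / 2 : ℝ) :=
      ⟨(B - A) / 2, (B - A) / 2 + ε, by linarith, by linarith⟩
    refine ⟨χ, χ.contDiff, χ.hasCompactSupport, ?_, fun t => χ.nonneg, fun t ht => ?_⟩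
    · rw [χ.tsupport_eq, Real.closedBall_eq_Icc]
      change Icc ((A + B) / 2 - ((B - A) / 2 + ε)) ((A + B) / 2 + ((B - A) / 2 + ε)) ⊆ _
      intro t ht
      constructor <;> linarith [ht.1, ht.2]
    · refine χ.one_of_mem_closedBall ?_
      rw [Real.closedBall_eq_Icc]
      change t ∈ Icc ((A + B) / 2 - ((B - A) / 2)) ((A + B) / 2 + ((B - A) / 2))
      constructor <;> linarith [ht.1, ht.2]
  · refine ⟨0, contDiff_const, HasCompactSupport.zero, by simp, fun t => le_rfl, fun t ht => ?_⟩
    exact absurd (ht.1.trans ht.2) (not_lt.2 hAB)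

/-- Fatou's lemma as an integrability criterion. In its applications the integrals of `f N` come
from vanishing identities plus a fixed dominating function, so `M` is just the integral of the
latter. -/
theorem integrable_of_tendsto_of_integral_le {X : Type*} [MeasurableSpace X] {μ : Measure X}
    {f : ℕ → X → ℝ} {g : X → ℝ} {M : ℝ} (hf : ∀ N, Integrable (f N) μ) (h0 : ∀ N, 0 ≤ᵐ[μ] f N)
    (hM : ∀ N, ∫ x, f N x ∂μ ≤ M) (hlim : ∀ᵐ x ∂μ, Tendsto (fun N => f N x) atTop (𝓝 (g x))) :
    Integrable g μ := by
  refine ⟨aestronglyMeasurable_of_tendsto_ae atTop (fun N => (hf N).1) hlim, ?_⟩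
  have h1 : ∫⁻ x, ‖g x‖ₑ ∂μ ≤ liminf (fun N => ∫⁻ x, ‖f N x‖ₑ ∂μ) atTop :=
    lintegral_congr_ae (by filter_upwards [hlim] with x hx using hx.enorm.liminf_eq) ▸
      lintegral_liminf_le' fun N => (hf N).1.enorm
  refine (h1.trans ?_).trans_lt (ENNReal.ofReal_lt_top (r := M))
  refine liminf_le_of_le (by isBoundedDefault) fun c hc => ?_
  obtain ⟨N, hN⟩ := hc.exists
  refine hN.trans ?_
  rw [← ofReal_integral_norm_eq_lintegral_enorm (hf N)]
  refine ENNReal.ofReal_le_ofReal ((le_of_eq ?_).trans (hM N))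
  refine integral_congr_ae ?_
  filter_upwards [h0 N] with x hx using Real.norm_of_nonneg hx

end TimeLocInt

/-! ### Removing the spatial cutoff: integrability of the gradient term -/

section Limit

variable {m n : ℕ} {a b T : ℝ} {x₀ : E n} {u ut : ST n → E m} {Du : ST n → Fin m → E n}
  {F : E m → ℝ}

/-- The kernel has the sign of `T - t`, which is constant on a slab avoiding `T`. -/
theorem exists_sign_heatKernel (hT : T ∉ Ioo a b) : ∃ s : ℝ, s * s = 1 ∧
    ∀ z ∈ slab n a b, |heatKernel T x₀ z| = s * heatKernel T x₀ z := by
  have hf : ∀ z : ST n, heatKernel T x₀ z = (T - z.1) * (4 * Real.pi *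
      |4 * Real.pi * (T - z.1)| ^ (-(n : ℝ) / 2 - 1)
        * Real.exp (-(‖z.2 - x₀‖ ^ 2 / (4 * (T - z.1))))) := fun z => by
    rw [heatKernel]; ring
  have hpos : ∀ z : ST n, 0 ≤ 4 * Real.pi *
      |4 * Real.pi * (T - z.1)| ^ (-(n : ℝ) / 2 - 1)
        * Real.exp (-(‖z.2 - x₀‖ ^ 2 / (4 * (T - z.1)))) := fun z => by positivity
  by_cases hTa : T ≤ a
  · refine ⟨-1, by norm_num, fun z hz => ?_⟩
    rw [abs_of_nonpos, neg_one_mul]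
    rw [hf]
    exact mul_nonpos_of_nonpos_of_nonneg (by linarith [hz.1.1]) (hpos z)
  · refine ⟨1, by norm_num, fun z hz => ?_⟩
    rw [abs_of_nonneg, one_mul]
    rw [hf]
    refine mul_nonneg ?_ (hpos z)
    by_contra hc
    exact hT ⟨not_le.1 hTa, by linarith [hz.1.2, not_le.1 hc]⟩

theorem heatKernel_div_nonneg (z : ST n) : 0 ≤ 1 / (T - z.1) * heatKernel T x₀ z := by
  have : 1 / (T - z.1) * heatKernel T x₀ z = (T - z.1)⁻¹ * (T - z.1) * (4 * Real.pi *
      |4 * Real.pi * (T - z.1)| ^ (-(n : ℝ) / 2 - 1)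
        * Real.exp (-(‖z.2 - x₀‖ ^ 2 / (4 * (T - z.1))))) := by
    rw [heatKernel, one_div]; ring
  rw [this]
  have h2 : 0 ≤ (T - z.1)⁻¹ * (T - z.1) := by
    rcases eq_or_ne (T - z.1) 0 with h | h
    · simp [h]
    · rw [inv_mul_cancel₀ h]; exact zero_le_one
  positivity

theorem defect_nonneg (β : ℝ) (z : ST n) : 0 ≤ defect β T x₀ u ut Du z :=
  Finset.sum_nonneg fun _ _ => sq_nonneg _

theorem continuousOn_inv_time (hT : T ∉ Ioo a b) :
    ContinuousOn (fun t : ℝ => 1 / (T - t)) (Ioo a b) :=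
  continuousOn_const.div (continuousOn_const.sub continuousOn_id)
    fun _ ht => sub_ne_zero.2 fun h => hT (h ▸ ht)

section Pointwise

variable {ζ : ℝ → ℝ} {η : E n → ℝ} {C : ℝ}

theorem abs_productCutoff_le (hη0 : ∀ x, 0 ≤ η x) (hη1 : ∀ x, η x ≤ 1) (z : ST n) :
    |productCutoff ζ η z| ≤ |ζ z.1| := by
  rw [productCutoff, abs_mul, abs_of_nonneg (sq_nonneg (η z.2))]
  exact mul_le_of_le_one_right (abs_nonneg _) (pow_le_one₀ (hη0 _) (hη1 _))

theorem abs_fderiv_productCutoff_scalingField_le (hζ : ContDiff ℝ ∞ ζ) (hη : ContDiff ℝ ∞ η)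
    (hη0 : ∀ x, 0 ≤ η x) (hη1 : ∀ x, η x ≤ 1) (hC : ∀ x, ‖fderiv ℝ η x‖ * ‖x - x₀‖ ≤ C)
    (z : ST n) : |fderiv ℝ (productCutoff ζ η) z (scalingField T x₀ z)| ≤
      |deriv ζ z.1| * |2 * (z.1 - T)| + |ζ z.1| * (2 * C) := by
  rw [fderiv_productCutoff hζ hη]
  refine (abs_add_le _ _).trans (add_le_add ?_ ?_)
  · rw [abs_mul, abs_mul, abs_of_nonneg (sq_nonneg (η z.2))]
    exact mul_le_of_le_one_right (by positivity) (pow_le_one₀ (hη0 _) (hη1 _))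
  · rw [abs_mul]
    refine mul_le_mul_of_nonneg_left ?_ (abs_nonneg _)
    rw [abs_mul, abs_mul, abs_of_pos two_pos, abs_of_nonneg (hη0 _)]
    have h1 : |fderiv ℝ η z.2 (scalingField T x₀ z).2| ≤ C :=
      ((fderiv ℝ η z.2).le_opNorm _).trans (hC _)
    calc _ ≤ 2 * 1 * C := by
          gcongr
          exact hη1 _
      _ = _ := by ring

/-- Young's inequality. The cutoff enters as `η²`, so its gradient keeps a factor `η` and half of
the gradient term with the same cutoff absorbs the product. -/
theorem abs_sum_mul_fderiv_productCutoff_le (hζ : ContDiff ℝ ∞ ζ) (hη : ContDiff ℝ ∞ η)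
    (hζ0 : ∀ t, 0 ≤ ζ t) (hη0 : ∀ x, 0 ≤ η x) (hC : ∀ x, ‖fderiv ℝ η x‖ ≤ C) (β : ℝ) (z : ST n) :
    |β * ∑ i, u z i * fderiv ℝ (productCutoff ζ η) z (0, Du z i)| ≤
      1 / 2 * ((∑ i, ‖Du z i‖ ^ 2) * productCutoff ζ η z) +
        2 * β ^ 2 * C ^ 2 * (ζ z.1 * ‖u z‖ ^ 2) := by
  rw [EuclideanSpace.real_norm_sq_eq (u z), productCutoff]
  simp only [Finset.mul_sum, Finset.sum_mul, ← Finset.sum_add_distrib]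
  refine (Finset.abs_sum_le_sum_abs _ _).trans (Finset.sum_le_sum fun i _ => ?_)
  rw [fderiv_productCutoff hζ hη, mul_zero, zero_mul, zero_add]
  have h1 : |fderiv ℝ η z.2 (Du z i)| ≤ C * ‖Du z i‖ :=
    ((fderiv ℝ η z.2).le_opNorm _).trans (by gcongr; exact hC _)
  have h2 : |β * (u z i * (ζ z.1 * (2 * η z.2 * fderiv ℝ η z.2 (Du z i))))| ≤
      ζ z.1 * (2 * (|β| * |u z i| * (η z.2 * (C * ‖Du z i‖)))) := by
    simp only [abs_mul, abs_of_nonneg (hζ0 _), abs_of_nonneg (hη0 _), abs_of_pos (two_pos (α := ℝ))]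
    calc _ = ζ z.1 * (2 * (|β| * |u z i| * (η z.2 * |fderiv ℝ η z.2 (Du z i)|))) := by ring
      _ ≤ _ := by
        gcongr
        · exact hζ0 _
        · exact hη0 _
  refine h2.trans ?_
  have h3 : 2 * (|β| * |u z i| * (η z.2 * (C * ‖Du z i‖))) ≤
      1 / 2 * (‖Du z i‖ ^ 2 * η z.2 ^ 2) + 2 * β ^ 2 * C ^ 2 * u z i ^ 2 := by
    nlinarith [sq_nonneg (η z.2 * ‖Du z i‖ - 2 * (|β| * |u z i| * C)), sq_abs β, sq_abs (u z i),
      show (|β| * |u z i| * C) ^ 2 = β ^ 2 * u z i ^ 2 * C ^ 2 by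
        rw [mul_pow, mul_pow, sq_abs, sq_abs]]
  calc _ ≤ ζ z.1 * (1 / 2 * (‖Du z i‖ ^ 2 * η z.2 ^ 2) + 2 * β ^ 2 * C ^ 2 * u z i ^ 2) :=
        mul_le_mul_of_nonneg_left h3 (hζ0 _)
    _ = _ := by ring

/-- One factor `|x - x₀|` in `Xu` is paid for by `|∇η| |x - x₀| ≤ C`; the rest is Young's
inequality. The bound contains `|∇u|²`, hence the need for
`IsVariationalSolution.timeLocInt_gradient`. -/
theorem abs_sum_fderiv_productCutoff_mul_le (hζ : ContDiff ℝ ∞ ζ) (hη : ContDiff ℝ ∞ η)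
    (hη0 : ∀ x, 0 ≤ η x) (hη1 : ∀ x, η x ≤ 1) (hC : ∀ x, ‖fderiv ℝ η x‖ ≤ C)
    (hC' : ∀ x, ‖fderiv ℝ η x‖ * ‖x - x₀‖ ≤ C) (β : ℝ) (z : ST n) :
    |2 * ∑ i, fderiv ℝ (productCutoff ζ η) z (0, Du z i) *
        (β * u z i - dirDeriv ut Du z (scalingField T x₀ z) i)| ≤
      |ζ z.1| * (4 * C * (2 * (∑ i, ‖Du z i‖ ^ 2) + 1 / 2 * β ^ 2 * ‖u z‖ ^ 2
        + 2 * (T - z.1) ^ 2 * ‖ut z‖ ^ 2)) := by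
  rw [EuclideanSpace.real_norm_sq_eq (u z), EuclideanSpace.real_norm_sq_eq (ut z)]
  simp only [Finset.mul_sum, ← Finset.sum_add_distrib]
  refine (Finset.abs_sum_le_sum_abs _ _).trans (Finset.sum_le_sum fun i _ => ?_)
  rw [fderiv_productCutoff hζ hη, mul_zero, zero_mul, zero_add, dirDeriv_scalingField]
  have hC0 : 0 ≤ C := (norm_nonneg _).trans (hC 0)
  set d := ‖Du z i‖ with hd
  set l := ‖fderiv ℝ η z.2‖ with hl
  have hl0 : 0 ≤ l := norm_nonneg _
  have hd0 : 0 ≤ d := norm_nonneg _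
  have h1 : |fderiv ℝ η z.2 (Du z i)| ≤ l * d := (fderiv ℝ η z.2).le_opNorm _
  have h2 : |β * u z i - (inner ℝ (Du z i) (z.2 - x₀) - 2 * (T - z.1) * ut z i)| ≤
      |β * u z i| + d * ‖z.2 - x₀‖ + 2 * |(T - z.1) * ut z i| := by
    have e1 := abs_real_inner_le_norm (Du z i) (z.2 - x₀)
    have e2 : β * u z i - (inner ℝ (Du z i) (z.2 - x₀) - 2 * (T - z.1) * ut z i) =
      β * u z i - inner ℝ (Du z i) (z.2 - x₀) + 2 * ((T - z.1) * ut z i) := by ring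
    rw [e2]
    refine (abs_add_le _ _).trans (add_le_add ((abs_sub _ _).trans (by linarith)) ?_)
    rw [abs_mul, abs_of_pos two_pos]
  have h3 : l * d * (|β * u z i| + d * ‖z.2 - x₀‖ + 2 * |(T - z.1) * ut z i|) ≤
      C * (d * |β * u z i| + d * d + 2 * (d * |(T - z.1) * ut z i|)) := by
    have := hC z.2
    have := hC' z.2
    calc _ = l * (d * |β * u z i|) + (l * ‖z.2 - x₀‖) * (d * d) +
          l * (2 * (d * |(T - z.1) * ut z i|)) := by ring
      _ ≤ C * (d * |β * u z i|) + C * (d * d) + C * (2 * (d * |(T - z.1) * ut z i|)) := by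
          gcongr
      _ = _ := by ring
  have h4 : d * |β * u z i| + d * d + 2 * (d * |(T - z.1) * ut z i|) ≤
      2 * d ^ 2 + 1 / 2 * β ^ 2 * u z i ^ 2 + 2 * (T - z.1) ^ 2 * ut z i ^ 2 := by
    nlinarith [sq_nonneg (d - |β * u z i|), sq_nonneg (d - 2 * |(T - z.1) * ut z i|),
      sq_abs (β * u z i), sq_abs ((T - z.1) * ut z i), mul_pow β (u z i) 2,
      mul_pow (T - z.1) (ut z i) 2]
  rw [abs_mul, abs_mul, abs_mul (ζ z.1), abs_mul (2 * η z.2), abs_mul 2 (η z.2), abs_of_pos (two_pos (α := ℝ)),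
    abs_of_nonneg (hη0 _)]
  calc _ ≤ 2 * (|ζ z.1| * (2 * 1 * (l * d)) *
        (|β * u z i| + d * ‖z.2 - x₀‖ + 2 * |(T - z.1) * ut z i|)) := by
        gcongr
        exact hη1 _
    _ = |ζ z.1| * (4 * (l * d * (|β * u z i| + d * ‖z.2 - x₀‖ + 2 * |(T - z.1) * ut z i|))) := by
        ring
    _ ≤ |ζ z.1| * (4 * (C * (2 * d ^ 2 + 1 / 2 * β ^ 2 * u z i ^ 2
          + 2 * (T - z.1) ^ 2 * ut z i ^ 2))) := by
        exact mul_le_mul_of_nonneg_left (mul_le_mul_of_nonneg_left (h3.trans (by gcongr))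
          (by norm_num)) (abs_nonneg _)
    _ = _ := by ring

end Pointwise

variable {β : ℝ}

/-- The gradient identity bounds the cutoff integrals of `|∇u|² |G|`: the term with `∇η` is
absorbed, and the others are dominated by integrable functions independent of `N`. Fatou then gives
the limit. -/
theorem IsVariationalSolution.timeLocInt_gradient (h : IsVariationalSolution F a b u ut Du)
    (hT : T ∉ Ioo a b)
    (hE : TimeLocInt a b fun z => heatKernel T x₀ z * energy F u Du z)
    (hU : TimeLocInt a b fun z => heatKernel T x₀ z * ‖u z‖ ^ 2)
    (hB : TimeLocInt a b fun z => heatKernel T x₀ z * bulk F β u z) :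
    TimeLocInt a b fun z => heatKernel T x₀ z * ∑ i, ‖Du z i‖ ^ 2 := by
  intro A B hA hB'
  obtain ⟨ζ, hζ, hζc, hζs, hζ0, hζ1⟩ := exists_time_cutoff hA hB'
  obtain ⟨η, C, hC0, hη, hηc, hη0, hη1, hC, hC', hlim⟩ := exists_spatial_cutoff x₀
  obtain ⟨s, hs, hsG⟩ := exists_sign_heatKernel (n := n) (x₀ := x₀) hT
  have hζ'c : Continuous (deriv ζ) := hζ.continuous_deriv (by norm_num)
  have hζ'k : HasCompactSupport (deriv ζ) := hζc.deriv
  have hζ's : tsupport (deriv ζ) ⊆ Ioo a b := 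
    (closure_minimal support_deriv_subset (isClosed_tsupport ζ)).trans hζs
  have hUτ := hU.mul_continuousOn (continuousOn_inv_time hT)
  have htm : ContinuousOn (fun t : ℝ => 2 * (t - T)) (Ioo a b) := by fun_prop
  let D1 : ST n → ℝ := fun z => 2 * β ^ 2 * C ^ 2 * |heatKernel T x₀ z * ‖u z‖ ^ 2| +
    |heatKernel T x₀ z * bulk F β u z| + |β - 1| * |heatKernel T x₀ z * energy F u Du z| +
    |β / 4| * (2 * C) * |1 / (T - z.1) * (heatKernel T x₀ z * ‖u z‖ ^ 2)|
  let D2 : ST n → ℝ := fun z =>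
    |β / 4| * |2 * (z.1 - T) * (1 / (T - z.1) * (heatKernel T x₀ z * ‖u z‖ ^ 2))|
  have hD1 : TimeLocInt a b D1 := (((hU.abs.const_mul _).add hB.abs).add (hE.abs.const_mul _)).add
    (hUτ.abs.const_mul _)
  have hD2 : TimeLocInt a b D2 := (hUτ.mul_continuousOn htm).abs.const_mul _
  -- An integrable majorant of the negative part of `s * f N`, uniform in `N`. The terms with `ζ`
  -- and `ζ'` are kept apart because each uses its own compact support.
  let D : ST n → ℝ := fun z => ζ z.1 * D1 z + |deriv ζ z.1| * D2 z
  have hD : Integrable D (volume.restrict (slab n a b)) :=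
    (hD1.integrable_mul hζ.continuous hζc hζs).add
      (hD2.integrable_mul hζ'c.abs hζ'k.abs
        ((closure_mono fun t ht => by simpa using ht).trans hζ's))
  -- From here `f N` has integral zero, so the integral of `s * f N + D` is that of `D`.
  let q : ℕ → ST n → ℝ := fun N => productCutoff ζ (η N)
  let f : ℕ → ST n → ℝ := fun N z => heatKernel T x₀ z *
      ((∑ i, ‖Du z i‖ ^ 2) * q N z + β * (∑ i, u z i * fderiv ℝ (q N) z (0, Du z i))
        + bulk F β u z * q N z + (β - 1) * energy F u Du z * q N z
        + β / 4 * (1 / (T - z.1) * ‖u z‖ ^ 2) * fderiv ℝ (q N) z (scalingField T x₀ z))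
  have hf : ∀ N, HasZeroIntegral (volume.restrict (slab n a b)) (f N) := fun N =>
    h.hasZeroIntegral_gradient hT β
      (isTestFunction_productCutoff hζ hζc hζs (hη N) (hηc N))
  let r : ST n → ℝ := fun z => ζ z.1 * (heatKernel T x₀ z * bulk F β u z)
      + ζ z.1 * ((β - 1) * (heatKernel T x₀ z * energy F u Du z))
      + deriv ζ z.1 * (β / 4 * (2 * (z.1 - T) * (1 / (T - z.1) * (heatKernel T x₀ z * ‖u z‖ ^ 2))))
  have hr : Integrable r (volume.restrict (slab n a b)) :=
    -- The function `r` collects the limit terms without `|∇u|²`; they are integrable and can be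
    -- subtracted.
    ((hB.integrable_mul hζ.continuous hζc hζs).add
      ((hE.const_mul _).integrable_mul hζ.continuous hζc hζs)).add
      (((hUτ.mul_continuousOn htm).const_mul _).integrable_mul hζ'c hζ'k hζ's)
  have hFatou : Integrable (fun z => s * (ζ z.1 * (heatKernel T x₀ z * ∑ i, ‖Du z i‖ ^ 2) + r z)
      + D z) (volume.restrict (slab n a b)) := by
    refine integrable_of_tendsto_of_integral_le (f := fun N z => s * f N z + D z)
      (M := ∫ z in slab n a b, D z) (fun N => ((hf N).1.const_mul s).add hD) (fun N => ?_)
      (fun N => ?_) (Eventually.of_forall fun z => ?_)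
    · filter_upwards [ae_restrict_mem (measurableSet_slab a b)] with z hz
      have hG := hsG z hz
      have hq0 : 0 ≤ q N z := mul_nonneg (hζ0 _) (sq_nonneg _)
      have hqζ : q N z ≤ ζ z.1 := by
        have := abs_productCutoff_le (ζ := ζ) (hη0 N) (hη1 N) z
        rwa [abs_of_nonneg hq0, abs_of_nonneg (hζ0 _)] at this
      have b1 := abs_sum_mul_fderiv_productCutoff_le (u := u) (Du := Du) hζ (hη N) hζ0 (hη0 N)
        (hC N) β z
      have b2 := abs_fderiv_productCutoff_scalingField_le (T := T) hζ (hη N) (hη0 N) (hη1 N)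
        (hC' N) z
      rw [abs_of_nonneg (hζ0 _)] at b2
      have hA0 : 0 ≤ ∑ i, ‖Du z i‖ ^ 2 := Finset.sum_nonneg fun _ _ => sq_nonneg _
      have c1 : -(|bulk F β u z| * ζ z.1) ≤ bulk F β u z * q N z := by
        have : |bulk F β u z * q N z| ≤ |bulk F β u z| * ζ z.1 := by
          rw [abs_mul, abs_of_nonneg hq0]; gcongr
        exact (abs_le.1 this).1
      have c2 : -(|β - 1| * |energy F u Du z| * ζ z.1) ≤ (β - 1) * energy F u Du z * q N z := by
        have : |(β - 1) * energy F u Du z * q N z| ≤ |β - 1| * |energy F u Du z| * ζ z.1 := by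
          rw [abs_mul, abs_mul, abs_of_nonneg hq0]; gcongr
        exact (abs_le.1 this).1
      have c3 : -(|β / 4| * (|1 / (T - z.1)| * ‖u z‖ ^ 2) *
          (|deriv ζ z.1| * |2 * (z.1 - T)| + ζ z.1 * (2 * C))) ≤
          β / 4 * (1 / (T - z.1) * ‖u z‖ ^ 2) * fderiv ℝ (q N) z (scalingField T x₀ z) := by
        have : |β / 4 * (1 / (T - z.1) * ‖u z‖ ^ 2) * fderiv ℝ (q N) z (scalingField T x₀ z)| ≤
            |β / 4| * (|1 / (T - z.1)| * ‖u z‖ ^ 2) *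
          (|deriv ζ z.1| * |2 * (z.1 - T)| + ζ z.1 * (2 * C)) := by
          rw [abs_mul, abs_mul, abs_mul (1 / (T - z.1)), abs_of_nonneg (sq_nonneg ‖u z‖)]
          gcongr
        exact (abs_le.1 this).1
      have c4 := (abs_le.1 b1).1
      have hAq : 0 ≤ (∑ i, ‖Du z i‖ ^ 2) * productCutoff ζ (η N) z := mul_nonneg hA0 hq0
      have key : 0 ≤ |heatKernel T x₀ z| * (((∑ i, ‖Du z i‖ ^ 2) * q N z
          + β * (∑ i, u z i * fderiv ℝ (q N) z (0, Du z i))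
          + bulk F β u z * q N z + (β - 1) * energy F u Du z * q N z
          + β / 4 * (1 / (T - z.1) * ‖u z‖ ^ 2) * fderiv ℝ (q N) z (scalingField T x₀ z)) +
          (2 * β ^ 2 * C ^ 2 * (ζ z.1 * ‖u z‖ ^ 2) + |bulk F β u z| * ζ z.1 +
          |β - 1| * |energy F u Du z| * ζ z.1 + |β / 4| * (|1 / (T - z.1)| * ‖u z‖ ^ 2) *
          (|deriv ζ z.1| * |2 * (z.1 - T)| + ζ z.1 * (2 * C)))) := by
        refine mul_nonneg (abs_nonneg _) ?_
        dsimp only [q] at c1 c2 c3 ⊢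
        linarith
      refine key.trans (le_of_eq ?_)
      dsimp only [f, D, D1, D2]
      simp only [abs_mul (heatKernel T x₀ z), abs_mul (1 / (T - z.1)), abs_mul (2 * (z.1 - T)),
        abs_of_nonneg (sq_nonneg ‖u z‖)]
      rw [mul_add, ← mul_assoc s, ← hG]
      ring
    · rw [integral_add ((hf N).1.const_mul s) hD, integral_const_mul, (hf N).2, mul_zero, zero_add]
    · refine tendsto_const_nhds.congr' ?_
      filter_upwards [hlim z.2] with N hN
      dsimp only [f, r, q]
      simp only [fderiv_productCutoff hζ (hη N), hN.1, hN.2, productCutoff, scalingField]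
      simp only [zero_apply, mul_zero, Finset.sum_const_zero, mul_one, one_pow, add_zero]
      ring
  -- Multiplication by `s` a second time undoes the sign, as `s * s = 1`.
  have hfin : Integrable (fun z => ζ z.1 * (heatKernel T x₀ z * ∑ i, ‖Du z i‖ ^ 2))
      (volume.restrict (slab n a b)) := by
    refine (((hFatou.sub hD).const_mul s).sub hr).congr (Eventually.of_forall fun z => ?_)
    simp only [Pi.sub_apply]
    linear_combination (ζ z.1 * (heatKernel T x₀ z * ∑ i, ‖Du z i‖ ^ 2) + r z) * hs
  refine (IntegrableOn.mono_set hfin (prod_mono (Ioo_subset_Ioo hA.le hB'.le) le_rfl)).congr_fun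
    (fun z hz => ?_) (measurableSet_slab A B)
  simp only [hζ1 z.1 hz.1, one_mul]

end Limit

/-! ### Removing the spatial cutoff: the identity in time -/

section Monotonicity

variable {m n : ℕ} {a b T : ℝ} {x₀ : E n} {u ut : ST n → E m} {Du : ST n → Fin m → E n}
  {F : E m → ℝ} {β : ℝ}

/-- The integrand of the monotonicity identity for a product cutoff, without the square term. -/
theorem abs_monotonicity_rest_le {ζ : ℝ → ℝ} {η : E n → ℝ} {C : ℝ}
    (hζ : ContDiff ℝ ∞ ζ) (hη : ContDiff ℝ ∞ η)
    (hη0 : ∀ x, 0 ≤ η x) (hη1 : ∀ x, η x ≤ 1) (hC : ∀ x, ‖fderiv ℝ η x‖ ≤ C)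
    (hC' : ∀ x, ‖fderiv ℝ η x‖ * ‖x - x₀‖ ≤ C) (z : ST n) :
    |heatKernel T x₀ z * ((energy F u Du z - β / 2 * (1 / (T - z.1) * ‖u z‖ ^ 2)) *
          (2 * β * productCutoff ζ η z + fderiv ℝ (productCutoff ζ η) z (scalingField T x₀ z))
        + 2 * bulk F β u z * productCutoff ζ η z
        + 2 * ∑ i, fderiv ℝ (productCutoff ζ η) z (0, Du z i) *
          (β * u z i - dirDeriv ut Du z (scalingField T x₀ z) i))| ≤
    |ζ z.1| * ((|2 * β| + 2 * C) * (|heatKernel T x₀ z * energy F u Du z| +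
        |β / 2| * |1 / (T - z.1) * (heatKernel T x₀ z * ‖u z‖ ^ 2)|) +
      2 * |heatKernel T x₀ z * bulk F β u z| +
      4 * C * (2 * |heatKernel T x₀ z * ∑ i, ‖Du z i‖ ^ 2| +
        1 / 2 * β ^ 2 * |heatKernel T x₀ z * ‖u z‖ ^ 2| +
        2 * |(T - z.1) ^ 2 * (heatKernel T x₀ z * ‖ut z‖ ^ 2)|)) +
    |deriv ζ z.1| * (|2 * (z.1 - T) * (heatKernel T x₀ z * energy F u Du z)| +
        |β / 2| * |2 * (z.1 - T) * (1 / (T - z.1) * (heatKernel T x₀ z * ‖u z‖ ^ 2))|) := by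
  have hC0 : 0 ≤ C := (norm_nonneg _).trans (hC 0)
  have b1 := abs_productCutoff_le (ζ := ζ) hη0 hη1 z
  have b2 := abs_fderiv_productCutoff_scalingField_le (T := T) hζ hη hη0 hη1 hC' z
  have b3 := abs_sum_fderiv_productCutoff_mul_le (T := T) (u := u) (ut := ut) (Du := Du)
    hζ hη hη0 hη1 hC hC' β z
  have c1 : |(energy F u Du z - β / 2 * (1 / (T - z.1) * ‖u z‖ ^ 2)) *
      (2 * β * productCutoff ζ η z + fderiv ℝ (productCutoff ζ η) z (scalingField T x₀ z))| ≤
      (|energy F u Du z| + |β / 2| * (|1 / (T - z.1)| * ‖u z‖ ^ 2)) *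
        (|2 * β| * |ζ z.1| + (|deriv ζ z.1| * |2 * (z.1 - T)| + |ζ z.1| * (2 * C))) := by
    rw [abs_mul]
    refine mul_le_mul ((abs_sub _ _).trans (le_of_eq ?_)) ((abs_add_le _ _).trans ?_)
      (abs_nonneg _) (by positivity)
    · rw [abs_mul (β / 2), abs_mul (1 / (T - z.1)), abs_of_nonneg (sq_nonneg ‖u z‖)]
    · rw [abs_mul]
      gcongr
  have c2 : |2 * bulk F β u z * productCutoff ζ η z| ≤ 2 * |bulk F β u z| * |ζ z.1| := by
    rw [abs_mul, abs_mul, abs_of_pos (two_pos (α := ℝ))]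
    gcongr
  rw [abs_mul]
  have hA0 : 0 ≤ ∑ i, ‖Du z i‖ ^ 2 := Finset.sum_nonneg fun _ _ => sq_nonneg _
  refine (mul_le_mul_of_nonneg_left ((abs_add_three _ _ _).trans
    (add_le_add (add_le_add c1 c2) b3)) (abs_nonneg _)).trans (le_of_eq ?_)
  simp only [abs_mul (heatKernel T x₀ z), abs_mul (1 / (T - z.1)), abs_mul (2 * (z.1 - T)),
    abs_mul ((T - z.1) ^ 2), abs_of_nonneg (sq_nonneg ‖u z‖), abs_of_nonneg (sq_nonneg ‖ut z‖),
    abs_of_nonneg (sq_nonneg (T - z.1)), abs_of_nonneg hA0]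
  ring

/-- The dominating function for the monotonicity identity. -/
theorem exists_dominating (C : ℝ) {ζ : ℝ → ℝ} (hT : T ∉ Ioo a b)
    (hζ : ContDiff ℝ ∞ ζ) (hζc : HasCompactSupport ζ) (hζs : tsupport ζ ⊆ Ioo a b)
    (hE : TimeLocInt a b fun z => heatKernel T x₀ z * energy F u Du z)
    (hU : TimeLocInt a b fun z => heatKernel T x₀ z * ‖u z‖ ^ 2)
    (hUt : TimeLocInt a b fun z => heatKernel T x₀ z * ‖ut z‖ ^ 2)
    (hB : TimeLocInt a b fun z => heatKernel T x₀ z * bulk F β u z)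
    (hA : TimeLocInt a b fun z => heatKernel T x₀ z * ∑ i, ‖Du z i‖ ^ 2) :
    Integrable (fun z => |ζ z.1| * ((|2 * β| + 2 * C) * (|heatKernel T x₀ z * energy F u Du z| +
        |β / 2| * |1 / (T - z.1) * (heatKernel T x₀ z * ‖u z‖ ^ 2)|) +
      2 * |heatKernel T x₀ z * bulk F β u z| +
      4 * C * (2 * |heatKernel T x₀ z * ∑ i, ‖Du z i‖ ^ 2| +
        1 / 2 * β ^ 2 * |heatKernel T x₀ z * ‖u z‖ ^ 2| +
        2 * |(T - z.1) ^ 2 * (heatKernel T x₀ z * ‖ut z‖ ^ 2)|)) +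
    |deriv ζ z.1| * (|2 * (z.1 - T) * (heatKernel T x₀ z * energy F u Du z)| +
        |β / 2| * |2 * (z.1 - T) * (1 / (T - z.1) * (heatKernel T x₀ z * ‖u z‖ ^ 2))|))
      (volume.restrict (slab n a b)) := by
  have hζ'c : Continuous (deriv ζ) := hζ.continuous_deriv (by norm_num)
  have hζ's : tsupport (deriv ζ) ⊆ Ioo a b :=
    (closure_minimal support_deriv_subset (isClosed_tsupport ζ)).trans hζs
  have hUτ := hU.mul_continuousOn (continuousOn_inv_time hT)
  have htm : ContinuousOn (fun t : ℝ => 2 * (t - T)) (Ioo a b) := by fun_prop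
  have htm2 : ContinuousOn (fun t : ℝ => (T - t) ^ 2) (Ioo a b) := by fun_prop
  refine Integrable.add (TimeLocInt.integrable_mul (κ := fun t => |ζ t|) ?_ hζ.continuous.abs
    hζc.abs ((closure_mono fun t ht => by simpa using ht).trans hζs))
    (TimeLocInt.integrable_mul (κ := fun t => |deriv ζ t|) ?_ hζ'c.abs hζc.deriv.abs
    ((closure_mono fun t ht => by simpa using ht).trans hζ's))
  · exact (((hE.abs.add (hUτ.abs.const_mul _)).const_mul _).add (hB.abs.const_mul _)).add
      ((((hA.abs.const_mul _).add (hU.abs.const_mul _)).add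
        ((hUt.mul_continuousOn htm2).abs.const_mul _)).const_mul _)
  · exact (hE.mul_continuousOn htm).abs.add ((hUτ.mul_continuousOn htm).abs.const_mul _)

/-- Here no sign `s` is needed: `G / (T - t)` is nonnegative on either side of `T`, and all other
terms have the majorant `D`, uniform in `N`. Fatou applies to `f N + D`. -/
theorem IsVariationalSolution.timeLocInt_defect (h : IsVariationalSolution F a b u ut Du)
    (hT : T ∉ Ioo a b)
    (hE : TimeLocInt a b fun z => heatKernel T x₀ z * energy F u Du z)
    (hU : TimeLocInt a b fun z => heatKernel T x₀ z * ‖u z‖ ^ 2)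
    (hUt : TimeLocInt a b fun z => heatKernel T x₀ z * ‖ut z‖ ^ 2)
    (hB : TimeLocInt a b fun z => heatKernel T x₀ z * bulk F β u z) :
    TimeLocInt a b fun z => 1 / (T - z.1) * defect β T x₀ u ut Du z * heatKernel T x₀ z := by
  intro A B hA hB'
  obtain ⟨ζ, hζ, hζc, hζs, hζ0, hζ1⟩ := exists_time_cutoff hA hB'
  obtain ⟨η, C, hC0, hη, hηc, hη0, hη1, hC, hC', hlim⟩ := exists_spatial_cutoff x₀
  have hζ'c : Continuous (deriv ζ) := hζ.continuous_deriv (by norm_num)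
  have hζ's : tsupport (deriv ζ) ⊆ Ioo a b :=
    (closure_minimal support_deriv_subset (isClosed_tsupport ζ)).trans hζs
  have hUτ := hU.mul_continuousOn (continuousOn_inv_time hT)
  have htm : ContinuousOn (fun t : ℝ => 2 * (t - T)) (Ioo a b) := by fun_prop
  have hD := exists_dominating C hT hζ hζc hζs hE hU hUt hB (h.timeLocInt_gradient hT hE hU hB)
  set D : ST n → ℝ := fun z => |ζ z.1| * ((|2 * β| + 2 * C) *
        (|heatKernel T x₀ z * energy F u Du z| +
        |β / 2| * |1 / (T - z.1) * (heatKernel T x₀ z * ‖u z‖ ^ 2)|) +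
      2 * |heatKernel T x₀ z * bulk F β u z| +
      4 * C * (2 * |heatKernel T x₀ z * ∑ i, ‖Du z i‖ ^ 2| +
        1 / 2 * β ^ 2 * |heatKernel T x₀ z * ‖u z‖ ^ 2| +
        2 * |(T - z.1) ^ 2 * (heatKernel T x₀ z * ‖ut z‖ ^ 2)|)) +
    |deriv ζ z.1| * (|2 * (z.1 - T) * (heatKernel T x₀ z * energy F u Du z)| +
        |β / 2| * |2 * (z.1 - T) * (1 / (T - z.1) * (heatKernel T x₀ z * ‖u z‖ ^ 2))|) with hDdef
  let f : ℕ → ST n → ℝ := fun N z => heatKernel T x₀ z *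
      ((energy F u Du z - β / 2 * (1 / (T - z.1) * ‖u z‖ ^ 2)) *
          (2 * β * productCutoff ζ (η N) z +
            fderiv ℝ (productCutoff ζ (η N)) z (scalingField T x₀ z))
        + (2 * bulk F β u z + 1 / (T - z.1) * defect β T x₀ u ut Du z) * productCutoff ζ (η N) z
        + 2 * ∑ i, fderiv ℝ (productCutoff ζ (η N)) z (0, Du z i) *
          (β * u z i - dirDeriv ut Du z (scalingField T x₀ z) i))
  have hf : ∀ N, HasZeroIntegral (volume.restrict (slab n a b)) (f N) := fun N =>
    h.hasZeroIntegral_monotonicity hT β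
      (isTestFunction_productCutoff hζ hζc hζs (hη N) (hηc N))
  let r : ST n → ℝ := fun z => ζ z.1 * (2 * β * (heatKernel T x₀ z * energy F u Du z)
      + -(β ^ 2) * (1 / (T - z.1) * (heatKernel T x₀ z * ‖u z‖ ^ 2))
      + 2 * (heatKernel T x₀ z * bulk F β u z))
      + deriv ζ z.1 * (2 * (z.1 - T) * (heatKernel T x₀ z * energy F u Du z)
        + -(β / 2) * (2 * (z.1 - T) * (1 / (T - z.1) * (heatKernel T x₀ z * ‖u z‖ ^ 2))))
  have hr : Integrable r (volume.restrict (slab n a b)) :=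
    ((((hE.const_mul _).add (hUτ.const_mul _)).add (hB.const_mul _)).integrable_mul
      hζ.continuous hζc hζs).add
    (((hE.mul_continuousOn htm).add ((hUτ.mul_continuousOn htm).const_mul _)).integrable_mul
      hζ'c hζc.deriv hζ's)
  have hFatou : Integrable (fun z =>
      ζ z.1 * (1 / (T - z.1) * defect β T x₀ u ut Du z * heatKernel T x₀ z) + r z + D z)
      (volume.restrict (slab n a b)) := by
    refine integrable_of_tendsto_of_integral_le (f := fun N z => f N z + D z)
      (M := ∫ z in slab n a b, D z) (fun N => (hf N).1.add hD) (fun N => ?_)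
      (fun N => ?_) (Eventually.of_forall fun z => ?_)
    · refine Eventually.of_forall fun z => ?_
      have b := (abs_le.1 (abs_monotonicity_rest_le (T := T) (F := F) (u := u) (ut := ut) (Du := Du)
        (β := β) hζ (hη N) (hη0 N) (hη1 N) (hC N) (hC' N) z)).1
      have hpos : 0 ≤ 1 / (T - z.1) * heatKernel T x₀ z * defect β T x₀ u ut Du z *
          productCutoff ζ (η N) z := mul_nonneg (mul_nonneg (heatKernel_div_nonneg z)
            (defect_nonneg β z)) (mul_nonneg (hζ0 _) (sq_nonneg _))
      change 0 ≤ f N z + D z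
      dsimp only [f, D]
      linarith
    · change ∫ z in slab n a b, (f N z + D z) ≤ _
      rw [integral_add (hf N).1 hD, (hf N).2, zero_add]
    · refine tendsto_const_nhds.congr' ?_
      filter_upwards [hlim z.2] with N hN
      dsimp only [f, r]
      simp only [fderiv_productCutoff hζ (hη N), hN.1, hN.2, productCutoff, scalingField]
      simp only [zero_apply, mul_zero, zero_mul, Finset.sum_const_zero, mul_one, one_pow, add_zero]
      ring
  have hfin := (hFatou.sub hD).sub hr
  refine (IntegrableOn.mono_set hfin (prod_mono (Ioo_subset_Ioo hA.le hB'.le) le_rfl)).congr_fun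
    (fun z hz => ?_) (measurableSet_slab A B)
  simp only [Pi.sub_apply, hζ1 z.1 hz.1]
  ring

/-- Now that the square term is integrable too, it joins the dominating function. Pointwise, `η_N`
is eventually one with zero gradient, so every term with a spatial derivative of the cutoff
disappears. -/
theorem IsVariationalSolution.hasZeroIntegral_time (h : IsVariationalSolution F a b u ut Du)
    (hT : T ∉ Ioo a b)
    (hE : TimeLocInt a b fun z => heatKernel T x₀ z * energy F u Du z)
    (hU : TimeLocInt a b fun z => heatKernel T x₀ z * ‖u z‖ ^ 2)
    (hUt : TimeLocInt a b fun z => heatKernel T x₀ z * ‖ut z‖ ^ 2)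
    (hB : TimeLocInt a b fun z => heatKernel T x₀ z * bulk F β u z)
    {ζ : ℝ → ℝ} (hζ : ContDiff ℝ ∞ ζ) (hζc : HasCompactSupport ζ) (hζs : tsupport ζ ⊆ Ioo a b) :
    HasZeroIntegral (volume.restrict (slab n a b)) fun z =>
      (energy F u Du z * heatKernel T x₀ z - β / 2 * (1 / (T - z.1) * ‖u z‖ ^ 2 *
        heatKernel T x₀ z)) * (2 * β * ζ z.1 + 2 * (z.1 - T) * deriv ζ z.1) +
      (2 * (bulk F β u z * heatKernel T x₀ z) +
        1 / (T - z.1) * defect β T x₀ u ut Du z * heatKernel T x₀ z) * ζ z.1 := by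
  obtain ⟨η, C, hC0, hη, hηc, hη0, hη1, hC, hC', hlim⟩ := exists_spatial_cutoff x₀
  have hD := exists_dominating C hT hζ hζc hζs hE hU hUt hB (h.timeLocInt_gradient hT hE hU hB)
  have hd := ((h.timeLocInt_defect hT hE hU hUt hB).integrable_mul hζ.continuous hζc hζs).norm
  set D : ST n → ℝ := fun z => |ζ z.1| * ((|2 * β| + 2 * C) *
        (|heatKernel T x₀ z * energy F u Du z| +
        |β / 2| * |1 / (T - z.1) * (heatKernel T x₀ z * ‖u z‖ ^ 2)|) +
      2 * |heatKernel T x₀ z * bulk F β u z| +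
      4 * C * (2 * |heatKernel T x₀ z * ∑ i, ‖Du z i‖ ^ 2| +
        1 / 2 * β ^ 2 * |heatKernel T x₀ z * ‖u z‖ ^ 2| +
        2 * |(T - z.1) ^ 2 * (heatKernel T x₀ z * ‖ut z‖ ^ 2)|)) +
    |deriv ζ z.1| * (|2 * (z.1 - T) * (heatKernel T x₀ z * energy F u Du z)| +
        |β / 2| * |2 * (z.1 - T) * (1 / (T - z.1) * (heatKernel T x₀ z * ‖u z‖ ^ 2))|) with hDdef
  let f : ℕ → ST n → ℝ := fun N z => heatKernel T x₀ z *
      ((energy F u Du z - β / 2 * (1 / (T - z.1) * ‖u z‖ ^ 2)) *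
          (2 * β * productCutoff ζ (η N) z +
            fderiv ℝ (productCutoff ζ (η N)) z (scalingField T x₀ z))
        + (2 * bulk F β u z + 1 / (T - z.1) * defect β T x₀ u ut Du z) * productCutoff ζ (η N) z
        + 2 * ∑ i, fderiv ℝ (productCutoff ζ (η N)) z (0, Du z i) *
          (β * u z i - dirDeriv ut Du z (scalingField T x₀ z) i))
  have hf : ∀ N, HasZeroIntegral (volume.restrict (slab n a b)) (f N) := fun N =>
    h.hasZeroIntegral_monotonicity hT β
      (isTestFunction_productCutoff hζ hζc hζs (hη N) (hηc N))
  have hfD : ∀ N z, ‖f N z‖ ≤ D z +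
      ‖ζ z.1 * (1 / (T - z.1) * defect β T x₀ u ut Du z * heatKernel T x₀ z)‖ := by
    intro N z
    have b := abs_monotonicity_rest_le (T := T) (F := F) (u := u) (ut := ut) (Du := Du)
      (β := β) hζ (hη N) (hη0 N) (hη1 N) (hC N) (hC' N) z
    have b2 : |productCutoff ζ (η N) z * (1 / (T - z.1) * defect β T x₀ u ut Du z *
        heatKernel T x₀ z)| ≤
        |ζ z.1 * (1 / (T - z.1) * defect β T x₀ u ut Du z * heatKernel T x₀ z)| := by
      rw [abs_mul, abs_mul (ζ z.1)]
      exact mul_le_mul_of_nonneg_right (abs_productCutoff_le (hη0 N) (hη1 N) z) (abs_nonneg _)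
    rw [Real.norm_eq_abs, Real.norm_eq_abs]
    refine le_trans (le_of_eq ?_) ((abs_add_le _ _).trans (add_le_add b b2))
    congr 1
    dsimp only [f]
    ring
  have hptw : ∀ z, Tendsto (fun N => f N z) atTop (𝓝 ((energy F u Du z * heatKernel T x₀ z -
      β / 2 * (1 / (T - z.1) * ‖u z‖ ^ 2 *
        heatKernel T x₀ z)) * (2 * β * ζ z.1 + 2 * (z.1 - T) * deriv ζ z.1) +
      (2 * (bulk F β u z * heatKernel T x₀ z) +
        1 / (T - z.1) * defect β T x₀ u ut Du z * heatKernel T x₀ z) * ζ z.1)) := by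
    intro z
    refine tendsto_const_nhds.congr' ?_
    filter_upwards [hlim z.2] with N hN
    dsimp only [f]
    simp only [fderiv_productCutoff hζ (hη N), hN.1, hN.2, productCutoff, scalingField]
    simp only [zero_apply, mul_zero, zero_mul, Finset.sum_const_zero, mul_one, one_pow, add_zero]
    ring
  refine ⟨(hD.add hd).mono' (aestronglyMeasurable_of_tendsto_ae atTop (fun N => (hf N).1.1)
    (Eventually.of_forall hptw)) (Eventually.of_forall fun z => ?_), ?_⟩
  · exact le_of_tendsto (hptw z).norm (Eventually.of_forall fun N => hfD N z)
  · have := tendsto_integral_of_dominated_convergence _ (fun N => (hf N).1.1) (hD.add hd)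
      (fun N => Eventually.of_forall (hfD N)) (Eventually.of_forall hptw)
    simp only [fun N => (hf N).2] at this
    exact tendsto_nhds_unique this tendsto_const_nhds

end Monotonicity

/-! ### The lemma of du Bois-Reymond -/

section DuBoisReymond

variable {a b c : ℝ} {w v q : ℝ → ℝ}

/-- The base point `c` is included so that primitives from `c` can be handled on the same compact
subinterval as the supports. -/
theorem exists_Ioo_of_isCompact {K : Set ℝ} (hK : IsCompact K) (hKs : K ⊆ Ioo a b)
    (hc : c ∈ Ioo a b) : ∃ A B, a < A ∧ A < c ∧ c < B ∧ B < b ∧ K ⊆ Ioo A B := by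
  have hK' : IsCompact (insert c K) := hK.insert c
  have hne : (insert c K).Nonempty := insert_nonempty c K
  have hs : insert c K ⊆ Ioo a b := insert_subset hc hKs
  obtain ⟨A₀, hA₀, hA₀'⟩ := hK'.exists_isLeast hne
  obtain ⟨B₀, hB₀, hB₀'⟩ := hK'.exists_isGreatest hne
  obtain ⟨A, hA, hAA⟩ := exists_between (hs hA₀).1
  obtain ⟨B, hBB, hB⟩ := exists_between (hs hB₀).2
  exact ⟨A, B, hA, hAA.trans_le (hA₀' (mem_insert _ _)), (hB₀' (mem_insert _ _)).trans_lt hBB, hB,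
    fun t ht => ⟨hAA.trans_le (hA₀' (mem_insert_of_mem _ ht)),
      (hB₀' (mem_insert_of_mem _ ht)).trans_lt hBB⟩⟩

theorem intervalIntegrable_of_locallyIntegrableOn (hv : LocallyIntegrableOn v (Ioo a b)) {x y : ℝ}
    (hx : x ∈ Ioo a b) (hy : y ∈ Ioo a b) : IntervalIntegrable v volume x y :=
  intervalIntegrable_iff.2 ((hv.integrableOn_compact_subset (ordConnected_Ioo.uIcc_subset hx hy)
    isCompact_uIcc).mono_set uIoc_subset_uIcc)

theorem continuousOn_primitive_of_locallyIntegrableOn (hv : LocallyIntegrableOn v (Ioo a b))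
    (hc : c ∈ Ioo a b) : ContinuousOn (fun t => ∫ s in c..t, v s) (Ioo a b) := by
  intro t ht
  obtain ⟨A, B, hA, hAc, hcB, hB, hs⟩ := exists_Ioo_of_isCompact isCompact_singleton
    (singleton_subset_iff.2 ht) hc
  have ht' := singleton_subset_iff.1 hs
  have hAB : A ≤ B := (hAc.trans hcB).le
  have h := intervalIntegral.continuousOn_primitive_interval'
    (intervalIntegrable_of_locallyIntegrableOn hv ⟨hA, hAc.trans hc.2⟩ ⟨hc.1.trans hcB, hB⟩)
    (a := c) (by rw [uIcc_of_le hAB]; exact ⟨hAc.le, hcB.le⟩)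
  rw [uIcc_of_le hAB] at h
  exact (h.continuousAt (Icc_mem_nhds ht'.1 ht'.2)).continuousWithinAt

theorem integrable_mul_of_tsupport_subset (hv : LocallyIntegrableOn v (Ioo a b)) {κ : ℝ → ℝ}
    (hκ : Continuous κ) (hκc : HasCompactSupport κ) (hκs : tsupport κ ⊆ Ioo a b) :
    Integrable (fun t => v t * κ t) (volume.restrict (Ioo a b)) := by
  have h1 : IntegrableOn (fun t => v t * κ t) (tsupport κ) :=
    (hv.integrableOn_compact_subset hκs hκc.isCompact).mul_continuousOn hκ.continuousOn
      hκc.isCompact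
  exact IntegrableOn.of_forall_sdiff_eq_zero h1 measurableSet_Ioo fun t ht => by
    rw [image_eq_zero_of_notMem_tsupport ht.2, mul_zero]

/-- The primitive is absolutely continuous with derivative `v` almost everywhere; integration by
parts has no boundary terms since `ζ` vanishes at the ends. -/
theorem hasZeroIntegral_primitive_mul_deriv (hv : LocallyIntegrableOn v (Ioo a b))
    (hc : c ∈ Ioo a b) {ζ : ℝ → ℝ} (hζ : ContDiff ℝ ∞ ζ) (hζc : HasCompactSupport ζ)
    (hζs : tsupport ζ ⊆ Ioo a b) :
    HasZeroIntegral (volume.restrict (Ioo a b))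
      fun t => (∫ s in c..t, v s) * deriv ζ t + v t * ζ t := by
  have hd : Continuous (deriv ζ) := hζ.continuous_deriv (by simp)
  have hds : tsupport (deriv ζ) ⊆ tsupport ζ := tsupport_deriv_subset
  refine ⟨(integrable_mul_of_tsupport_subset
    ((continuousOn_primitive_of_locallyIntegrableOn hv hc).locallyIntegrableOn measurableSet_Ioo)
    hd hζc.deriv (hds.trans hζs)).add
    (integrable_mul_of_tsupport_subset hv hζ.continuous hζc hζs), ?_⟩
  obtain ⟨A, B, hA, hAc, hcB, hB, hs⟩ := exists_Ioo_of_isCompact hζc.isCompact hζs hc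
  have hAB : A ≤ B := (hAc.trans hcB).le
  have hvi := intervalIntegrable_of_locallyIntegrableOn hv (x := A) (y := B)
    ⟨hA, hAc.trans hc.2⟩ ⟨hc.1.trans hcB, hB⟩
  have h0 : ∀ t, t ∉ Ioo A B → ζ t = 0 := fun t ht =>
    image_eq_zero_of_notMem_tsupport fun h => ht (hs h)
  have h0' : ∀ t, t ∉ Ioo A B → deriv ζ t = 0 := fun t ht =>
    image_eq_zero_of_notMem_tsupport fun h => ht (hs (hds h))
  have e1 : ∫ t in Ioo a b, ((∫ s in c..t, v s) * deriv ζ t + v t * ζ t) =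
      ∫ t in Ioc A B, ((∫ s in c..t, v s) * deriv ζ t + v t * ζ t) := by
    refine setIntegral_eq_of_subset_of_forall_sdiff_eq_zero measurableSet_Ioo
      (fun t ht => ⟨hA.trans ht.1, ht.2.trans_lt hB⟩) fun t ht => ?_
    have : t ∉ Ioo A B := fun h => ht.2 (Ioo_subset_Ioc_self h)
    rw [h0 t this, h0' t this, mul_zero, mul_zero, add_zero]
  have hcm : c ∈ uIcc A B := by rw [uIcc_of_le hAB]; exact ⟨hAc.le, hcB.le⟩
  have e2 := AbsolutelyContinuousOnInterval.integral_deriv_mul_eq_sub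
    (hvi.absolutelyContinuousOnInterval_intervalIntegral hcm)
    (ContDiffOn.absolutelyContinuousOnInterval (f := ζ) (a := A) (b := B)
      (hζ.of_le (by simp)).contDiffOn)
  rw [h0 A (by simp), h0 B (by simp), mul_zero, mul_zero, sub_zero] at e2
  rw [e1, ← intervalIntegral.integral_of_le hAB, ← e2]
  refine intervalIntegral.integral_congr_ae ?_
  filter_upwards [hvi.ae_hasDerivAt_integral] with t ht htm
  rw [(ht (uIoc_subset_uIcc htm) c hcm).deriv]
  ring

/-- The primitive from the left end vanishes to the left of the support, and to the right of it
because the mean is zero. -/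
theorem exists_primitive_of_integral_eq_zero {ψ : ℝ → ℝ} (hψ : ContDiff ℝ ∞ ψ)
    (hψc : HasCompactSupport ψ) (hψs : tsupport ψ ⊆ Ioo a b) (hab : a < b)
    (h0 : ∫ t, ψ t = 0) : ∃ ζ : ℝ → ℝ, ContDiff ℝ ∞ ζ ∧ HasCompactSupport ζ ∧
      tsupport ζ ⊆ Ioo a b ∧ deriv ζ = ψ := by
  obtain ⟨c, hc⟩ := exists_between hab
  obtain ⟨A, B, hA, hAc, hcB, hB, hs⟩ := exists_Ioo_of_isCompact hψc.isCompact hψs hc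
  have hAB : A ≤ B := (hAc.trans hcB).le
  have hz : ∀ t, t ∉ Ioo A B → ψ t = 0 := fun t ht =>
    image_eq_zero_of_notMem_tsupport fun h => ht (hs h)
  have hd : ∀ t, HasDerivAt (fun t => ∫ s in A..t, ψ s) (ψ t) t := fun t =>
    intervalIntegral.integral_hasDerivAt_right (hψ.continuous.intervalIntegrable _ _)
      (hψ.continuous.stronglyMeasurableAtFilter _ _) hψ.continuous.continuousAt
  have hdd : deriv (fun t => ∫ s in A..t, ψ s) = ψ := funext fun t => (hd t).deriv
  have hAB0 : ∫ s in A..B, ψ s = 0 := by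
    rw [intervalIntegral.integral_of_le hAB, ← h0]
    exact setIntegral_eq_integral_of_forall_compl_eq_zero
      fun t ht => hz t fun h => ht (Ioo_subset_Ioc_self h)
  have hsup : tsupport (fun t => ∫ s in A..t, ψ s) ⊆ Icc A B := by
    refine closure_minimal (fun t ht => ?_) isClosed_Icc
    by_contra hcon
    refine ht ?_
    rcases lt_or_ge t A with h | h
    · change ∫ s in A..t, ψ s = 0
      refine intervalIntegral.integral_zero_ae (Eventually.of_forall fun s hs => hz s ?_)
      rw [uIoc_of_ge h.le] at hs
      exact fun h' => absurd h'.1 (not_lt.2 hs.2)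
    · have hBt : B < t := not_le.1 fun h' => hcon ⟨h, h'⟩
      change ∫ s in A..t, ψ s = 0
      rw [← intervalIntegral.integral_add_adjacent_intervals
        (hψ.continuous.intervalIntegrable A B) (hψ.continuous.intervalIntegrable B t), hAB0,
        zero_add]
      refine intervalIntegral.integral_zero_ae (Eventually.of_forall fun s hs => hz s ?_)
      rw [uIoc_of_le hBt.le] at hs
      exact fun h' => absurd h'.2 (not_lt.2 hs.1.le)
  refine ⟨fun t => ∫ s in A..t, ψ s, ?_, ?_, ?_, hdd⟩
  · rw [contDiff_infty_iff_deriv, hdd]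
    exact ⟨fun t => (hd t).differentiableAt, hψ⟩
  · exact isCompact_Icc.of_isClosed_subset (isClosed_tsupport _) hsup
  · exact hsup.trans fun t ht => ⟨hA.trans_le ht.1, ht.2.trans_lt hB⟩

theorem exists_ae_eq_const_of_integral_mul_deriv_eq_zero (hq : LocallyIntegrableOn q (Ioo a b))
    (h : ∀ ζ : ℝ → ℝ, ContDiff ℝ ∞ ζ → HasCompactSupport ζ → tsupport ζ ⊆ Ioo a b →
      ∫ t in Ioo a b, q t * deriv ζ t = 0) :
    ∃ C : ℝ, ∀ᵐ t, t ∈ Ioo a b → q t = C := by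
  rcases le_or_gt b a with hab | hab
  · exact ⟨0, Eventually.of_forall fun t ht => absurd (ht.1.trans ht.2) (not_lt.2 hab)⟩
  have hw : 0 < (b - a) / 4 := by linarith
  let χ : ContDiffBump ((a + b) / 2 : ℝ) := ⟨(b - a) / 8, (b - a) / 4, by linarith, by linarith⟩
  set φ₀ := χ.normed volume with hφ₀
  have d0 : ContDiff ℝ ∞ φ₀ := χ.contDiff_normed
  have c0 : HasCompactSupport φ₀ := χ.hasCompactSupport_normed
  have s0 : tsupport φ₀ ⊆ Ioo a b := by
    rw [hφ₀, χ.tsupport_normed_eq, Real.closedBall_eq_Icc]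
    change Icc ((a + b) / 2 - (b - a) / 4) ((a + b) / 2 + (b - a) / 4) ⊆ _
    intro t ht
    constructor <;> linarith [ht.1, ht.2]
  have i0 : ∫ t, φ₀ t = 1 := χ.integral_normed
  set C := ∫ t in Ioo a b, q t * φ₀ t with hC
  refine ⟨C, ?_⟩
  have hqC : LocallyIntegrableOn (fun t => q t - C) (Ioo a b) := hq.sub (locallyIntegrableOn_const C)
  refine (isOpen_Ioo.ae_eq_zero_of_integral_contDiff_smul_eq_zero hqC
    fun φ dφ cφ sφ => ?_).mono fun t ht hm => sub_eq_zero.1 (ht hm)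
  -- Subtracting `I` times the normalized bump gives a function of mean zero, hence the derivative
  -- of a test function; the hypothesis applies to it and identifies `C`.
  set I := ∫ t, φ t with hI
  have hψs : tsupport (fun t => φ t - I * φ₀ t) ⊆ Ioo a b := by
    refine (closure_minimal (fun t ht => ?_) ((isClosed_tsupport φ).union (isClosed_tsupport φ₀))).trans
      (union_subset sφ s0)
    by_contra hcon
    rw [mem_union, not_or] at hcon
    refine ht ?_
    simp only [image_eq_zero_of_notMem_tsupport hcon.1, image_eq_zero_of_notMem_tsupport hcon.2,
      mul_zero, sub_zero]
  have hψc : HasCompactSupport (fun t => φ t - I * φ₀ t) := cφ.sub c0.mul_left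
  have hφi := dφ.continuous.integrable_of_hasCompactSupport cφ (μ := volume)
  have hφ₀i := d0.continuous.integrable_of_hasCompactSupport c0 (μ := volume)
  have h00 : ∫ t, (φ t - I * φ₀ t) = 0 := by
    rw [integral_sub hφi (hφ₀i.const_mul I), integral_const_mul, i0, mul_one, sub_self]
  obtain ⟨ζ, dζ, cζ, sζ, eζ⟩ := exists_primitive_of_integral_eq_zero
    (dφ.sub (contDiff_const.mul d0)) hψc hψs hab h00
  have key := h ζ dζ cζ sζ
  rw [eζ] at key
  have q1 := integrable_mul_of_tsupport_subset hq dφ.continuous cφ sφ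
  have q0 := integrable_mul_of_tsupport_subset hq d0.continuous c0 s0
  have e1 : ∫ t in Ioo a b, q t * (φ t - I * φ₀ t) =
      (∫ t in Ioo a b, q t * φ t) - I * C := by
    rw [hC, ← integral_const_mul, ← integral_sub q1 (q0.const_mul I)]
    exact integral_congr_ae (Eventually.of_forall fun t => by ring)
  have e2 : ∫ t in Ioo a b, φ t = I :=
    setIntegral_eq_integral_of_forall_compl_eq_zero fun t ht =>
      image_eq_zero_of_notMem_tsupport fun h' => ht (sφ h')
  rw [← setIntegral_eq_integral_of_forall_compl_eq_zero (s := Ioo a b) fun t ht => by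
    rw [image_eq_zero_of_notMem_tsupport fun h' => ht (sφ h'), zero_smul]]
  have e3 : ∫ t in Ioo a b, φ t • (q t - C) = (∫ t in Ioo a b, q t * φ t) - C * I := by
    rw [← e2, ← integral_const_mul, ← integral_sub q1 (hφi.integrableOn.const_mul C)]
    exact integral_congr_ae (Eventually.of_forall fun t => by simp only [smul_eq_mul]; ring)
  rw [e3]
  linarith

/-- The lemma of du Bois-Reymond. -/
theorem exists_ae_eq_primitive (hw : LocallyIntegrableOn w (Ioo a b))
    (hv : LocallyIntegrableOn v (Ioo a b)) (hc : c ∈ Ioo a b)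
    (h : ∀ ζ : ℝ → ℝ, ContDiff ℝ ∞ ζ → HasCompactSupport ζ → tsupport ζ ⊆ Ioo a b →
      HasZeroIntegral (volume.restrict (Ioo a b)) fun t => w t * deriv ζ t + v t * ζ t) :
    ∃ C : ℝ, ∀ᵐ t, t ∈ Ioo a b → w t = C + ∫ s in c..t, v s := by
  have hV := (continuousOn_primitive_of_locallyIntegrableOn hv hc).locallyIntegrableOn
    measurableSet_Ioo (μ := volume)
  obtain ⟨C, hC⟩ := exists_ae_eq_const_of_integral_mul_deriv_eq_zero
    (q := fun t => w t - ∫ s in c..t, v s) (hw.sub hV) fun ζ dζ cζ sζ => by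
      have h1 := h ζ dζ cζ sζ
      have h2 := hasZeroIntegral_primitive_mul_deriv hv hc dζ cζ sζ
      have h3 := (h1.add (h2.const_mul (-1))).2
      rw [← h3]
      exact integral_congr_ae (Eventually.of_forall fun t => by ring)
  exact ⟨C, hC.mono fun t ht hm => by linarith [ht hm]⟩

end DuBoisReymond

/-! ### Differentiation of the scaled layer integrals -/

section Scaling

variable {a b T β p q r : ℝ} {h k : ℝ → ℝ}

theorem hasDerivAt_integral_layer {g : ℝ → ℝ} (hg : ContinuousOn g (Ioo a b))
    (hp : T + p * r ^ 2 ∈ Ioo a b) (hq : T + q * r ^ 2 ∈ Ioo a b) :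
    HasDerivAt (fun r => ∫ t in T + p * r ^ 2..T + q * r ^ 2, g t)
      (g (T + q * r ^ 2) * (2 * q * r) - g (T + p * r ^ 2) * (2 * p * r)) r := by
  have hgl := hg.locallyIntegrableOn measurableSet_Ioo (μ := volume)
  have hP : ∀ t ∈ Ioo a b,
      HasDerivAt (fun t => ∫ s in T + p * r ^ 2..t, g s) (g t) t := fun t ht =>
    intervalIntegral.integral_hasDerivAt_right
      (intervalIntegrable_of_locallyIntegrableOn hgl hp ht)
      (hg.stronglyMeasurableAtFilter isOpen_Ioo t ht) (hg.continuousAt (isOpen_Ioo.mem_nhds ht))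
  have hd : ∀ s : ℝ, HasDerivAt (fun r : ℝ => T + s * r ^ 2) (2 * s * r) r := fun s => by
    have := ((hasDerivAt_pow 2 r).const_mul s).const_add T
    refine this.congr_deriv ?_
    norm_num
    ring
  have hev : ∀ s : ℝ, T + s * r ^ 2 ∈ Ioo a b → ∀ᶠ r' in 𝓝 r, T + s * r' ^ 2 ∈ Ioo a b :=
    fun s hs => (hd s).continuousAt.eventually (isOpen_Ioo.mem_nhds hs)
  refine (((hP _ hq).comp r (hd q)).sub ((hP _ hp).comp r (hd p))).congr_of_eventuallyEq ?_
  filter_upwards [hev p hp, hev q hq] with r' hp' hq'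
  exact (intervalIntegral.integral_interval_sub_left
    (intervalIntegrable_of_locallyIntegrableOn hgl hp hq')
    (intervalIntegrable_of_locallyIntegrableOn hgl hp hp')).symm

/-- The hypothesis says `(2(t - T)h)' = 2βh + k` weakly. At an endpoint `t = T + q r²` the speed is
`2qr`, so the boundary term is `2(t - T)h / r`. The difference of the two boundary terms is `(2β ∫h
+ ∫k) / r`, and its first part cancels the derivative of `r^(-2β)`. -/
theorem hasDerivAt_rpow_mul_integral_layer (hh : LocallyIntegrableOn h (Ioo a b))
    (hk : LocallyIntegrableOn k (Ioo a b)) (hT : T ∉ Ioo a b)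
    (hzero : ∀ ζ : ℝ → ℝ, ContDiff ℝ ∞ ζ → HasCompactSupport ζ → tsupport ζ ⊆ Ioo a b →
      HasZeroIntegral (volume.restrict (Ioo a b))
        fun t => h t * (2 * β * ζ t + 2 * (t - T) * deriv ζ t) + k t * ζ t)
    (hr : 0 < r) (hp : T + p * r ^ 2 ∈ Ioo a b) (hq : T + q * r ^ 2 ∈ Ioo a b) :
    HasDerivAt (fun r => r ^ (-2 * β) * ∫ t in T + p * r ^ 2..T + q * r ^ 2, h t)
      (r ^ (-2 * β - 1) * ∫ t in T + p * r ^ 2..T + q * r ^ 2, k t) r := by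
  have hv : LocallyIntegrableOn (fun t => 2 * β * h t + k t) (Ioo a b) :=
    (hh.continuousOn_mul continuousOn_const isOpen_Ioo.isLocallyClosed).add hk
  have hw : LocallyIntegrableOn (fun t => 2 * (t - T) * h t) (Ioo a b) :=
    hh.continuousOn_mul (by fun_prop) isOpen_Ioo.isLocallyClosed
  obtain ⟨C, hC⟩ := exists_ae_eq_primitive hw hv hp fun ζ dζ cζ sζ =>
    (hzero ζ dζ cζ sζ).congr_on measurableSet_Ioo fun t _ => by ring
  set V : ℝ → ℝ := fun t => ∫ s in T + p * r ^ 2..t, (2 * β * h s + k s) with hV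
  have hVc : ContinuousOn V (Ioo a b) := continuousOn_primitive_of_locallyIntegrableOn hv hp
  have hne : ∀ t ∈ Ioo a b, 2 * (t - T) ≠ 0 := fun t ht =>
    mul_ne_zero two_ne_zero (sub_ne_zero.2 fun e => hT (e ▸ ht))
  -- The continuous representative of `h`. Dividing by `t - T` is allowed as `T` is outside the
  -- interval.
  set g : ℝ → ℝ := fun t => (C + V t) / (2 * (t - T)) with hgdef
  have hg : ContinuousOn g (Ioo a b) := (continuousOn_const.add hVc).div (by fun_prop) hne
  have hgh : ∀ᵐ t, t ∈ Ioo a b → h t = g t := hC.mono fun t ht hm => by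
    rw [hgdef, eq_div_iff (hne t hm), ← ht hm]; ring
  have hev : ∀ s : ℝ, T + s * r ^ 2 ∈ Ioo a b → ∀ᶠ r' in 𝓝 r, T + s * r' ^ 2 ∈ Ioo a b :=
    fun s hs => (show ContinuousAt (fun r : ℝ => T + s * r ^ 2) r by fun_prop).eventually
      (isOpen_Ioo.mem_nhds hs)
  have heq : ∀ r', T + p * r' ^ 2 ∈ Ioo a b → T + q * r' ^ 2 ∈ Ioo a b →
      ∫ t in T + p * r' ^ 2..T + q * r' ^ 2, h t = ∫ t in T + p * r' ^ 2..T + q * r' ^ 2, g t :=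
    fun r' hp' hq' => intervalIntegral.integral_congr_ae (hgh.mono fun t ht hm =>
      ht (ordConnected_Ioo.uIcc_subset hp' hq' (uIoc_subset_uIcc hm)))
  have hd := (Real.hasDerivAt_rpow_const (p := -2 * β) (Or.inl hr.ne')).mul
    (hasDerivAt_integral_layer hg hp hq)
  refine (hd.congr_deriv ?_).congr_of_eventuallyEq ?_
  · have hpr : p * r ^ 2 ≠ 0 := fun e => hT (by rw [e, add_zero] at hp; exact hp)
    have hqr : q * r ^ 2 ≠ 0 := fun e => hT (by rw [e, add_zero] at hq; exact hq)
    have hp0 := left_ne_zero_of_mul hpr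
    have hq0 := left_ne_zero_of_mul hqr
    have hr0 := hr.ne'
    have hVp : V (T + p * r ^ 2) = 0 := intervalIntegral.integral_same
    have hVq : V (T + q * r ^ 2) = 2 * β * (∫ t in T + p * r ^ 2..T + q * r ^ 2, g t) +
        ∫ t in T + p * r ^ 2..T + q * r ^ 2, k t := by
      rw [← heq r hp hq, ← intervalIntegral.integral_const_mul]
      exact intervalIntegral.integral_add
        ((intervalIntegrable_of_locallyIntegrableOn hh hp hq).const_mul _)
        (intervalIntegrable_of_locallyIntegrableOn hk hp hq)
    -- The primitive `V` starts at the lower endpoint, so only the constant `C` remains there and it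
    -- cancels in the difference.
    have hgp : g (T + p * r ^ 2) * (2 * p * r) = C / r := by
      rw [hgdef]; simp only [hVp]; field_simp; ring
    have hgq : g (T + q * r ^ 2) * (2 * q * r) = (C + V (T + q * r ^ 2)) / r := by
      rw [hgdef]; field_simp; ring
    have hrp : r ^ (-2 * β) = r ^ (-2 * β - 1) * r := by
      rw [← Real.rpow_add_one hr0]; congr 1; ring
    rw [hgp, hgq, hVq, hrp]
    field_simp
    ring
  · filter_upwards [hev p hp, hev q hq] with r' hp' hq'
    simp only [Pi.mul_apply, heq r' hp' hq']

theorem continuousOn_rpow_mul_integral_layer (hk : LocallyIntegrableOn k (Ioo a b)) (α : ℝ)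
    {J : Set ℝ} (hJ : ∀ r ∈ J, 0 < r ∧ T + p * r ^ 2 ∈ Ioo a b ∧ T + q * r ^ 2 ∈ Ioo a b) :
    ContinuousOn (fun r => r ^ α * ∫ t in T + p * r ^ 2..T + q * r ^ 2, k t) J := by
  refine ContinuousOn.mul (fun r hr => (Real.continuousAt_rpow_const _ _
    (Or.inl (hJ r hr).1.ne')).continuousWithinAt) ?_
  rcases J.eq_empty_or_nonempty with rfl | ⟨r₀, hr₀⟩
  · exact continuousOn_empty _
  have hc := (hJ r₀ hr₀).2.1
  have hP := continuousOn_primitive_of_locallyIntegrableOn hk hc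
  have h1 : ∀ s : ℝ, (∀ r ∈ J, T + s * r ^ 2 ∈ Ioo a b) →
      ContinuousOn (fun r => ∫ t in T + p * r₀ ^ 2..T + s * r ^ 2, k t) J := fun s hs =>
    hP.comp (f := fun r : ℝ => T + s * r ^ 2) (by fun_prop) hs
  refine ((h1 q fun r hr => (hJ r hr).2.2).sub (h1 p fun r hr => (hJ r hr).2.1)).congr
    fun r hr => ?_
  exact (intervalIntegral.integral_interval_sub_left
    (intervalIntegrable_of_locallyIntegrableOn hk hc (hJ r hr).2.2)
    (intervalIntegrable_of_locallyIntegrableOn hk hc (hJ r hr).2.1)).symm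

end Scaling

/-! ### Integration over time slices -/

section Slices

variable {n : ℕ} {a b : ℝ} {f : ST n → ℝ}

theorem integrableOn_slab_slice {A B : ℝ} (hf : IntegrableOn f (slab n A B)) :
    IntegrableOn (fun t => ∫ x, f (t, x)) (Ioo A B) := by
  have : Integrable f ((volume.restrict (Ioo A B)).prod (volume : Measure (E n))) := by
    rw [← Measure.restrict_univ (μ := (volume : Measure (E n))), Measure.prod_restrict]
    exact hf
  exact this.integral_prod_left

theorem setIntegral_slab {A B : ℝ} (hf : IntegrableOn f (slab n A B)) :
    ∫ z in slab n A B, f z = ∫ t in Ioo A B, ∫ x, f (t, x) := by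
  have := setIntegral_prod (μ := volume) (ν := volume) f hf
  rwa [Measure.restrict_univ] at this

theorem TimeLocInt.locallyIntegrableOn_slice (hf : TimeLocInt a b f) :
    LocallyIntegrableOn (fun t => ∫ x, f (t, x)) (Ioo a b) := by
  intro t ht
  obtain ⟨A, hA, hAt⟩ := exists_between ht.1
  obtain ⟨B, htB, hB⟩ := exists_between ht.2
  exact ⟨Ioo A B, mem_nhdsWithin_of_mem_nhds (Ioo_mem_nhds hAt htB),
    integrableOn_slab_slice (hf A B hA hB)⟩

end Slices

/-! ### The monotonicity formula for a family of layers -/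

section Layers

variable {m n : ℕ} {F : E m → ℝ} {a b T β : ℝ} {x₀ : E n} {u ut : ST n → E m}
  {Du : ST n → Fin m → E n}

theorem TimeLocInt.ae_integrable_slice {f : ST n → ℝ} (hf : TimeLocInt a b f) :
    ∀ᵐ t, t ∈ Ioo a b → Integrable fun x => f (t, x) := by
  refine ae_of_mem_of_ae_of_mem_inter_Ioo fun A B hA hB _ => ?_
  have h1 : Integrable f ((volume.restrict (Ioo A B)).prod (volume : Measure (E n))) := by
    rw [← Measure.restrict_univ (μ := (volume : Measure (E n))), Measure.prod_restrict]
    exact hf A B hA.1 hB.2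
  exact ((ae_restrict_iff' measurableSet_Ioo).1 h1.prod_right_ae).mono fun t ht hm => ht hm.2

theorem HasZeroIntegral.slice {f : ST n → ℝ}
    (hf : HasZeroIntegral (volume.restrict (slab n a b)) f) :
    HasZeroIntegral (volume.restrict (Ioo a b)) fun t => ∫ x, f (t, x) :=
  ⟨integrableOn_slab_slice hf.1, by rw [← setIntegral_slab hf.1]; exact hf.2⟩

theorem HasZeroIntegral.congr_ae {X : Type*} [MeasurableSpace X] {μ : Measure X} {f g : X → ℝ}
    (hf : HasZeroIntegral μ f) (h : f =ᵐ[μ] g) : HasZeroIntegral μ g :=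
  ⟨hf.1.congr h, by rw [← integral_congr_ae h]; exact hf.2⟩

theorem TimeLocInt.setIntegral_slab_eq {f : ST n → ℝ} (hf : TimeLocInt a b f) {A B : ℝ}
    (hA : A ∈ Ioo a b) (hB : B ∈ Ioo a b) (hAB : A ≤ B) :
    ∫ z in slab n A B, f z = ∫ t in A..B, ∫ x, f (t, x) := by
  rw [setIntegral_slab (hf A B hA.1 hB.2), intervalIntegral.integral_of_le hAB,
    integral_Ioc_eq_integral_Ioo]

/-- Both halves of the theorem at once: the layers enter only through the coefficients `p ≤ q` of
`r²` and the condition that the interval avoids `T`. -/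
theorem IsVariationalSolution.monotonicity_of_layers (h : IsVariationalSolution F a b u ut Du)
    (hT : T ∉ Ioo a b)
    (hE : TimeLocInt a b fun z => heatKernel T x₀ z * energy F u Du z)
    (hU : TimeLocInt a b fun z => heatKernel T x₀ z * ‖u z‖ ^ 2)
    (hUt : TimeLocInt a b fun z => heatKernel T x₀ z * ‖ut z‖ ^ 2)
    (hB : TimeLocInt a b fun z => heatKernel T x₀ z * bulk F β u z)
    {p q R : ℝ} (hpq : p ≤ q)
    (hR : ∀ r ∈ Ioo 0 R, T + p * r ^ 2 ∈ Ioo a b ∧ T + q * r ^ 2 ∈ Ioo a b)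
    {L : ℝ → Set (ST n)} (hL : ∀ r, L r = slab n (T + p * r ^ 2) (T + q * r ^ 2))
    (hβ : ∀ r ∈ Ioo 0 R, 0 ≤ ∫ z in L r, heatKernel T x₀ z * bulk F β u z) :
    (∀ r ∈ Ioo 0 R,
        IntegrableOn (fun z => energy F u Du z * heatKernel T x₀ z) (L r) ∧
        IntegrableOn (fun z => 1 / (T - z.1) * ‖u z‖ ^ 2 * heatKernel T x₀ z) (L r) ∧
        IntegrableOn (fun z => 1 / (T - z.1) * defect β T x₀ u ut Du z * heatKernel T x₀ z)
          (L r)) ∧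
      (∀ ρ σ : ℝ, 0 < ρ → ρ < σ → σ < R →
        IntervalIntegrable (fun r : ℝ => 2 * r ^ (-2 * β - 1) *
          ∫ z in L r, bulk F β u z * heatKernel T x₀ z) volume ρ σ ∧
        IntervalIntegrable (fun r : ℝ => r ^ (-2 * β - 1) *
          ∫ z in L r, 1 / (T - z.1) * defect β T x₀ u ut Du z * heatKernel T x₀ z) volume ρ σ ∧
        Psi F β T x₀ u Du L σ - Psi F β T x₀ u Du L ρ =
          (∫ r in ρ..σ, 2 * r ^ (-2 * β - 1) * ∫ z in L r, bulk F β u z * heatKernel T x₀ z) +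
          (∫ r in ρ..σ, r ^ (-2 * β - 1) *
            ∫ z in L r, 1 / (T - z.1) * defect β T x₀ u ut Du z * heatKernel T x₀ z) ∧
        0 ≤ (∫ r in ρ..σ, 2 * r ^ (-2 * β - 1) *
            ∫ z in L r, bulk F β u z * heatKernel T x₀ z) +
          (∫ r in ρ..σ, r ^ (-2 * β - 1) *
            ∫ z in L r, 1 / (T - z.1) * defect β T x₀ u ut Du z * heatKernel T x₀ z)) ∧
      MonotoneOn (Psi F β T x₀ u Du L) (Ioo 0 R) := by
  have tE : TimeLocInt a b fun z => energy F u Du z * heatKernel T x₀ z :=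
    hE.congr fun z _ => mul_comm _ _
  have tB : TimeLocInt a b fun z => bulk F β u z * heatKernel T x₀ z :=
    hB.congr fun z _ => mul_comm _ _
  have tU : TimeLocInt a b fun z => 1 / (T - z.1) * ‖u z‖ ^ 2 * heatKernel T x₀ z :=
    (hU.mul_continuousOn (continuousOn_inv_time hT)).congr fun z _ => by ring
  have tD := h.timeLocInt_defect hT hE hU hUt hB
  set e : ST n → ℝ := fun z => energy F u Du z * heatKernel T x₀ z with he
  set w : ST n → ℝ := fun z => 1 / (T - z.1) * ‖u z‖ ^ 2 * heatKernel T x₀ z with hw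
  set g : ST n → ℝ := fun z => bulk F β u z * heatKernel T x₀ z with hg
  set d : ST n → ℝ := fun z => 1 / (T - z.1) * defect β T x₀ u ut Du z * heatKernel T x₀ z with hd
  have tH : TimeLocInt a b fun z => e z + -(β / 2) * w z := tE.add (tU.const_mul _)
  have tK : TimeLocInt a b fun z => 2 * g z + d z := (tB.const_mul 2).add tD
  have hint : ∀ r ∈ Ioo 0 R, ∀ {f : ST n → ℝ}, TimeLocInt a b f → IntegrableOn f (L r) :=
    fun r hr f hf => by rw [hL]; exact hf _ _ (hR r hr).1.1 (hR r hr).2.2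
  have hle : ∀ r : ℝ, T + p * r ^ 2 ≤ T + q * r ^ 2 := fun r => by
    have := mul_le_mul_of_nonneg_right hpq (sq_nonneg r)
    linarith
  have hval : ∀ r ∈ Ioo 0 R, ∀ {f : ST n → ℝ}, TimeLocInt a b f →
      ∫ z in L r, f z = ∫ t in T + p * r ^ 2..T + q * r ^ 2, ∫ x, f (t, x) := fun r hr f hf => by
    rw [hL]; exact hf.setIntegral_slab_eq (hR r hr).1 (hR r hr).2 (hle r)
  have hzero : ∀ ζ : ℝ → ℝ, ContDiff ℝ ∞ ζ → HasCompactSupport ζ → tsupport ζ ⊆ Ioo a b →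
      HasZeroIntegral (volume.restrict (Ioo a b)) fun t =>
        (∫ x, (e (t, x) + -(β / 2) * w (t, x))) * (2 * β * ζ t + 2 * (t - T) * deriv ζ t) +
          (∫ x, (2 * g (t, x) + d (t, x))) * ζ t := by
    intro ζ dζ cζ sζ
    refine (h.hasZeroIntegral_time hT hE hU hUt hB dζ cζ sζ).slice.congr_ae ?_
    rw [EventuallyEq, ae_restrict_iff' measurableSet_Ioo]
    -- Splitting the slice integral requires integrability in `x`, available for almost every `t`.
    filter_upwards [tH.ae_integrable_slice, tK.ae_integrable_slice] with t h1 h2 ht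
    rw [← integral_mul_const, ← integral_mul_const,
      ← integral_add ((h1 ht).mul_const _) ((h2 ht).mul_const _)]
    refine integral_congr_ae (Eventually.of_forall fun x => ?_)
    simp only [he, hw, hg, hd]
    ring
  have hPsi : ∀ r ∈ Ioo 0 R, Psi F β T x₀ u Du L r = r ^ (-2 * β) *
      ∫ t in T + p * r ^ 2..T + q * r ^ 2, ∫ x, (e (t, x) + -(β / 2) * w (t, x)) := by
    intro r hr
    rw [← hval r hr tH, integral_add (hint r hr tE) ((hint r hr tU).const_mul _),
      integral_const_mul, Psi]
    ring
  have hI : ∀ ρ σ : ℝ, 0 < ρ → ρ < σ → σ < R → ∀ {f : ST n → ℝ}, TimeLocInt a b f →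
      IntervalIntegrable (fun r : ℝ => r ^ (-2 * β - 1) * ∫ z in L r, f z) volume ρ σ := by
    intro ρ σ hρ hρσ hσ f hf
    have hsub : ∀ r ∈ uIcc ρ σ, r ∈ Ioo 0 R := fun r hr => by
      rw [uIcc_of_le hρσ.le] at hr
      exact ⟨hρ.trans_le hr.1, hr.2.trans_lt hσ⟩
    refine ContinuousOn.intervalIntegrable ((continuousOn_rpow_mul_integral_layer
      (T := T) (p := p) (q := q) hf.locallyIntegrableOn_slice (-2 * β - 1)
      fun r hr => ⟨(hsub r hr).1, hR r (hsub r hr)⟩).congr fun r hr => ?_)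
    rw [hval r (hsub r hr) hf]
  have main : ∀ ρ σ : ℝ, 0 < ρ → ρ < σ → σ < R →
      IntervalIntegrable (fun r : ℝ => 2 * r ^ (-2 * β - 1) * ∫ z in L r, g z) volume ρ σ ∧
      IntervalIntegrable (fun r : ℝ => r ^ (-2 * β - 1) * ∫ z in L r, d z) volume ρ σ ∧
      Psi F β T x₀ u Du L σ - Psi F β T x₀ u Du L ρ =
        (∫ r in ρ..σ, 2 * r ^ (-2 * β - 1) * ∫ z in L r, g z) +
        (∫ r in ρ..σ, r ^ (-2 * β - 1) * ∫ z in L r, d z) ∧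
      0 ≤ (∫ r in ρ..σ, 2 * r ^ (-2 * β - 1) * ∫ z in L r, g z) +
        (∫ r in ρ..σ, r ^ (-2 * β - 1) * ∫ z in L r, d z) := by
    intro ρ σ hρ hρσ hσ
    have hsub : ∀ r ∈ uIcc ρ σ, r ∈ Ioo 0 R := fun r hr => by
      rw [uIcc_of_le hρσ.le] at hr
      exact ⟨hρ.trans_le hr.1, hr.2.trans_lt hσ⟩
    have i1 : IntervalIntegrable (fun r : ℝ => 2 * r ^ (-2 * β - 1) * ∫ z in L r, g z)
        volume ρ σ := by
      simpa only [mul_assoc] using (hI ρ σ hρ hρσ hσ tB).const_mul 2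
    have i2 := hI ρ σ hρ hρσ hσ tD
    have i3 := hI ρ σ hρ hρσ hσ tK
    refine ⟨i1, i2, ?_, add_nonneg ?_ ?_⟩
    -- Differentiability holds at every radius of `[ρ, σ]`, so the fundamental theorem of calculus
    -- gives the formula.
    · have ftc := intervalIntegral.integral_eq_sub_of_hasDerivAt (a := ρ) (b := σ)
        (fun r hr => hasDerivAt_rpow_mul_integral_layer tH.locallyIntegrableOn_slice
          tK.locallyIntegrableOn_slice hT hzero (hsub r hr).1 (hR r (hsub r hr)).1
          (hR r (hsub r hr)).2)
        (i3.congr fun r hr => by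
          simp only [hval r (hsub r (uIoc_subset_uIcc hr)) tK])
      rw [hPsi σ (hsub σ right_mem_uIcc), hPsi ρ (hsub ρ left_mem_uIcc), ← ftc,
        ← intervalIntegral.integral_add i1 i2]
      refine intervalIntegral.integral_congr fun r hr => ?_
      rw [← hval r (hsub r hr) tK, integral_add ((hint r (hsub r hr) tB).const_mul 2)
        (hint r (hsub r hr) tD), integral_const_mul]
      ring
    · refine intervalIntegral.integral_nonneg hρσ.le fun r hr => ?_
      have hr' := hsub r (Icc_subset_uIcc hr)
      have : ∫ z in L r, g z = ∫ z in L r, heatKernel T x₀ z * bulk F β u z :=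
        integral_congr_ae (Eventually.of_forall fun z => mul_comm _ _)
      rw [this]
      exact mul_nonneg (mul_nonneg zero_le_two (Real.rpow_nonneg hr'.1.le _)) (hβ r hr')
    · refine intervalIntegral.integral_nonneg hρσ.le fun r hr => ?_
      refine mul_nonneg (Real.rpow_nonneg (hsub r (Icc_subset_uIcc hr)).1.le _)
        (integral_nonneg fun z => ?_)
      have : d z = 1 / (T - z.1) * heatKernel T x₀ z * defect β T x₀ u ut Du z := by
        simp only [hd]; ring
      rw [this]
      exact mul_nonneg (heatKernel_div_nonneg z) (defect_nonneg β z)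
  refine ⟨fun r hr => ⟨hint r hr tE, hint r hr tU, hint r hr tD⟩, main, fun ρ hρ σ hσ hρσ => ?_⟩
  rcases hρσ.eq_or_lt with rfl | hlt
  · exact le_rfl
  · obtain ⟨-, -, h3, h4⟩ := main ρ σ hρ.1 hlt hσ.2
    rw [← h3] at h4
    linarith

end Layers

/-! ### From the assumptions of the theorem to integrability locally in time -/

section Hypotheses

variable {m n : ℕ} {F : E m → ℝ} {a b t₁ t₂ T β : ℝ} {x₀ : E n} {u ut : ST n → E m}
  {Du : ST n → Fin m → E n}

theorem aestronglyMeasurable_slab {W : Type*} [NormedAddCommGroup W] {v : ST n → W}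
    (hv : ∀ R > 0, MemLp v 2 (volume.restrict (Ioo a b ×ˢ Metric.ball (0 : E n) R))) :
    AEStronglyMeasurable v (volume.restrict (slab n a b)) := by
  have : slab n a b = ⋃ k : ℕ, Ioo a b ×ˢ Metric.ball (0 : E n) (k + 1) := by
    ext z
    simp only [slab, mem_prod, mem_univ, and_true, mem_iUnion, exists_and_left, iff_self_and]
    intro _
    obtain ⟨k, hk⟩ := exists_nat_gt ‖z.2‖
    exact ⟨k, by rw [mem_ball_zero_iff]; linarith⟩
  rw [this, aestronglyMeasurable_iUnion_iff]
  exact fun k => (hv (k + 1) (by positivity)).1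

/-- The kernel is the Gaussian weight times a function of time that is continuous away from `T`. -/
theorem TimeLocInt.heatKernel_mul (hT : T ∉ Ioo a b) {f : ST n → ℝ}
    (hf : TimeLocInt a b fun z => gaussWeight T x₀ z * f z) :
    TimeLocInt a b fun z => heatKernel T x₀ z * f z := by
  have hne : ∀ t ∈ Ioo a b, |4 * Real.pi * (T - t)| ≠ 0 := fun t ht =>
    abs_ne_zero.2 (mul_ne_zero (by positivity) (sub_ne_zero.2 fun e => hT (e ▸ ht)))
  have hc : ContinuousOn
      (fun t => 4 * Real.pi * (T - t) * |4 * Real.pi * (T - t)| ^ (-(n : ℝ) / 2 - 1)) (Ioo a b) := by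
    refine ContinuousOn.mul (by fun_prop) (ContinuousOn.rpow_const (by fun_prop) ?_)
    exact fun t ht => Or.inl (hne t ht)
  exact (hf.mul_continuousOn hc).congr fun z _ => by rw [heatKernel, gaussWeight]; ring

/-- The bulk term is assumed integrable only on single layers; finitely many of them cover the times
in a compact subinterval. -/
theorem timeLocInt_of_layers {f : ST n → ℝ} {L : ℝ → Set ℝ} {J : Set ℝ} (hL : ∀ r, IsOpen (L r))
    (hcov : ∀ t ∈ Ioo a b, ∃ r ∈ J, t ∈ L r) (hf : ∀ r ∈ J, IntegrableOn f (L r ×ˢ univ)) :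
    TimeLocInt a b f := by
  intro A B hA hB
  refine IntegrableOn.mono_set (t := Icc A B ×ˢ univ) ?_ (prod_mono Ioo_subset_Icc_self le_rfl)
  refine isCompact_Icc.induction_on (p := fun s => IntegrableOn f (s ×ˢ (univ : Set (E n))) volume)
    (by simp) (fun s t hst ht => ht.mono_set (prod_mono hst le_rfl))
    (fun s t hs ht => by rw [union_prod]; exact hs.union ht) fun t ht => ?_
  obtain ⟨r, hr, htr⟩ := hcov t ⟨hA.trans_le ht.1, ht.2.trans_lt hB⟩
  exact ⟨L r, mem_nhdsWithin_of_mem_nhds ((hL r).mem_nhds htr), hf r hr⟩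

theorem measurable_gaussWeight : Measurable (gaussWeight T x₀) := by
  unfold gaussWeight
  fun_prop

theorem EnergyBounds.timeLocInt (hb : EnergyBounds F t₁ t₂ T x₀ u ut Du) (hu : IsH1 a b u ut Du)
    (hab : ∀ A B, a < A → B < b →
      ∃ δ > 0, Ioo A B ⊆ Ioo t₁ (T - δ) ∪ Ioo (T + δ) t₂) :
    TimeLocInt a b (fun z => gaussWeight T x₀ z * energy F u Du z) ∧
      TimeLocInt a b (fun z => gaussWeight T x₀ z * ‖u z‖ ^ 2) ∧
      TimeLocInt a b (fun z => gaussWeight T x₀ z * ‖ut z‖ ^ 2) := by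
  have hw0 : ∀ z, 0 ≤ gaussWeight T x₀ z := fun z => (Real.exp_pos _).le
  have hsum : TimeLocInt a b fun z => gaussWeight T x₀ z * (‖ut z‖ ^ 2 + ‖u z‖ ^ 2) := by
    intro A B hA hB
    obtain ⟨δ, hδ, hs⟩ := hab A B hA hB
    exact (hb δ hδ).2.2.mono_set (prod_mono hs le_rfl)
  have hdom : ∀ v : ST n → E m, AEStronglyMeasurable v (volume.restrict (slab n a b)) →
      (∀ z, ‖v z‖ ^ 2 ≤ ‖ut z‖ ^ 2 + ‖u z‖ ^ 2) →
      TimeLocInt a b fun z => gaussWeight T x₀ z * ‖v z‖ ^ 2 := by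
    intro v hv hle A B hA hB
    refine (hsum A B hA hB).mono' (measurable_gaussWeight.aestronglyMeasurable.mul
      ((hv.mono_set ?_).norm.pow 2)) (Eventually.of_forall fun z => ?_)
    · exact prod_mono (Ioo_subset_Ioo hA.le hB.le) le_rfl
    · rw [Real.norm_of_nonneg (mul_nonneg (hw0 z) (sq_nonneg _))]
      exact mul_le_mul_of_nonneg_left (hle z) (hw0 z)
  refine ⟨fun A B hA hB => ?_, hdom u (aestronglyMeasurable_slab hu.memLp) fun z => ?_,
    hdom ut (aestronglyMeasurable_slab hu.memLp_time) fun z => ?_⟩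
  · obtain ⟨δ, hδ, hs⟩ := hab A B hA hB
    exact (hb δ hδ).1.mono_set (prod_mono hs le_rfl)
  · exact le_add_of_nonneg_left (sq_nonneg _)
  · exact le_add_of_nonneg_right (sq_nonneg _)

theorem four_mul_sq_lt_of_lt_sqrt_half {r s : ℝ} (hr : r ∈ Ioo 0 (√s / 2)) : 4 * r ^ 2 < s := by
  have h1 : 2 * r < √s := by linarith [hr.2]
  rw [Real.lt_sqrt (by linarith [hr.1])] at h1
  linarith

theorem exists_radius {s S : ℝ} (hs : 0 < s) (hS : s < S) :
    ∃ r ∈ Ioo 0 (√S / 2), r ^ 2 < s ∧ s < 4 * r ^ 2 := by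
  -- With `r = √τ / 2` one has `4 r² = τ`, so the conditions become `s < τ < 4s` and `τ < S`.
  obtain ⟨τ, h1, h2⟩ := exists_between (lt_min hS (show s < 4 * s by linarith))
  have hτ : 0 < τ := hs.trans h1
  have hsq : (√τ / 2) ^ 2 = τ / 4 := by rw [div_pow, Real.sq_sqrt hτ.le]; norm_num
  refine ⟨√τ / 2, ⟨by positivity, ?_⟩, ?_, ?_⟩
  · have := Real.sqrt_lt_sqrt hτ.le (h2.trans_le (min_le_left _ _))
    linarith
  · rw [hsq]; linarith [h2.trans_le (min_le_right S (4 * s))]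
  · rw [hsq]; linarith

theorem layerMinus_eq (r : ℝ) : layerMinus n T r = slab n (T + -4 * r ^ 2) (T + -1 * r ^ 2) := by
  rw [layerMinus]; congr 1 <;> ring

theorem layerPlus_eq (r : ℝ) : layerPlus n T r = slab n (T + 1 * r ^ 2) (T + 4 * r ^ 2) := by
  rw [layerPlus, one_mul]

end Hypotheses

end ParabolicMonotonicity

theorem theorem3p1 (m n : ℕ) (hm : 1 ≤ m) (hn : 1 ≤ n)
    (F : E m → ℝ) (hF : ContDiff ℝ ∞ F)
    (t₁ t₂ T : ℝ) (ht₁ : t₁ ≤ T) (ht₂ : T ≤ t₂) (x₀ : E n)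
    (u ut : ST n → E m)
    (Du : ST n → Fin m → E n)
    (hu_minus : IsVariationalSolution F t₁ T u ut Du)
    (hu_plus : IsVariationalSolution F T t₂ u ut Du)
    (hbound : EnergyBounds F t₁ t₂ T x₀ u ut Du)
    (β : ℝ)
    (hβ_minus : ∀ r ∈ Ioo 0 (√(T - t₁) / 2),
      IntegrableOn (fun z => heatKernel T x₀ z *
        bulk F β u z) (layerMinus n T r) ∧
      0 ≤ ∫ z in layerMinus n T r,
        heatKernel T x₀ z * bulk F β u z)
    (hβ_plus : ∀ r ∈ Ioo 0 (√(t₂ - T) / 2),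
      IntegrableOn (fun z => heatKernel T x₀ z *
        bulk F β u z) (layerPlus n T r) ∧
      0 ≤ ∫ z in layerPlus n T r,
        heatKernel T x₀ z * bulk F β u z) :
    -- the layers before the time `T`: all integrals converge, the formula, monotonicity
    ((∀ r ∈ Ioo 0 (√(T - t₁) / 2),
        IntegrableOn (fun z => energy F u Du z *
          heatKernel T x₀ z) (layerMinus n T r) ∧
        IntegrableOn (fun z => 1 / (T - z.1) * ‖u z‖ ^ 2 *
          heatKernel T x₀ z) (layerMinus n T r) ∧
        IntegrableOn (fun z => 1 / (T - z.1) *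
          defect β T x₀ u ut Du z *
          heatKernel T x₀ z) (layerMinus n T r)) ∧
      (∀ ρ σ : ℝ, 0 < ρ → ρ < σ → σ < √(T - t₁) / 2 →
        IntervalIntegrable (fun r : ℝ => 2 * r ^ (-2 * β - 1) *
          ∫ z in layerMinus n T r,
            bulk F β u z * heatKernel T x₀ z)
          volume ρ σ ∧
        IntervalIntegrable (fun r : ℝ => r ^ (-2 * β - 1) *
          ∫ z in layerMinus n T r, 1 / (T - z.1) *
            defect β T x₀ u ut Du z *
            heatKernel T x₀ z)
          volume ρ σ ∧
        Psi F β T x₀ u Du (layerMinus n T) σ -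
            Psi F β T x₀ u Du (layerMinus n T) ρ =
          (∫ r in ρ..σ, 2 * r ^ (-2 * β - 1) *
            ∫ z in layerMinus n T r,
              bulk F β u z * heatKernel T x₀ z) +
          (∫ r in ρ..σ, r ^ (-2 * β - 1) *
            ∫ z in layerMinus n T r, 1 / (T - z.1) *
              defect β T x₀ u ut Du z *
              heatKernel T x₀ z) ∧
        0 ≤ (∫ r in ρ..σ, 2 * r ^ (-2 * β - 1) *
            ∫ z in layerMinus n T r,
              bulk F β u z * heatKernel T x₀ z) +
          (∫ r in ρ..σ, r ^ (-2 * β - 1) *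
            ∫ z in layerMinus n T r, 1 / (T - z.1) *
              defect β T x₀ u ut Du z *
              heatKernel T x₀ z)) ∧
      MonotoneOn (Psi F β T x₀ u Du (layerMinus n T))
        (Ioo 0 (√(T - t₁) / 2))) ∧
    -- the layers after the time `T`
    ((∀ r ∈ Ioo 0 (√(t₂ - T) / 2),
        IntegrableOn (fun z => energy F u Du z *
          heatKernel T x₀ z) (layerPlus n T r) ∧
        IntegrableOn (fun z => 1 / (T - z.1) * ‖u z‖ ^ 2 *
          heatKernel T x₀ z) (layerPlus n T r) ∧
        IntegrableOn (fun z => 1 / (T - z.1) *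
          defect β T x₀ u ut Du z *
          heatKernel T x₀ z) (layerPlus n T r)) ∧
      (∀ ρ σ : ℝ, 0 < ρ → ρ < σ → σ < √(t₂ - T) / 2 →
        IntervalIntegrable (fun r : ℝ => 2 * r ^ (-2 * β - 1) *
          ∫ z in layerPlus n T r,
            bulk F β u z * heatKernel T x₀ z)
          volume ρ σ ∧
        IntervalIntegrable (fun r : ℝ => r ^ (-2 * β - 1) *
          ∫ z in layerPlus n T r, 1 / (T - z.1) *
            defect β T x₀ u ut Du z *
            heatKernel T x₀ z)
          volume ρ σ ∧
        Psi F β T x₀ u Du (layerPlus n T) σ -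
            Psi F β T x₀ u Du (layerPlus n T) ρ =
          (∫ r in ρ..σ, 2 * r ^ (-2 * β - 1) *
            ∫ z in layerPlus n T r,
              bulk F β u z * heatKernel T x₀ z) +
          (∫ r in ρ..σ, r ^ (-2 * β - 1) *
            ∫ z in layerPlus n T r, 1 / (T - z.1) *
              defect β T x₀ u ut Du z *
              heatKernel T x₀ z) ∧
        0 ≤ (∫ r in ρ..σ, 2 * r ^ (-2 * β - 1) *
            ∫ z in layerPlus n T r,
              bulk F β u z * heatKernel T x₀ z) +
          (∫ r in ρ..σ, r ^ (-2 * β - 1) *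
            ∫ z in layerPlus n T r, 1 / (T - z.1) *
              defect β T x₀ u ut Du z *
              heatKernel T x₀ z)) ∧
      MonotoneOn (Psi F β T x₀ u Du (layerPlus n T))
        (Ioo 0 (√(t₂ - T) / 2))) := by

  have hTm : T ∉ Ioo t₁ T := fun h => lt_irrefl T h.2
  have hTp : T ∉ Ioo T t₂ := fun h => lt_irrefl T h.1
  -- A subinterval ending at `B < T` keeps the distance `T - B` from `T`, which serves as the `δ` of
  -- the energy bounds; after `T` it is `A - T`.
  obtain ⟨em, um, utm⟩ := hbound.timeLocInt hu_minus.h1 fun A B hA hB =>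
    ⟨T - B, sub_pos.2 hB, fun t ht => Or.inl ⟨hA.trans ht.1, by linarith [ht.2]⟩⟩
  obtain ⟨ep, up, utp⟩ := hbound.timeLocInt hu_plus.h1 fun A B hA hB =>
    ⟨A - T, sub_pos.2 hA, fun t ht => Or.inr ⟨by linarith [ht.1], ht.2.trans hB⟩⟩
  have bm : TimeLocInt t₁ T fun z => heatKernel T x₀ z * bulk F β u z := by
    refine timeLocInt_of_layers (L := fun r => Ioo (T - 4 * r ^ 2) (T - r ^ 2))
      (fun r => isOpen_Ioo) (fun t ht => ?_) fun r hr => (hβ_minus r hr).1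
    obtain ⟨r, hr, h1, h2⟩ := exists_radius (sub_pos.2 ht.2) (show T - t < T - t₁ by linarith [ht.1])
    exact ⟨r, hr, by linarith, by linarith⟩
  have bp : TimeLocInt T t₂ fun z => heatKernel T x₀ z * bulk F β u z := by
    refine timeLocInt_of_layers (L := fun r => Ioo (T + r ^ 2) (T + 4 * r ^ 2))
      (fun r => isOpen_Ioo) (fun t ht => ?_) fun r hr => (hβ_plus r hr).1
    obtain ⟨r, hr, h1, h2⟩ := exists_radius (sub_pos.2 ht.1) (show t - T < t₂ - T by linarith [ht.2])
    exact ⟨r, hr, by linarith, by linarith⟩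
  -- The coefficients are `(-4, -1)` before `T` and `(1, 4)` after it; the bound on `r` amounts to
  -- `4 r² < T - t₁`, respectively `4 r² < t₂ - T`.
  refine ⟨hu_minus.monotonicity_of_layers hTm (em.heatKernel_mul hTm) (um.heatKernel_mul hTm)
    (utm.heatKernel_mul hTm) bm (by norm_num) (fun r hr => ?_) layerMinus_eq
    fun r hr => (hβ_minus r hr).2,
    hu_plus.monotonicity_of_layers hTp (ep.heatKernel_mul hTp) (up.heatKernel_mul hTp)
    (utp.heatKernel_mul hTp) bp (by norm_num) (fun r hr => ?_) layerPlus_eq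
    fun r hr => (hβ_plus r hr).2⟩
  all_goals
    have h1 := four_mul_sq_lt_of_lt_sqrt_half hr
    have h2 : 0 < r ^ 2 := pow_pos hr.1 2
    constructor <;> constructor <;> linarith
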